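/- Let $q_1,\dots,q_d$ be non-zero complex polynomials with $q_k(0)=0$, let $q$ be a complex function with $q(0)=0$, and put $$H(\mathbf z,t)=1-q(t)-\sum_{k=1}^d q_k(t)z_k,\qquad P(t)=H(\mathbf 1,t).$$ Let $\rho$ be the smallest positive root of $P$, and suppose that $q$ is analytic for $|t|\le\rho$ (that is, on a neighbourhood of this disk). Suppose that the power series of $1-H(\mathbf z,t)=q(t)+\sum_k q_k(t)z_k$ at the origin has non-negative real coefficients, and that the exponents appearing in the power series of $q(t)$ have greatest common divisor $1$. Let $G(\mathbf z,t)$ be a complex function, analytic on a neighbourhood of the closed polydisk $|z_1|,\dots,|z_d|\le1$, $|t|\le\rho$, with $G(\mathbf 1,\rho)\ne0$. Let $F=G/H$ and let $f_{\mathbf s,n}=[z_1^{s_1}\cdots z_d^{s_d}t^n]F$ be the coefficients of its power series expansion at the origin. Let $\mathcal H$ be the $d\times d$ matrix with entries $$\mathcal H_{i,j}=\frac{\rho\, q_i(\rho)q_j(\rho)P''(\rho)-\bigl(q_j(\rho)q_i'(\rho)\rho+q_i(\rho)q_j'(\rho)\rho-q_i(\rho)q_j(\rho)\bigr)P'(\rho)}{\rho^2P'(\rho)^3}\quad(i\ne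 j),$$ $$\mathcal H_{j,j}=\frac{\rho\, q_j(\rho)^2P''(\rho)-\bigl(2q_j(\rho)q_j'(\rho)\rho-q_j(\rho)^2\bigr)P'(\rho)-q_j(\rho)\rho P'(\rho)^2}{\rho^2P'(\rho)^3}.$$ Then $$\det\mathcal H=\frac{(-1)^d\left(\prod_{k=1}^dq_k(\rho)\right)\left[(q(\rho)-1)\left(\rho P''(\rho)+P'(\rho)+\rho\sum_{k=1}^d\frac{q_k'(\rho)^2}{q_k(\rho)}\right)+q'(\rho)^2\rho\right]}{P'(\rho)^{d+2}\rho^{d+1}},$$ and $\det\mathcal H$ is non-zero; indeed it is real and positive. Put $$A_n=\rho^{-n}n^{-d/2}\frac{G(\mathbf 1,\rho)}{-\rho P'(\rho)(2\pi)^{d/2}\sqrt{\det\mathcal H}},\qquad \mathbf m=\left(\frac{-q_1(\rho)}{\rho P'(\rho)},\dots,\frac{-q_d(\rho)}{\rho P'(\rho)}\right),$$ $$v_n(\mathbf s)=\exp\left[-\frac{(\mathbf s-n\mathbf m)\mathcal H^{-1}(\mathbf s-n\mathbf m)^T}{2n}\right].$$ Then, as $n\to\infty$, the maximum coefficient of $[t^n]F(\mathbf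 z,t)$ as a series in $z_1,\dots,z_d$ is asymptotic to $A_n$, in the following sense. For all large $n$ there is a coefficient $f_{\mathbf s,n}$ of largest modulus, and for any choice of $\mathbf s(n)$ such that $f_{\mathbf s(n),n}$ has largest modulus for all large $n$, one has $f_{\mathbf s(n),n}/A_n\to1$. If moreover all $f_{\mathbf s,n}$ are real and $G(\mathbf 1,\rho)>0$, the same holds with "largest modulus" replaced by "largest value". Furthermore, $$\sup_{s_1,\dots,s_d\in\mathbb N}\left|\frac{[z_1^{s_1}\cdots z_d^{s_d}t^n]F(\mathbf z,t)}{A_n}-v_n(s_1,\dots,s_d)\right|\to0 .$$ -/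

import Mathlib

open Filter Topology Polynomial
open scoped ComplexOrder Matrix ENNReal

noncomputable section

namespace LinearLCLT

/-- The coefficient of `t ^ n` in the power series expansion of `q` at the origin. -/
def taylorCoeff (q : ℂ → ℂ) (n : ℕ) : ℂ :=
  iteratedDeriv n q 0 / (n.factorial : ℂ)

/-- `f s n` is the coefficient of `z ^ s * t ^ n` in the power series expansion of `F` at the
origin: the series converges (unconditionally) to `F` on a neighbourhood of the origin. -/
def HasExpansion {d : ℕ} (F : (Fin d → ℂ) × ℂ → ℂ) (f : (Fin d → ℕ) → ℕ → ℂ) : Prop :=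
  ∃ r : ℝ, 0 < r ∧ ∀ (z : Fin d → ℂ) (t : ℂ), (∀ k, ‖z k‖ < r) → ‖t‖ < r →
    HasSum (fun a : (Fin d → ℕ) × ℕ => f a.1 a.2 * (∏ k, z k ^ a.1 k) * t ^ a.2) (F (z, t))

/-- `H(z, t) = 1 - q(t) - ∑ k, q_k(t) z_k`. -/
def denom {d : ℕ} (q : ℂ → ℂ) (qs : Fin d → ℂ[X]) (x : (Fin d → ℂ) × ℂ) : ℂ :=
  1 - q x.2 - ∑ k, (qs k).eval x.2 * x.1 k

/-- `P(t) = H(1, t)`. -/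
def diag {d : ℕ} (q : ℂ → ℂ) (qs : Fin d → ℂ[X]) (t : ℂ) : ℂ :=
  denom q qs (fun _ => 1, t)

/-- The closed polydisk `|z_k| ≤ 1`, `|t| ≤ ρ`. -/
def polydisk (d : ℕ) (ρ : ℝ) : Set ((Fin d → ℂ) × ℂ) :=
  {x | (∀ k, ‖x.1 k‖ ≤ 1) ∧ ‖x.2‖ ≤ ρ}

/-- The matrix `ℋ` (its entries are real, although they are computed in `ℂ`). -/
def hessian {d : ℕ} (q : ℂ → ℂ) (qs : Fin d → ℂ[X]) (ρ : ℝ) : Matrix (Fin d) (Fin d) ℂ :=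
  let P1 : ℂ := deriv (diag q qs) ρ
  let P2 : ℂ := deriv (deriv (diag q qs)) ρ
  let Q : Fin d → ℂ := fun k => (qs k).eval (ρ : ℂ)
  let Q' : Fin d → ℂ := fun k => (derivative (qs k)).eval (ρ : ℂ)
  Matrix.of fun i j =>
    if i = j then
      (ρ * Q j ^ 2 * P2 - (2 * Q j * Q' j * ρ - Q j ^ 2) * P1 - Q j * ρ * P1 ^ 2)
        / (ρ ^ 2 * P1 ^ 3)
    else
      (ρ * Q i * Q j * P2 - (Q j * Q' i * ρ + Q i * Q' j * ρ - Q i * Q j) * P1)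
        / (ρ ^ 2 * P1 ^ 3)

/-- The closed form of `det ℋ`. -/
def hessianDet {d : ℕ} (q : ℂ → ℂ) (qs : Fin d → ℂ[X]) (ρ : ℝ) : ℂ :=
  let P1 : ℂ := deriv (diag q qs) ρ
  let P2 : ℂ := deriv (deriv (diag q qs)) ρ
  let Q : Fin d → ℂ := fun k => (qs k).eval (ρ : ℂ)
  let Q' : Fin d → ℂ := fun k => (derivative (qs k)).eval (ρ : ℂ)
  ((-1) ^ d * (∏ k, Q k) *
      ((q ρ - 1) * (ρ * P2 + P1 + ρ * ∑ k, Q' k ^ 2 / Q k) + deriv q ρ ^ 2 * ρ))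
    / (P1 ^ (d + 2) * ρ ^ (d + 1))

/-- The vector `m = (-q_1(ρ) / (ρ P'(ρ)), …, -q_d(ρ) / (ρ P'(ρ)))`. -/
def meanVec {d : ℕ} (q : ℂ → ℂ) (qs : Fin d → ℂ[X]) (ρ : ℝ) (k : Fin d) : ℂ :=
  -(qs k).eval (ρ : ℂ) / (ρ * deriv (diag q qs) ρ)

/-- `A_n = ρ^(-n) n^(-d/2) G(1, ρ) / (-ρ P'(ρ) (2π)^(d/2) √(det ℋ))`; the square root is the
principal one, and `det ℋ` is a positive real number. -/
def peak {d : ℕ} (G : (Fin d → ℂ) × ℂ → ℂ) (q : ℂ → ℂ) (qs : Fin d → ℂ[X]) (ρ : ℝ) (n : ℕ) : ℂ :=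
  ((ρ ^ (-(n : ℤ)) * (n : ℝ) ^ (-(d : ℝ) / 2) : ℝ) : ℂ) *
    (G (fun _ => 1, (ρ : ℂ)) /
      (-ρ * deriv (diag q qs) ρ * (((2 * Real.pi) ^ ((d : ℝ) / 2) : ℝ) : ℂ)
        * (hessian q qs ρ).det ^ (1 / 2 : ℂ)))

/-- `v_n(s) = exp (-(s - n m) ℋ⁻¹ (s - n m)ᵀ / (2 n))`. -/
def gauss {d : ℕ} (q : ℂ → ℂ) (qs : Fin d → ℂ[X]) (ρ : ℝ) (n : ℕ) (s : Fin d → ℕ) : ℂ :=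
  let x : Fin d → ℂ := fun k => (s k : ℂ) - n * meanVec q qs ρ k
  Complex.exp (-(x ⬝ᵥ ((hessian q qs ρ)⁻¹ *ᵥ x)) / (2 * n))

/-- For large `n` the array `(f s n)` (with `n` fixed) has an entry at which `φ` is maximal, and
any such entry is asymptotic to `A n` as `n → ∞`. -/
def MaxAsymptotic {d : ℕ} (φ : ℂ → ℝ) (f : (Fin d → ℕ) → ℕ → ℂ) (A : ℕ → ℂ) : Prop :=
  (∀ᶠ n in atTop, ∃ s, ∀ s', φ (f s' n) ≤ φ (f s n)) ∧
    ∀ σ : ℕ → Fin d → ℕ, (∀ᶠ n in atTop, ∀ s', φ (f s' n) ≤ φ (f (σ n) n)) →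
      Tendsto (fun n => f (σ n) n / A n) atTop (𝓝 1)

end LinearLCLT

end

/-! Since `H(1, ρ) = 0` and all series have non-negative coefficients, the numbers `[tⁿ]q · ρⁿ` and
`[tⁿ]q_k · ρⁿ` form a probability distribution on steps of random length `X = n`, either unmarked or
carrying a mark `k`. For `G = 1`, `f s n · ρⁿ` is the probability that the associated renewal
process hits `n` after collecting `s_k` marks of each type `k`. The theorem is thus a local central
limit theorem; a general `G` contributes only the factor `G(1, ρ)`. In these terms `μ = E X =
-ρP'(ρ)`, `m_k = P(mark k) / μ`, and `ℋ` is `μ⁻¹` times the covariance matrix of the centred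
variables `1_k - m_k X`.

The proof is analytic. Up to `ρⁿ`, the coefficient `[tⁿ]F(z, t)` at `z = e^{iθ}` plays the role of a
characteristic function, and `coeff_eq_integral` recovers `f s n` from it by Cauchy's formula on the
unit torus. The equality case of the triangle inequality, together with gcd `1`, leaves `(1, ρ)` as
the only zero of `H` in the closed polydisk (`Admissible.eq_of_denom_eq_zero`). Hence away from `z =
1` these coefficients are exponentially smaller than `ρ⁻ⁿ` (`Admissible.exists_sliceCoeff_le`). Near
`z = 1` a single simple pole `t = T(z)`, given by the implicit function theorem, produces them up to
an exponentially smaller error (`Admissible.exists_pole`).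

On the torus, `log (T / ρ) = -i m·θ + θᵀℋθ / 2 + O(|θ|³)` (`Moments.isBigO_root`). As `ℋ` is
positive definite, this gives a Gaussian bound on the whole torus and, after `θ = φ / √n`, pointwise
convergence to a Gaussian (`Moments.sliceCoeff_asymptotics`). Dominated convergence then makes the
Fourier coefficients converge uniformly in `s` (`local_limit`).

The determinant formula holds because `ℋ` is a multiple of a diagonal matrix plus one of rank two.
For the maximum, the limiting weight is at most `1` and tends to `1` at the lattice point `⌊n m⌋`,
so the uniform estimate forces the largest entry to be asymptotic to `A_n`. Cauchy estimates on a
polydisk of radius larger than `1` make the coefficients decay in `s`, so that a largest one exists.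
-/

noncomputable section

namespace LinearLCLT

open Asymptotics

/-! ### Taylor coefficients: Cauchy estimates, simple poles, moments -/

section

lemma norm_taylorCoeff_le {g : ℂ → ℂ} {R C : ℝ} (hR : 0 < R)
    (hg : DifferentiableOn ℂ g (Metric.closedBall 0 R))
    (hC : ∀ t ∈ Metric.sphere (0 : ℂ) R, ‖g t‖ ≤ C) (n : ℕ) :
    ‖taylorCoeff g n‖ ≤ C / R ^ n := by
  have h := Complex.norm_iteratedDeriv_le_of_forall_mem_sphere_norm_le n hR
    (hg.diffContOnCl_ball subset_rfl) hC
  have hn : (0 : ℝ) < n.factorial := by positivity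
  rw [taylorCoeff, norm_div, Complex.norm_natCast, div_le_iff₀ hn]
  calc _ ≤ _ := h
    _ = _ := by ring

lemma taylorCoeff_congr {g h : ℂ → ℂ} (hgh : g =ᶠ[𝓝 0] h) (n : ℕ) :
    taylorCoeff g n = taylorCoeff h n := by
  rw [taylorCoeff, taylorCoeff, hgh.iteratedDeriv_eq]

lemma taylorCoeff_add {g h : ℂ → ℂ} (hg : AnalyticAt ℂ g 0) (hh : AnalyticAt ℂ h 0) (n : ℕ) :
    taylorCoeff (fun t => g t + h t) n = taylorCoeff g n + taylorCoeff h n := by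
  have : (fun t => g t + h t) = g + h := rfl
  rw [taylorCoeff, this, iteratedDeriv_add hg.contDiffAt hh.contDiffAt, add_div]
  rfl

lemma taylorCoeff_const_mul_inv_sub {t₀ : ℂ} (ht₀ : t₀ ≠ 0) (r : ℂ) (n : ℕ) :
    taylorCoeff (fun t => r * (t - t₀)⁻¹) n = -(r * (t₀ ^ (n + 1))⁻¹) := by
  have h := congrFun (iter_deriv_inv_linear_sub (𝕜 := ℂ) n 1 t₀) 0
  rw [taylorCoeff, iteratedDeriv_const_mul_field, iteratedDeriv_eq_iterate]
  simp only [one_mul] at h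
  rw [h]
  have hn : (n.factorial : ℂ) ≠ 0 := by exact_mod_cast n.factorial_ne_zero
  have e : (-1 - (n : ℤ)) = -((n + 1 : ℕ) : ℤ) := by push_cast; ring
  rw [e, zpow_neg, zpow_natCast, zero_sub, neg_pow t₀, mul_inv, one_pow]
  have e1 : ((-1 : ℂ) ^ (n + 1))⁻¹ = (-1) ^ (n + 1) := by
    rw [← inv_pow]; norm_num
  rw [e1, pow_succ (-1 : ℂ) n]
  have e2 : ((-1 : ℂ) ^ n) * (-1) ^ n = 1 := by rw [← mul_pow]; norm_num
  field_simp
  linear_combination (-r) * e2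

/-- The Taylor coefficients of a quotient with a single simple pole in a disk. -/
lemma norm_taylorCoeff_div_add_le {g h : ℂ → ℂ} {R M : ℝ} {t₀ : ℂ} {U : Set ℂ} (hU : IsOpen U)
    (hRU : Metric.closedBall 0 R ⊆ U) (hg : DifferentiableOn ℂ g U) (hh : DifferentiableOn ℂ h U)
    (ht₀ : ‖t₀‖ < R) (ht₀' : t₀ ≠ 0) (h0 : h t₀ = 0) (hd : deriv h t₀ ≠ 0)
    (huniq : ∀ t ∈ Metric.closedBall (0 : ℂ) R, h t = 0 → t = t₀)
    (hM : ∀ t ∈ Metric.sphere (0 : ℂ) R, ‖g t / h t‖ ≤ M) (n : ℕ) :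
    ‖taylorCoeff (fun t => g t / h t) n + g t₀ / deriv h t₀ * (t₀ ^ (n + 1))⁻¹‖ ≤
      (M + ‖g t₀ / deriv h t₀‖ / (R - ‖t₀‖)) / R ^ n := by
  have hR : 0 < R := (norm_nonneg _).trans_lt ht₀
  have hmem : t₀ ∈ U := hRU (by simpa using ht₀.le)
  have hUn : U ∈ 𝓝 t₀ := hU.mem_nhds hmem
  set r := g t₀ / deriv h t₀ with hr
  -- Dividing out the zero: `h = (t - t₀) k` with `k` zero-free on the closed disk and `k t₀ = h'
  -- t₀`.
  set k := dslope h t₀ with hk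
  have hkd : DifferentiableOn ℂ k U := (Complex.differentiableOn_dslope hUn).2 hh
  have hkh : ∀ t, h t = (t - t₀) * k t := fun t => by
    have := sub_smul_dslope h t₀ t
    rw [h0, sub_zero] at this
    exact this.symm
  have hk0 : ∀ t ∈ Metric.closedBall (0 : ℂ) R, k t ≠ 0 := by
    intro t ht h1
    have h2 : t = t₀ := huniq t ht (by rw [hkh, h1, mul_zero])
    rw [h2, hk, dslope_same] at h1
    exact hd h1
  set V := U ∩ {t | k t ≠ 0} with hV
  have hVo : IsOpen V := hkd.continuousOn.isOpen_inter_preimage hU isOpen_compl_singleton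
  have hRV : Metric.closedBall 0 R ⊆ V := fun t ht => ⟨hRU ht, hk0 t ht⟩
  set l := fun t => g t / k t with hl
  have hld : DifferentiableOn ℂ l V :=
    (hg.mono Set.inter_subset_left).div (hkd.mono Set.inter_subset_left) fun t ht => ht.2
  have htV : t₀ ∈ V := hRV (by simpa using ht₀.le)
  have hlr : l t₀ = r := by simp [hl, hr, hk, dslope_same]
  -- With `l = g / k`, this is `g / h` minus its polar part `r / (t - t₀)`, already extended
  -- holomorphically across `t₀`. Cauchy's estimate for `D` on the circle of radius `R` is the
  -- claim.
  set D := dslope l t₀ with hD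
  have hDd : DifferentiableOn ℂ D V :=
    (Complex.differentiableOn_dslope (hVo.mem_nhds htV)).2 hld
  have hDeq : ∀ t, t ≠ t₀ → D t = g t / h t + -r * (t - t₀)⁻¹ := by
    intro t ht
    have h1 : t - t₀ ≠ 0 := sub_ne_zero.2 ht
    rw [hD, dslope_of_ne _ ht, slope_def_field, hlr, hkh t, hl]
    simp only [div_eq_mul_inv, mul_inv]
    ring
  have hDeq0 : D =ᶠ[𝓝 0] fun t => g t / h t + -r * (t - t₀)⁻¹ := by
    filter_upwards [isOpen_compl_singleton.mem_nhds (show (0 : ℂ) ∈ ({t₀}ᶜ : Set ℂ) from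
      fun h => ht₀' h.symm)] with t ht using hDeq t ht
  have hU0 : U ∈ 𝓝 (0 : ℂ) := hU.mem_nhds (hRU (by simp [hR.le]))
  have hh0 : h 0 ≠ 0 := fun h1 => ht₀' (huniq 0 (by simp [hR.le]) h1).symm
  have hcoef : taylorCoeff D n =
      taylorCoeff (fun t => g t / h t) n + r * (t₀ ^ (n + 1))⁻¹ := by
    rw [taylorCoeff_congr hDeq0, taylorCoeff_add, taylorCoeff_const_mul_inv_sub ht₀']
    · ring
    · exact (hg.analyticAt hU0).div (hh.analyticAt hU0) hh0
    · exact analyticAt_const.mul ((analyticAt_id.sub analyticAt_const).inv (by simpa using ht₀'))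
  rw [← hcoef]
  refine norm_taylorCoeff_le hR (hDd.mono hRV) (fun t ht => ?_) n
  have htn : ‖t‖ = R := by simpa using ht
  have hne : t ≠ t₀ := by rintro rfl; exact absurd htn ht₀.ne
  rw [hDeq t hne]
  refine (norm_add_le _ _).trans (add_le_add (hM t ht) ?_)
  rw [norm_mul, norm_neg, norm_inv, ← div_eq_mul_inv]
  have h3 : R - ‖t₀‖ ≤ ‖t - t₀‖ := by rw [← htn]; exact norm_sub_norm_le _ _
  exact div_le_div_of_nonneg_left (norm_nonneg _) (by linarith) h3

lemma _root_.HasSum.of_forall_eq {ι : Type*} {f g : ι → ℂ} {a : ℂ} (hf : HasSum f a)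
    (h : ∀ i, f i = g i) : HasSum g a := by
  rwa [← funext h]

lemma hasSum_taylorCoeff {g : ℂ → ℂ} {R : ℝ} (hg : DifferentiableOn ℂ g (Metric.ball 0 R))
    {t : ℂ} (ht : ‖t‖ < R) : HasSum (fun n => taylorCoeff g n * t ^ n) (g t) := by
  refine (Complex.hasSum_taylorSeries_on_ball hg (z := t) (by simpa using ht)).of_forall_eq
    fun n => ?_
  simp only [taylorCoeff, div_eq_inv_mul, smul_eq_mul, sub_zero]
  ring

lemma taylorCoeff_deriv (g : ℂ → ℂ) (n : ℕ) :
    taylorCoeff (deriv g) n = (n + 1) * taylorCoeff g (n + 1) := by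
  have : ((n : ℂ) + 1) ≠ 0 := by exact_mod_cast n.succ_ne_zero
  rw [taylorCoeff, taylorCoeff, iteratedDeriv_succ', Nat.factorial_succ]
  push_cast
  field_simp

/-- Moments of the Taylor series of a function with non-negative Taylor coefficients. -/
lemma exists_moments {g : ℂ → ℂ} {R ρ : ℝ} (hg : DifferentiableOn ℂ g (Metric.ball 0 R))
    (hρ : 0 < ρ) (hρR : ρ < R) (hnn : ∀ n, 0 ≤ taylorCoeff g n) :
    ∃ (α : ℕ → ℝ) (b₀ b₁ b₂ : ℝ), (∀ n, 0 ≤ α n) ∧ (∀ n, (α n : ℂ) = taylorCoeff g n * ρ ^ n) ∧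
      HasSum α b₀ ∧ HasSum (fun n : ℕ => (n : ℝ) * α n) b₁ ∧ HasSum (fun n : ℕ => (n : ℝ) ^ 2 * α n) b₂ ∧
      g ρ = b₀ ∧ ρ * deriv g ρ = b₁ ∧ ρ ^ 2 * deriv (deriv g) ρ + ρ * deriv g ρ = b₂ := by
  have hρn : ‖(ρ : ℂ)‖ < R := by simpa [abs_of_pos hρ] using hρR
  have hg' : DifferentiableOn ℂ (deriv g) (Metric.ball 0 R) := hg.deriv Metric.isOpen_ball
  have hg'' := hg'.deriv Metric.isOpen_ball
  have s0 := hasSum_taylorCoeff hg hρn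
  have s1 := hasSum_taylorCoeff hg' hρn
  have s2 := hasSum_taylorCoeff hg'' hρn
  set α : ℕ → ℝ := fun n => (taylorCoeff g n).re * ρ ^ n with hα
  have hαc : ∀ n, (α n : ℂ) = taylorCoeff g n * ρ ^ n := fun n => by
    have h1 : ((taylorCoeff g n).re : ℂ) = taylorCoeff g n :=
      (Complex.eq_re_of_ofReal_le (r := 0) (by simpa using hnn n)).symm
    rw [hα]; push_cast; rw [h1]
  have t1 : HasSum (fun n : ℕ => ((n * α n : ℝ) : ℂ)) (ρ * deriv g ρ) := by
    rw [← hasSum_nat_add_iff' 1]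
    simp only [Finset.range_one, Finset.sum_singleton, Nat.cast_zero, zero_mul, Complex.ofReal_zero,
      sub_zero]
    refine (s1.mul_left (ρ : ℂ)).of_forall_eq fun n => ?_
    push_cast
    rw [hαc, taylorCoeff_deriv]
    ring
  -- The second factorial moment; adding the first moment turns `n(n - 1)` into `n²`.
  have t2 : HasSum (fun n : ℕ => ((n * (n - 1) * α n : ℝ) : ℂ)) (ρ ^ 2 * deriv (deriv g) ρ) := by
    rw [← hasSum_nat_add_iff' 2]
    simp only [Finset.sum_range_succ, Finset.range_one, Finset.sum_singleton, Nat.cast_zero,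
      zero_mul, Complex.ofReal_zero, Nat.cast_one, sub_self, mul_zero, add_zero, sub_zero]
    refine (s2.mul_left ((ρ : ℂ) ^ 2)).of_forall_eq fun n => ?_
    push_cast
    rw [hαc, taylorCoeff_deriv, taylorCoeff_deriv]
    push_cast
    ring
  have t3 : HasSum (fun n : ℕ => (((n : ℝ) ^ 2 * α n : ℝ) : ℂ))
      (ρ ^ 2 * deriv (deriv g) ρ + ρ * deriv g ρ) := by
    refine (t2.add t1).of_forall_eq fun n => ?_
    push_cast
    ring
  have t0 : HasSum (fun n : ℕ => ((α n : ℝ) : ℂ)) (g ρ) := by simpa only [hαc] using s0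
  have key : ∀ {β : ℕ → ℝ} {c : ℂ}, HasSum (fun n => ((β n : ℝ) : ℂ)) c →
      HasSum β c.re ∧ c = (c.re : ℂ) := by
    intro β c h
    have h1 := Complex.hasSum_re h
    simp only [Complex.ofReal_re] at h1
    exact ⟨h1, h.unique (Complex.hasSum_ofReal.2 h1)⟩
  refine ⟨α, _, _, _, fun n => ?_, hαc, (key t0).1, (key t1).1, (key t3).1, (key t0).2, (key t1).2,
    (key t3).2⟩
  exact mul_nonneg (Complex.le_def.1 (hnn n)).1 (by positivity)

lemma iteratedDeriv_eval (p : ℂ[X]) (n : ℕ) :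
    iteratedDeriv n (fun t => p.eval t) = fun t => (derivative^[n] p).eval t := by
  induction n with
  | zero => simp
  | succ n ih =>
    rw [iteratedDeriv_succ, ih]
    funext t
    rw [Polynomial.deriv, Function.iterate_succ_apply']

lemma taylorCoeff_eval (p : ℂ[X]) (n : ℕ) :
    taylorCoeff (fun t => p.eval t) n = p.coeff n := by
  have hn : (n.factorial : ℂ) ≠ 0 := by exact_mod_cast n.factorial_ne_zero
  rw [taylorCoeff, iteratedDeriv_eval]
  simp only [← coeff_zero_eq_eval_zero, coeff_iterate_derivative, zero_add, Nat.descFactorial_self,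
    nsmul_eq_mul]
  field_simp

end

/-! ### The denominator: moments at `ρ` and uniqueness of the minimal zero -/

section

/-- The standing hypotheses on the denominator; `q` is holomorphic on the disk of radius `R`. -/
structure Admissible {d : ℕ} (q : ℂ → ℂ) (qs : Fin d → ℂ[X]) (ρ R : ℝ) : Prop where
  pos : 0 < ρ
  lt : ρ < R
  root : diag q qs ρ = 0
  ne_zero : ∀ k, qs k ≠ 0
  diff : DifferentiableOn ℂ q (Metric.ball 0 R)
  coeff_nonneg : ∀ k n, 0 ≤ (qs k).coeff n
  taylor_nonneg : ∀ n, 0 ≤ taylorCoeff q n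
  gcd : ∀ m : ℕ, (∀ n, taylorCoeff q n ≠ 0 → m ∣ n) → m = 1

/-- The real moments of the denominator at `ρ`. -/
structure Moments {d : ℕ} (q : ℂ → ℂ) (qs : Fin d → ℂ[X]) (ρ : ℝ) (a₀ a₁ a₂ : ℝ)
    (b₀ b₁ b₂ : Fin d → ℝ) : Prop where
  q_eq : q ρ = a₀
  q1_eq : ρ * deriv q ρ = a₁
  q2_eq : ρ ^ 2 * deriv (deriv q) ρ + ρ * deriv q ρ = a₂
  p_eq : ∀ k, (qs k).eval (ρ : ℂ) = b₀ k
  p1_eq : ∀ k, ρ * (derivative (qs k)).eval (ρ : ℂ) = b₁ k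
  p2_eq : ∀ k, ρ ^ 2 * (derivative (derivative (qs k))).eval (ρ : ℂ)
    + ρ * (derivative (qs k)).eval (ρ : ℂ) = b₂ k
  a1_pos : 0 < a₁
  a2_pos : 0 < a₂
  b0_pos : ∀ k, 0 < b₀ k
  b1_nonneg : ∀ k, 0 ≤ b₁ k
  quad_nonneg : ∀ k x y, 0 ≤ b₂ k * x ^ 2 - 2 * b₁ k * x * y + b₀ k * y ^ 2
  sum_eq : a₀ + ∑ k, b₀ k = 1

lemma diag_eq {d : ℕ} (q : ℂ → ℂ) (qs : Fin d → ℂ[X]) (t : ℂ) :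
    diag q qs t = 1 - q t - ∑ k, (qs k).eval t := by
  simp [diag, denom]

namespace Admissible

variable {d : ℕ} {q : ℂ → ℂ} {qs : Fin d → ℂ[X]} {ρ R : ℝ}

/-- If only the constant term could survive, `2` would divide every exponent of `q`, against gcd
`1`. This is the source of `a₁, a₂ > 0`, hence of the strict positivity of the mean and of the
variance. -/
lemma exists_taylorCoeff_ne_zero (h : Admissible q qs ρ R) :
    ∃ n : ℕ, 1 ≤ n ∧ taylorCoeff q n ≠ 0 := by
  by_contra! hc
  have h2 := h.gcd 2 fun n hn => by
    rcases Nat.eq_zero_or_pos n with rfl | hpos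
    · exact dvd_zero _
    · exact absurd (hc n hpos) hn
  norm_num at h2

lemma exists_moments (h : Admissible q qs ρ R) :
    ∃ a₀ a₁ a₂ b₀ b₁ b₂, Moments q qs ρ a₀ a₁ a₂ b₀ b₁ b₂ := by
  obtain ⟨α, a₀, a₁, a₂, hα, hαc, s0, s1, s2, e0, e1, e2⟩ :=
    LinearLCLT.exists_moments h.diff h.pos h.lt h.taylor_nonneg
  have hp : ∀ k, _ := fun k => LinearLCLT.exists_moments (g := fun t => (qs k).eval t) (R := R)
    (qs k).differentiable.differentiableOn h.pos h.lt
    (fun n => by rw [taylorCoeff_eval]; exact h.coeff_nonneg k n)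
  choose β b₀ b₁ b₂ hβ hβc r0 r1 r2 f0 f1 f2 using hp
  have hd1 : ∀ k, deriv (fun t => (qs k).eval t) = fun t => (derivative (qs k)).eval t :=
    fun k => funext fun t => Polynomial.deriv _
  have hd2 : ∀ k, deriv (fun t => (derivative (qs k)).eval t) =
      fun t => (derivative (derivative (qs k))).eval t :=
    fun k => funext fun t => Polynomial.deriv _
  have hρ : (ρ : ℂ) ≠ 0 := by exact_mod_cast h.pos.ne'
  obtain ⟨n, hn, hqn⟩ := h.exists_taylorCoeff_ne_zero
  have hαn : 0 < α n := by
    refine lt_of_le_of_ne (hα n) fun h0 => ?_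
    have := hαc n
    rw [← h0, Complex.ofReal_zero] at this
    exact mul_ne_zero hqn (pow_ne_zero _ hρ) this.symm
  have hn' : (0 : ℝ) < n := by exact_mod_cast hn
  refine ⟨a₀, a₁, a₂, b₀, b₁, b₂, e0, e1, e2, f0, ?_, ?_, ?_, ?_, ?_, ?_, ?_, ?_⟩
  · intro k; rw [← f1 k, hd1]
  · intro k; rw [← f2 k, hd1, hd2]
  · exact (mul_pos hn' hαn).trans_le
      (le_hasSum s1 n fun j _ => mul_nonneg (Nat.cast_nonneg _) (hα j))
  · exact (mul_pos (pow_pos hn' 2) hαn).trans_le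
      (le_hasSum s2 n fun j _ => mul_nonneg (by positivity) (hα j))
  · intro k
    obtain ⟨j, hj⟩ : ∃ j, (qs k).coeff j ≠ 0 := by
      by_contra! hc
      exact h.ne_zero k (Polynomial.ext fun j => by simpa using hc j)
    refine lt_of_lt_of_le (lt_of_le_of_ne (hβ k j) fun h0 => ?_) (le_hasSum (r0 k) j fun i _ => hβ k i)
    have := hβc k j
    rw [← h0, Complex.ofReal_zero, taylorCoeff_eval] at this
    exact mul_ne_zero hj (pow_ne_zero _ hρ) this.symm
  · intro k
    exact (r1 k).nonneg fun j => mul_nonneg (Nat.cast_nonneg _) (hβ k j)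
  -- The form is the sum over `j` of `β k j (j x - y)²`.
  · intro k x y
    have hs := (((r2 k).mul_right (x ^ 2)).sub ((r1 k).mul_right (2 * x * y))).add
      ((r0 k).mul_right (y ^ 2))
    have := hs.nonneg fun j => by
      have : 0 ≤ β k j * (j * x - y) ^ 2 := mul_nonneg (hβ k j) (sq_nonneg _)
      nlinarith [this]
    linarith
  · have := h.root
    rw [diag_eq, e0] at this
    simp only [f0] at this
    have h2 : ((a₀ + ∑ k, b₀ k : ℝ) : ℂ) = 1 := by
      push_cast; linear_combination -this
    exact_mod_cast h2

/-- In the closed polydisk, the denominator vanishes at `(1, ρ)` only. -/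
lemma eq_of_denom_eq_zero (h : Admissible q qs ρ R) {z : Fin d → ℂ} {t : ℂ}
    (hz : ∀ k, ‖z k‖ ≤ 1) (ht : ‖t‖ ≤ ρ) (h0 : denom q qs (z, t) = 0) :
    t = ρ ∧ z = fun _ => 1 := by
  have hρn : ‖(ρ : ℂ)‖ < R := by simpa [abs_of_pos h.pos] using h.lt
  -- The equality case of `re w ≤ ‖w‖ ≤ r`.
  have key : ∀ {w : ℂ} {r : ℝ}, ‖w‖ ≤ r → w.re = r → w = r := by
    intro w r h1 h2
    have h3 : w.re ^ 2 + w.im ^ 2 ≤ r ^ 2 := by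
      have h5 : ‖w‖ ^ 2 = w.re ^ 2 + w.im ^ 2 := by
        rw [Complex.sq_norm, Complex.normSq_apply]; ring
      rw [← h5]
      exact pow_le_pow_left₀ (norm_nonneg _) h1 2
    have h4 : w.im = 0 := by
      have : w.im ^ 2 ≤ 0 := by rw [h2] at h3; linarith
      nlinarith [sq_nonneg w.im]
    apply Complex.ext <;> simp [h2, h4]
  obtain ⟨α, a₀, a₁, a₂, hα, hαc, s0, -, -, e0, -, -⟩ :=
    LinearLCLT.exists_moments h.diff h.pos h.lt h.taylor_nonneg
  have hp : ∀ k, _ := fun k => LinearLCLT.exists_moments (g := fun t => (qs k).eval t) (R := R)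
    (qs k).differentiable.differentiableOn h.pos h.lt
    (fun n => by rw [taylorCoeff_eval]; exact h.coeff_nonneg k n)
  choose β b₀ b₁ b₂ hβ hβc r0 r1 r2 f0 f1 f2 using hp
  have nrm : ∀ {c : ℂ} {r : ℝ} {n : ℕ}, (r : ℂ) = c * (ρ : ℂ) ^ n → 0 ≤ r → ‖c * t ^ n‖ ≤ r := by
    intro c r n hc hr
    have : r = ‖c‖ * ρ ^ n := by
      have := congrArg norm hc
      simpa [abs_of_nonneg hr, abs_of_pos h.pos] using this
    rw [this, norm_mul, norm_pow]
    gcongr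
  have st := hasSum_taylorCoeff h.diff (ht.trans_lt h.lt)
  have hsq : HasSum (fun n => α n - (taylorCoeff q n * t ^ n).re) (a₀ - (q t).re) :=
    s0.sub (Complex.hasSum_re st)
  have hterm : ∀ n, 0 ≤ α n - (taylorCoeff q n * t ^ n).re := fun n =>
    sub_nonneg.2 ((Complex.re_le_norm _).trans (nrm (hαc n) (hα n)))
  have hA : 0 ≤ a₀ - (q t).re := hsq.nonneg hterm
  have hBn : ∀ k, ‖(qs k).eval t * z k‖ ≤ b₀ k := by
    intro k
    have h1 : ‖(qs k).eval t‖ ≤ b₀ k :=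
      (hasSum_taylorCoeff (R := R) (g := fun t => (qs k).eval t)
        (qs k).differentiable.differentiableOn (ht.trans_lt h.lt)).norm_le_of_bounded (r0 k)
        fun n => nrm (hβc k n) (hβ k n)
    rw [norm_mul]
    exact (mul_le_of_le_one_right (norm_nonneg _) (hz k)).trans h1
  have hB : ∀ k, 0 ≤ b₀ k - ((qs k).eval t * z k).re := fun k =>
    sub_nonneg.2 ((Complex.re_le_norm _).trans (hBn k))
  have hsum1 : a₀ + ∑ k, b₀ k = 1 := by
    have := h.root
    rw [diag_eq, e0] at this
    simp only [f0] at this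
    have h2 : ((a₀ + ∑ k, b₀ k : ℝ) : ℂ) = 1 := by
      push_cast; linear_combination -this
    exact_mod_cast h2
  -- Subtracting the real part of `H(z, t) = 0` from `a₀ + ∑ b₀ k = 1` writes `0` as a sum of
  -- non-negative terms, so each of them vanishes.
  have htot : (a₀ - (q t).re) + ∑ k, (b₀ k - ((qs k).eval t * z k).re) = 0 := by
    have h2 := congrArg Complex.re h0
    simp only [denom, Complex.sub_re, Complex.one_re, Complex.re_sum, Complex.zero_re] at h2
    rw [Finset.sum_sub_distrib]
    linarith
  have hBs : 0 ≤ ∑ k, (b₀ k - ((qs k).eval t * z k).re) := Finset.sum_nonneg fun k _ => hB k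
  have hA0 : a₀ - (q t).re = 0 := by linarith
  have hB0 : ∑ k, (b₀ k - ((qs k).eval t * z k).re) = 0 := by linarith
  have hρ : (ρ : ℂ) ≠ 0 := by exact_mod_cast h.pos.ne'
  have htρ : t = ρ := by
    rw [hA0] at hsq
    have hz := (hasSum_zero_iff_of_nonneg hterm).1 hsq
    -- Every exponent `n` of `q` satisfies `(t / ρ)ⁿ = 1`, so the order of `t / ρ` divides all
    -- exponents and must be `1`.
    have ho := h.gcd (orderOf (t / ρ)) fun n hn => by
      apply orderOf_dvd_of_pow_eq_one
      have h1 : taylorCoeff q n * t ^ n = α n :=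
        key (nrm (hαc n) (hα n)) (sub_eq_zero.1 (congrFun hz n)).symm
      rw [hαc] at h1
      rw [div_pow, mul_left_cancel₀ hn h1, div_self (pow_ne_zero _ hρ)]
    rw [orderOf_eq_one_iff, div_eq_one_iff_eq hρ] at ho
    exact ho
  refine ⟨htρ, funext fun k => ?_⟩
  have h1 := (Finset.sum_eq_zero_iff_of_nonneg fun k _ => hB k).1 hB0 k (Finset.mem_univ _)
  have h2 : (qs k).eval t * z k = b₀ k := key (hBn k) (sub_eq_zero.1 h1).symm
  have h3 : (qs k).eval t = b₀ k := by rw [htρ]; exact f0 k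
  obtain ⟨_, _, _, c₀, _, _, hm⟩ := h.exists_moments
  have h4 : (b₀ k : ℂ) ≠ 0 := by
    rw [(f0 k).symm.trans (hm.p_eq k)]
    exact_mod_cast (hm.b0_pos k).ne'
  rw [h3] at h2
  exact mul_left_cancel₀ h4 (by rw [h2, mul_one])

lemma hasDerivAt_diag (h : Admissible q qs ρ R) {t : ℂ} (ht : ‖t‖ < R) :
    HasDerivAt (diag q qs) (-deriv q t - ∑ k, (derivative (qs k)).eval t) t := by
  have h1 : HasDerivAt q (deriv q t) t :=
    (h.diff.differentiableAt (Metric.isOpen_ball.mem_nhds (by simpa using ht))).hasDerivAt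
  have h2 := (h1.const_sub 1).sub (HasDerivAt.fun_sum (u := Finset.univ)
    fun k _ => (qs k).hasDerivAt t)
  have h3 : diag q qs = (fun t => 1 - q t) - fun t => ∑ k, (qs k).eval t :=
    funext fun t => diag_eq q qs t
  rwa [h3]

lemma norm_rho_lt (h : Admissible q qs ρ R) : ‖(ρ : ℂ)‖ < R := by
  simpa [abs_of_pos h.pos] using h.lt

lemma deriv_diag (h : Admissible q qs ρ R) :
    deriv (diag q qs) ρ = -deriv q ρ - ∑ k, (derivative (qs k)).eval (ρ : ℂ) :=
  (h.hasDerivAt_diag h.norm_rho_lt).deriv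

lemma deriv_deriv_diag (h : Admissible q qs ρ R) :
    deriv (deriv (diag q qs)) ρ =
      -deriv (deriv q) ρ - ∑ k, (derivative (derivative (qs k))).eval (ρ : ℂ) := by
  have hmem : (ρ : ℂ) ∈ Metric.ball (0 : ℂ) R := by simpa using h.norm_rho_lt
  have he : deriv (diag q qs) =ᶠ[𝓝 (ρ : ℂ)]
      fun t => -deriv q t - ∑ k, (derivative (qs k)).eval t := by
    filter_upwards [Metric.isOpen_ball.mem_nhds hmem] with t ht
    exact (h.hasDerivAt_diag (by simpa using ht)).deriv
  rw [he.deriv_eq]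
  have h1 : HasDerivAt (deriv q) (deriv (deriv q) ρ) (ρ : ℂ) :=
    ((h.diff.deriv Metric.isOpen_ball).differentiableAt
      (Metric.isOpen_ball.mem_nhds hmem)).hasDerivAt
  exact (h1.neg.sub (HasDerivAt.fun_sum (u := Finset.univ)
    fun k _ => (derivative (qs k)).hasDerivAt (ρ : ℂ))).deriv

end Admissible

lemma exists_admissible {d : ℕ} {q : ℂ → ℂ} {qs : Fin d → ℂ[X]} {ρ : ℝ}
    (hρ : 0 < ρ) (hroot : diag q qs ρ = 0) (hqs : ∀ k, qs k ≠ 0)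
    (hq : AnalyticOnNhd ℂ q (Metric.closedBall 0 ρ))
    (hqs_nonneg : ∀ k n, 0 ≤ (qs k).coeff n) (hq_nonneg : ∀ n, 0 ≤ taylorCoeff q n)
    (hgcd : ∀ m : ℕ, (∀ n, taylorCoeff q n ≠ 0 → m ∣ n) → m = 1) :
    ∃ R, Admissible q qs ρ R := by
  obtain ⟨δ, hδ, hsub⟩ := (isCompact_closedBall (0 : ℂ) ρ).exists_cthickening_subset_open
    (isOpen_analyticAt ℂ q) (fun t ht => hq t ht)
  rw [cthickening_closedBall hδ.le hρ.le] at hsub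
  refine ⟨δ + ρ, hρ, by linarith, hroot, hqs, fun t ht => ?_, hqs_nonneg, hq_nonneg,
    hgcd⟩
  exact (hsub (Metric.ball_subset_closedBall ht)).differentiableAt.differentiableWithinAt

end

/-! ### The covariance matrix: positivity and determinant -/

section

/-- The covariance matrix `ℋ` in terms of the moments: `μ` is the mean, `M` the second moment. -/
def covMatrix {d : ℕ} (μ M : ℝ) (b₀ b₁ : Fin d → ℝ) : Matrix (Fin d) (Fin d) ℝ :=
  Matrix.of fun i j => (M * (b₀ i / μ) * (b₀ j / μ) - b₀ i / μ * b₁ j - b₁ i * (b₀ j / μ)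
    + if i = j then b₀ i else 0) / μ

/-- Only the two linear forms `m·θ` and `∑ b₁ k θ k` enter, besides a diagonal term. Positive
definiteness is read off this shape, and the expansion of the root produces the same one. -/
lemma dotProduct_covMatrix_mulVec {d : ℕ} (μ M : ℝ) (b₀ b₁ θ : Fin d → ℝ) :
    θ ⬝ᵥ (covMatrix μ M b₀ b₁ *ᵥ θ) = (M * (∑ k, b₀ k / μ * θ k) ^ 2
      - 2 * (∑ k, b₀ k / μ * θ k) * (∑ k, b₁ k * θ k) + ∑ k, b₀ k * θ k ^ 2) / μ := by
  set X := ∑ k, b₀ k / μ * θ k with hX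
  set Y := ∑ k, b₁ k * θ k with hY
  have h1 : ∀ i, (covMatrix μ M b₀ b₁ *ᵥ θ) i =
      (M * (b₀ i / μ) * X - b₀ i / μ * Y - b₁ i * X + b₀ i * θ i) / μ := by
    intro i
    have h3 : ∑ j, (if i = j then b₀ i else 0) * θ j = b₀ i * θ i := by simp
    rw [hX, hY, ← h3, Finset.mul_sum, Finset.mul_sum, Finset.mul_sum, ← Finset.sum_sub_distrib,
      ← Finset.sum_sub_distrib, ← Finset.sum_add_distrib, Finset.sum_div]
    simp only [Matrix.mulVec, dotProduct, covMatrix, Matrix.of_apply]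
    exact Finset.sum_congr rfl fun j _ => by ring
  have h2 : M * X ^ 2 - 2 * X * Y + ∑ k, b₀ k * θ k ^ 2 =
      ∑ i, (M * X * (b₀ i / μ * θ i) - Y * (b₀ i / μ * θ i) - X * (b₁ i * θ i)
        + b₀ i * θ i ^ 2) := by
    rw [Finset.sum_add_distrib, Finset.sum_sub_distrib, Finset.sum_sub_distrib, ← Finset.mul_sum,
      ← Finset.mul_sum, ← Finset.mul_sum, ← hX, ← hY]
    ring
  rw [h2, Finset.sum_div, dotProduct]
  exact Finset.sum_congr rfl fun i _ => by rw [h1]; ring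

/-- A diagonal matrix plus a matrix of rank two. -/
lemma det_covMatrix {d : ℕ} {μ M : ℝ} {b₀ b₁ : Fin d → ℝ} (hμ : μ ≠ 0) (hb : ∀ k, b₀ k ≠ 0) :
    (covMatrix μ M b₀ b₁).det = μ⁻¹ ^ d * (∏ k, b₀ k) *
      ((1 - ∑ k, b₁ k / μ) ^ 2 + (∑ k, b₀ k) / μ ^ 2 * (M - ∑ k, b₁ k ^ 2 / b₀ k)) := by
  -- The factors are chosen so that `μ • covMatrix = diagonal b₀ + U V`. The matrix determinant
  -- lemma then reduces everything to the `2 × 2` determinant of `1 + V (diagonal b₀)⁻¹ U`.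
  set U : Matrix (Fin d) (Fin 2) ℝ :=
    Matrix.of fun i => ![b₀ i / μ, -b₁ i] with hU
  set V : Matrix (Fin 2) (Fin d) ℝ :=
    Matrix.of ![fun j => M * (b₀ j / μ) - b₁ j, fun j => b₀ j / μ] with hV
  have h1 : covMatrix μ M b₀ b₁ = μ⁻¹ • (Matrix.diagonal b₀ + U * V) := by
    ext i j
    simp only [covMatrix, Matrix.of_apply, Matrix.smul_apply, Matrix.add_apply,
      Matrix.diagonal_apply, Matrix.mul_apply, Fin.sum_univ_two, hU, hV, smul_eq_mul,
      Matrix.cons_val_zero, Matrix.cons_val_one]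
    ring
  have hdet : IsUnit (Matrix.diagonal b₀).det := by
    rw [Matrix.det_diagonal]
    exact (Finset.prod_ne_zero_iff.2 fun k _ => hb k).isUnit
  have hinv : (Matrix.diagonal b₀)⁻¹ = Matrix.diagonal fun k => (b₀ k)⁻¹ := by
    refine Matrix.inv_eq_left_inv ?_
    rw [Matrix.diagonal_mul_diagonal]
    simp [hb]
  have hent : ∀ i j, (V * Matrix.diagonal (fun k => (b₀ k)⁻¹) * U) i j =
      ∑ k, V i k * (b₀ k)⁻¹ * U k j := fun i j => by
    rw [Matrix.mul_apply]
    simp only [Matrix.mul_diagonal]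
  have e00 : (V * Matrix.diagonal (fun k => (b₀ k)⁻¹) * U) 0 0 =
      M * ((∑ k, b₀ k) / μ ^ 2) - ∑ k, b₁ k / μ := by
    rw [hent, Finset.sum_div, Finset.mul_sum, ← Finset.sum_sub_distrib]
    simp only [hU, hV, Matrix.of_apply, Matrix.cons_val_zero]
    exact Finset.sum_congr rfl fun k _ => by have := hb k; field_simp
  have e01 : (V * Matrix.diagonal (fun k => (b₀ k)⁻¹) * U) 0 1 =
      -M * (∑ k, b₁ k / μ) + ∑ k, b₁ k ^ 2 / b₀ k := by
    rw [hent, Finset.mul_sum, ← Finset.sum_add_distrib]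
    simp only [hU, hV, Matrix.of_apply, Matrix.cons_val_zero, Matrix.cons_val_one]
    exact Finset.sum_congr rfl fun k _ => by have := hb k; field_simp; ring
  have e10 : (V * Matrix.diagonal (fun k => (b₀ k)⁻¹) * U) 1 0 = (∑ k, b₀ k) / μ ^ 2 := by
    rw [hent, Finset.sum_div]
    simp only [hU, hV, Matrix.of_apply, Matrix.cons_val_zero, Matrix.cons_val_one]
    exact Finset.sum_congr rfl fun k _ => by have := hb k; field_simp
  have e11 : (V * Matrix.diagonal (fun k => (b₀ k)⁻¹) * U) 1 1 = -∑ k, b₁ k / μ := by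
    rw [hent, ← Finset.sum_neg_distrib]
    simp only [hU, hV, Matrix.of_apply, Matrix.cons_val_one, Matrix.cons_val_zero]
    exact Finset.sum_congr rfl fun k _ => by have := hb k; field_simp
  rw [h1, Matrix.det_smul, Matrix.det_add_mul _ _ hdet, Matrix.det_diagonal, hinv,
    Matrix.det_fin_two]
  simp only [Matrix.add_apply, e00, e01, e10, e11, Matrix.one_apply, Fintype.card_fin]
  simp
  ring

namespace Moments

variable {d : ℕ} {q : ℂ → ℂ} {qs : Fin d → ℂ[X]} {ρ R a₀ a₁ a₂ : ℝ} {b₀ b₁ b₂ : Fin d → ℝ}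

lemma mean_pos (hm : Moments q qs ρ a₀ a₁ a₂ b₀ b₁ b₂) : 0 < a₁ + ∑ k, b₁ k :=
  add_pos_of_pos_of_nonneg hm.a1_pos (Finset.sum_nonneg fun k _ => hm.b1_nonneg k)

/-- With `X = m·θ`, `μ` times the quadratic form is `a₂ X²` plus the non-negative forms of
`quad_nonneg` at `(X, θ k)`. If `X ≠ 0`, the first term is positive because `a₂ > 0`; if `X = 0`,
what remains is `∑ b₀ k θ k²`, which is positive for `θ ≠ 0`. -/
lemma posDef_covMatrix (hm : Moments q qs ρ a₀ a₁ a₂ b₀ b₁ b₂) :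
    (covMatrix (a₁ + ∑ k, b₁ k) (a₂ + ∑ k, b₂ k) b₀ b₁).PosDef := by
  have hμ := hm.mean_pos
  refine Matrix.PosDef.of_dotProduct_mulVec_pos ?_ fun θ hθ => ?_
  · ext i j
    simp only [covMatrix, Matrix.conjTranspose_apply, Matrix.of_apply, star_trivial]
    by_cases h : i = j
    · subst h; ring
    · rw [if_neg h, if_neg (Ne.symm h)]; ring
  · rw [star_trivial, dotProduct_covMatrix_mulVec]
    refine div_pos ?_ hμ
    set X := ∑ k, b₀ k / (a₁ + ∑ k, b₁ k) * θ k
    have h1 : (a₂ + ∑ k, b₂ k) * X ^ 2 - 2 * X * (∑ k, b₁ k * θ k) + ∑ k, b₀ k * θ k ^ 2 =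
        a₂ * X ^ 2 + ∑ k, (b₂ k * X ^ 2 - 2 * b₁ k * X * θ k + b₀ k * θ k ^ 2) := by
      rw [Finset.sum_add_distrib, Finset.sum_sub_distrib, ← Finset.sum_mul,
        Finset.mul_sum _ _ (2 * X)]
      have : ∑ k, 2 * X * (b₁ k * θ k) = ∑ k, 2 * b₁ k * X * θ k :=
        Finset.sum_congr rfl fun k _ => by ring
      rw [this]
      ring
    rw [h1]
    by_cases hX : X = 0
    · simp only [hX]
      obtain ⟨k, hk⟩ := Function.ne_iff.1 hθ
      have : 0 < ∑ k, b₀ k * θ k ^ 2 :=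
        Finset.sum_pos' (fun k _ => mul_nonneg (hm.b0_pos k).le (sq_nonneg _))
          ⟨k, Finset.mem_univ _, mul_pos (hm.b0_pos k) (sq_pos_of_ne_zero (by simpa using hk))⟩
      simpa using this
    · exact add_pos_of_pos_of_nonneg (mul_pos hm.a2_pos (by positivity))
        (Finset.sum_nonneg fun k _ => hm.quad_nonneg k _ _)

lemma deriv_diag_eq (hm : Moments q qs ρ a₀ a₁ a₂ b₀ b₁ b₂) (h : Admissible q qs ρ R) :
    ρ * deriv (diag q qs) ρ = -((a₁ + ∑ k, b₁ k : ℝ) : ℂ) := by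
  rw [h.deriv_diag]
  push_cast
  rw [← hm.q1_eq]
  simp only [← hm.p1_eq, ← Finset.mul_sum]
  ring

lemma deriv_deriv_diag_eq (hm : Moments q qs ρ a₀ a₁ a₂ b₀ b₁ b₂) (h : Admissible q qs ρ R) :
    ρ ^ 2 * deriv (deriv (diag q qs)) ρ + ρ * deriv (diag q qs) ρ =
      -((a₂ + ∑ k, b₂ k : ℝ) : ℂ) := by
  rw [h.deriv_diag, h.deriv_deriv_diag]
  push_cast
  rw [← hm.q2_eq]
  simp only [← hm.p2_eq, Finset.sum_add_distrib, ← Finset.mul_sum]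
  ring

lemma meanVec_eq (hm : Moments q qs ρ a₀ a₁ a₂ b₀ b₁ b₂) (h : Admissible q qs ρ R) (k : Fin d) :
    meanVec q qs ρ k = ((b₀ k / (a₁ + ∑ k, b₁ k) : ℝ) : ℂ) := by
  rw [meanVec, hm.deriv_diag_eq h, hm.p_eq, neg_div_neg_eq]
  push_cast
  rfl

lemma hessian_eq (hm : Moments q qs ρ a₀ a₁ a₂ b₀ b₁ b₂) (h : Admissible q qs ρ R) :
    hessian q qs ρ =
      (covMatrix (a₁ + ∑ k, b₁ k) (a₂ + ∑ k, b₂ k) b₀ b₁).map Complex.ofReal := by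
  have hμ : ((a₁ + ∑ k, b₁ k : ℝ) : ℂ) ≠ 0 := by exact_mod_cast hm.mean_pos.ne'
  have hρ : (ρ : ℂ) ≠ 0 := by exact_mod_cast h.pos.ne'
  have e1 := hm.deriv_diag_eq h
  have e2 := hm.deriv_deriv_diag_eq h
  ext i j
  simp only [hessian, covMatrix, Matrix.of_apply, Matrix.map_apply]
  set P1 := deriv (diag q qs) ρ
  set P2 := deriv (deriv (diag q qs)) ρ
  set μ := a₁ + ∑ k, b₁ k
  set M := a₂ + ∑ k, b₂ k
  have hP1 : P1 = -μ / ρ := by rw [eq_div_iff hρ, mul_comm]; exact e1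
  have hP2 : P2 = (-M + μ) / ρ ^ 2 := by
    field_simp
    linear_combination e2 - e1
  have hp1 : ∀ k, (derivative (qs k)).eval (ρ : ℂ) = b₁ k / ρ := fun k => by
    field_simp; rw [mul_comm]; exact hm.p1_eq k
  simp only [hP1, hP2, hp1, hm.p_eq]
  split_ifs with hij
  · subst hij
    push_cast
    field_simp
    ring
  · push_cast
    field_simp
    ring

lemma hessian_det (hm : Moments q qs ρ a₀ a₁ a₂ b₀ b₁ b₂) (h : Admissible q qs ρ R) :
    (hessian q qs ρ).det =
      ((covMatrix (a₁ + ∑ k, b₁ k) (a₂ + ∑ k, b₂ k) b₀ b₁).det : ℂ) := by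
  rw [hm.hessian_eq h]
  exact (RingHom.map_det Complex.ofRealHom _).symm

lemma hessian_inv (hm : Moments q qs ρ a₀ a₁ a₂ b₀ b₁ b₂) (h : Admissible q qs ρ R) :
    (hessian q qs ρ)⁻¹ =
      (covMatrix (a₁ + ∑ k, b₁ k) (a₂ + ∑ k, b₂ k) b₀ b₁)⁻¹.map Complex.ofReal := by
  rw [hm.hessian_eq h]
  refine Matrix.inv_eq_left_inv ?_
  have h1 := Matrix.nonsing_inv_mul _ (hm.posDef_covMatrix.det_pos.ne'.isUnit)
  have h2 := congrArg (fun A : Matrix (Fin d) (Fin d) ℝ => A.map Complex.ofRealHom) h1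
  simp only [Matrix.map_mul] at h2
  exact h2.trans (Matrix.map_one _ (map_zero _) (map_one _))

lemma det_eq_hessianDet (hm : Moments q qs ρ a₀ a₁ a₂ b₀ b₁ b₂) (h : Admissible q qs ρ R) :
    (hessian q qs ρ).det = hessianDet q qs ρ := by
  have hμ : ((a₁ + ∑ k, b₁ k : ℝ) : ℂ) ≠ 0 := by exact_mod_cast hm.mean_pos.ne'
  have hρ : (ρ : ℂ) ≠ 0 := by exact_mod_cast h.pos.ne'
  have hb : ∀ k, (b₀ k : ℂ) ≠ 0 := fun k => by exact_mod_cast (hm.b0_pos k).ne'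
  have e1 := hm.deriv_diag_eq h
  have e2 := hm.deriv_deriv_diag_eq h
  rw [hm.hessian_det h, det_covMatrix hm.mean_pos.ne' fun k => (hm.b0_pos k).ne', hessianDet]
  -- The definition of `μ` and the root equation eliminate the sums of `b₁` and `b₀`; this is where
  -- `q'(ρ)²` and `q(ρ) - 1` in the closed form come from.
  have hs : ∑ k, b₁ k / (a₁ + ∑ k, b₁ k) = 1 - a₁ / (a₁ + ∑ k, b₁ k) := by
    have := hm.mean_pos.ne'
    rw [← Finset.sum_div]
    field_simp
    ring
  have hs0 : ∑ k, b₀ k = 1 - a₀ := by linarith [hm.sum_eq]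
  rw [hs, hs0]
  set P1 := deriv (diag q qs) ρ
  set P2 := deriv (deriv (diag q qs)) ρ
  set μ := a₁ + ∑ k, b₁ k
  set M := a₂ + ∑ k, b₂ k
  have hP1 : P1 = -μ / ρ := by rw [eq_div_iff hρ, mul_comm]; exact e1
  have hP2 : P2 = (-M + μ) / ρ ^ 2 := by
    field_simp
    linear_combination e2 - e1
  have hp1 : ∀ k, (derivative (qs k)).eval (ρ : ℂ) = b₁ k / ρ := fun k => by
    field_simp; rw [mul_comm]; exact hm.p1_eq k
  have hq1 : deriv q ρ = a₁ / ρ := by field_simp; rw [mul_comm]; exact hm.q1_eq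
  have hS : ∑ k, ((b₁ k : ℂ) / ρ) ^ 2 / b₀ k = (∑ k, (b₁ k : ℂ) ^ 2 / b₀ k) / ρ ^ 2 := by
    rw [Finset.sum_div]
    exact Finset.sum_congr rfl fun k _ => by have := hb k; field_simp
  simp only [hP1, hP2, hp1, hm.p_eq, hm.q_eq, hq1, hS]
  push_cast
  set S := ∑ k, (b₁ k : ℂ) ^ 2 / b₀ k
  have h3 : (-(μ : ℂ) / ρ) ^ (d + 2) * (ρ : ℂ) ^ (d + 1) = (-1) ^ d * (μ : ℂ) ^ (d + 2) / ρ := by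
    rw [div_pow, neg_pow (μ : ℂ), pow_add (-1 : ℂ)]
    field_simp
    ring
  rw [h3]
  have h4 : ((-1 : ℂ)) ^ d ≠ 0 := pow_ne_zero _ (by norm_num)
  have h5 : ((μ : ℂ)⁻¹) ^ d = 1 / (μ : ℂ) ^ d := by rw [inv_pow, one_div]
  rw [h5]
  field_simp
  ring

end Moments

end

/-! ### Coefficients in `t` as functions of `z`; Fourier analysis on the torus -/

section

/-- The coefficient of `t ^ n` in `F(z, ·)`. -/
def sliceCoeff {d : ℕ} (F : (Fin d → ℂ) × ℂ → ℂ) (n : ℕ) (z : Fin d → ℂ) : ℂ :=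
  taylorCoeff (fun t => F (z, t)) n

/-- The point `(e^{iθ_1}, …, e^{iθ_d})`. -/
def torus {d : ℕ} (θ : Fin d → ℝ) : Fin d → ℂ := fun k => Complex.exp (θ k * Complex.I)

/-- The cube `(-π, π]^d`. -/
def cube (d : ℕ) : Set (Fin d → ℝ) := Set.univ.pi fun _ => Set.Ioc (-Real.pi) Real.pi

/-- The character `e^{-i s·θ}`. -/
def phase {d : ℕ} (s : Fin d → ℕ) (θ : Fin d → ℝ) : ℂ :=
  ∏ k, Complex.exp (-(s k * θ k * Complex.I))

lemma norm_torus_apply {d : ℕ} (θ : Fin d → ℝ) (k : Fin d) : ‖torus θ k‖ = 1 :=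
  Complex.norm_exp_ofReal_mul_I _

lemma norm_torus_le {d : ℕ} (θ : Fin d → ℝ) : ‖torus θ‖ ≤ 1 :=
  (pi_norm_le_iff_of_nonneg zero_le_one).2 fun k => (norm_torus_apply θ k).le

lemma continuous_torus {d : ℕ} : Continuous (torus : (Fin d → ℝ) → Fin d → ℂ) :=
  continuous_pi fun k => by unfold torus; fun_prop

lemma continuous_phase {d : ℕ} (s : Fin d → ℕ) : Continuous (phase s) := by
  unfold phase; fun_prop

lemma norm_phase {d : ℕ} (s : Fin d → ℕ) (θ : Fin d → ℝ) : ‖phase s θ‖ = 1 := by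
  rw [phase, norm_prod]
  refine Finset.prod_eq_one fun k _ => ?_
  have : -((s k : ℂ) * θ k * Complex.I) = ((-(s k * θ k) : ℝ) : ℂ) * Complex.I := by push_cast; ring
  rw [this, Complex.norm_exp_ofReal_mul_I]

lemma restrict_cube (d : ℕ) : (MeasureTheory.volume : MeasureTheory.Measure (Fin d → ℝ)).restrict
    (cube d) = MeasureTheory.Measure.pi fun _ : Fin d =>
      (MeasureTheory.volume : MeasureTheory.Measure ℝ).restrict (Set.Ioc (-Real.pi) Real.pi) := by
  rw [cube, MeasureTheory.volume_pi, MeasureTheory.Measure.restrict_pi_pi]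

instance (d : ℕ) : MeasureTheory.IsFiniteMeasure
    ((MeasureTheory.volume : MeasureTheory.Measure (Fin d → ℝ)).restrict (cube d)) := by
  rw [restrict_cube]; infer_instance

lemma integral_exp_int_mul (m : ℤ) :
    ∫ x in Set.Ioc (-Real.pi) Real.pi, Complex.exp (m * x * Complex.I) =
      if m = 0 then 2 * (Real.pi : ℂ) else 0 := by
  rw [← intervalIntegral.integral_of_le (by linarith [Real.pi_pos])]
  split_ifs with h
  · subst h
    simp
    ring
  · have hc : (m : ℂ) * Complex.I ≠ 0 := mul_ne_zero (by exact_mod_cast h) Complex.I_ne_zero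
    have e : ∀ x : ℝ, (m : ℂ) * x * Complex.I = m * Complex.I * x := fun x => by ring
    simp only [e]
    rw [integral_exp_mul_complex hc, div_eq_zero_iff, sub_eq_zero]
    left
    have : (m : ℂ) * Complex.I * (Real.pi : ℝ) =
        m * Complex.I * ((-Real.pi : ℝ) : ℂ) + m * (2 * Real.pi * Complex.I) := by
      push_cast; ring
    rw [this, Complex.exp_add, Complex.exp_int_mul_two_pi_mul_I, mul_one]

lemma integral_monomial_mul_phase {d : ℕ} (s s' : Fin d → ℕ) :
    ∫ θ in cube d, (∏ k, torus θ k ^ s' k) * phase s θ =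
      if s' = s then (2 * (Real.pi : ℂ)) ^ d else 0 := by
  have h1 : ∀ θ : Fin d → ℝ, (∏ k, torus θ k ^ s' k) * phase s θ =
      ∏ k, (fun k (x : ℝ) => Complex.exp (((s' k - s k : ℤ) : ℂ) * x * Complex.I)) k (θ k) := by
    intro θ
    rw [phase, ← Finset.prod_mul_distrib]
    refine Finset.prod_congr rfl fun k _ => ?_
    rw [torus, ← Complex.exp_nat_mul, ← Complex.exp_add]
    congr 1
    push_cast
    ring
  rw [MeasureTheory.integral_congr_ae (.of_forall h1), restrict_cube,
    MeasureTheory.integral_fintype_prod_eq_prod (𝕜 := ℂ)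
      (f := fun k (x : ℝ) => Complex.exp (((s' k - s k : ℤ) : ℂ) * x * Complex.I))]
  simp only [integral_exp_int_mul]
  split_ifs with h
  · subst h
    simp
  · obtain ⟨k, hk⟩ := Function.ne_iff.1 h
    refine Finset.prod_eq_zero (Finset.mem_univ k) (if_neg ?_)
    rw [sub_eq_zero]
    exact_mod_cast hk

/-- The `n`-th derivative in `t` is the `n`-th iterate of the directional derivative along `(0, 1)`,
an operation that preserves joint analyticity. -/
lemma analyticAt_sliceCoeff {d : ℕ} {F : (Fin d → ℂ) × ℂ → ℂ} {z : Fin d → ℂ}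
    (hF : AnalyticAt ℂ F (z, 0)) (n : ℕ) : AnalyticAt ℂ (sliceCoeff F n) z := by
  set D : ((Fin d → ℂ) × ℂ → ℂ) → (Fin d → ℂ) × ℂ → ℂ := fun F x => fderiv ℂ F x (0, 1) with hD
  set U : Set ((Fin d → ℂ) × ℂ) := {x | AnalyticAt ℂ F x} with hU
  have hUo : IsOpen U := isOpen_analyticAt ℂ F
  have h1 : ∀ n, ∀ x ∈ U, AnalyticAt ℂ (D^[n] F) x := by
    intro n
    induction n with
    | zero => exact fun x hx => hx
    | succ n ih =>
      intro x hx
      rw [Function.iterate_succ_apply']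
      exact ((ContinuousLinearMap.apply ℂ ℂ ((0, 1) : (Fin d → ℂ) × ℂ)).analyticAt _).comp
        (ih x hx).fderiv
  have h2 : ∀ n z t, (z, t) ∈ U → iteratedDeriv n (fun t => F (z, t)) t = (D^[n] F) (z, t) := by
    intro n
    induction n with
    | zero => intro z t _; simp
    | succ n ih =>
      intro z t hzt
      rw [iteratedDeriv_succ, Function.iterate_succ_apply']
      have hev : iteratedDeriv n (fun t => F (z, t)) =ᶠ[𝓝 t] fun t => (D^[n] F) (z, t) := by
        have hc : Continuous fun t : ℂ => (z, t) := by fun_prop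
        filter_upwards [(hUo.preimage hc).mem_nhds hzt] with t' ht' using ih z t' ht'
      rw [hev.deriv_eq]
      have hd := (h1 n (z, t) hzt).differentiableAt.hasFDerivAt.comp_hasDerivAt t
        ((hasDerivAt_const t z).prodMk (hasDerivAt_id t))
      exact hd.deriv
  have hev : sliceCoeff F n =ᶠ[𝓝 z] fun z => (D^[n] F) (z, 0) / (n.factorial : ℂ) := by
    have hc : Continuous fun z : Fin d → ℂ => (z, (0 : ℂ)) := by fun_prop
    filter_upwards [(hUo.preimage hc).mem_nhds hF] with z' hz'
    rw [sliceCoeff, taylorCoeff, h2 n z' 0 hz']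
  refine AnalyticAt.congr ?_ hev.symm
  have hpair : AnalyticAt ℂ (fun z : Fin d → ℂ => (z, (0 : ℂ))) z :=
    analyticAt_id.prod analyticAt_const
  exact ((h1 n (z, 0) hF).comp_of_eq hpair rfl).div analyticAt_const
    (by exact_mod_cast n.factorial_ne_zero)

lemma taylorCoeff_eq_of_hasSum {g : ℂ → ℂ} {c : ℕ → ℂ} {r : ℝ} (hr : 0 < r)
    (hg : AnalyticAt ℂ g 0) (h : ∀ t : ℂ, ‖t‖ < r → HasSum (fun n => c n * t ^ n) (g t)) (n : ℕ) :
    taylorCoeff g n = c n := by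
  obtain ⟨r', hr', hd⟩ : ∃ r' : ℝ, 0 < r' ∧ DifferentiableOn ℂ g (Metric.ball 0 r') := by
    obtain ⟨r', hr', hb⟩ := Metric.isOpen_iff.1 (isOpen_analyticAt ℂ g) 0 hg
    exact ⟨r', hr', fun t ht => (hb ht).differentiableAt.differentiableWithinAt⟩
  have key : ∀ {c : ℕ → ℂ} {r : ℝ}, 0 < r →
      (∀ t : ℂ, ‖t‖ < r → HasSum (fun n => c n * t ^ n) (g t)) →
      HasFPowerSeriesAt g (FormalMultilinearSeries.ofScalars ℂ c) 0 := by
    intro c r hr h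
    rw [hasFPowerSeriesAt_iff]
    filter_upwards [Metric.ball_mem_nhds (0 : ℂ) hr] with t ht
    refine HasSum.of_forall_eq (f := fun n => c n * t ^ n) ?_ fun n => ?_
    · simpa using h t (by simpa using ht)
    · rw [FormalMultilinearSeries.coeff_ofScalars, smul_eq_mul, mul_comm]
  have e := (key hr' fun t ht => hasSum_taylorCoeff hd ht).eq_formalMultilinearSeries (key hr h)
  have := congrArg (fun p => FormalMultilinearSeries.coeff p n) e
  simpa [FormalMultilinearSeries.coeff_ofScalars] using this

/-- The double series may be summed first over `s` and then over `n`; uniqueness of the Taylor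
series in `t` identifies the inner sums. -/
lemma hasSum_sliceCoeff {d : ℕ} {F : (Fin d → ℂ) × ℂ → ℂ} {f : (Fin d → ℕ) → ℕ → ℂ} {r : ℝ}
    (hr : 0 < r) (hf : ∀ (z : Fin d → ℂ) (t : ℂ), (∀ k, ‖z k‖ < r) → ‖t‖ < r →
      HasSum (fun a : (Fin d → ℕ) × ℕ => f a.1 a.2 * (∏ k, z k ^ a.1 k) * t ^ a.2) (F (z, t)))
    {z : Fin d → ℂ} (hz : ∀ k, ‖z k‖ < r) (hF : AnalyticAt ℂ F (z, 0)) (n : ℕ) :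
    HasSum (fun s : Fin d → ℕ => f s n * ∏ k, z k ^ s k) (sliceCoeff F n z) := by
  have hsm : ∀ n, Summable fun s : Fin d → ℕ => f s n * ∏ k, z k ^ s k := by
    intro n
    -- Any non-zero `t` in the domain of convergence would do: the terms with `n` fixed form a
    -- subfamily, from which `tⁿ` is divided out.
    have hr2 : ‖((r / 2 : ℝ) : ℂ)‖ < r := by
      rw [Complex.norm_real, Real.norm_of_nonneg (by linarith)]; linarith
    have h1 := (hf z _ hz hr2).summable.comp_injective
      (i := fun s : Fin d → ℕ => (s, n)) fun a b hab => congrArg Prod.fst hab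
    have h2 := h1.mul_right ((((r / 2 : ℝ) : ℂ) ^ n)⁻¹)
    refine h2.congr fun s => ?_
    have h3 : ((r / 2 : ℝ) : ℂ) ^ n ≠ 0 := pow_ne_zero _ (by exact_mod_cast (by positivity))
    simp only [Function.comp]
    rw [mul_assoc, mul_inv_cancel₀ h3, mul_one]
  have hc : Continuous fun t : ℂ => (z, t) := by fun_prop
  have han : AnalyticAt ℂ (fun t => F (z, t)) 0 :=
    hF.comp_of_eq (analyticAt_const.prod analyticAt_id) rfl
  have e : sliceCoeff F n z = ∑' s : Fin d → ℕ, f s n * ∏ k, z k ^ s k := by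
    refine taylorCoeff_eq_of_hasSum (c := fun n => ∑' s : Fin d → ℕ, f s n * ∏ k, z k ^ s k) hr han
      (fun t ht => ?_) n
    have h1 := (Equiv.prodComm ℕ (Fin d → ℕ)).hasSum_iff.2 (hf z t hz ht)
    exact h1.prod_fiberwise fun n => (hsm n).hasSum.mul_right (t ^ n)
  rw [e]
  exact (hsm n).hasSum

end

/-! ### Cauchy's formula on the unit torus -/

section

lemma isCompact_unit_slice {d : ℕ} {U : Set (Fin d → ℂ)} (hU : IsOpen U)
    (h : ∀ z : Fin d → ℂ, ‖z‖ ≤ 1 → z ∈ U) :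
    ∃ R : ℝ, 1 < R ∧ Metric.closedBall 0 R ⊆ U := by
  obtain ⟨δ, hδ, hsub⟩ := (isCompact_closedBall (0 : Fin d → ℂ) 1).exists_cthickening_subset_open hU
    (fun z hz => h z (by simpa using hz))
  rw [cthickening_closedBall hδ.le zero_le_one] at hsub
  exact ⟨δ + 1, by linarith, hsub⟩

/-- The expansion of `F` is only known to converge near the origin, whereas the integral is needed
on the unit torus. One complex dilation parameter `w` joins the two regimes, so that the
one-variable identity theorem applies. -/
lemma differentiableOn_integral_dilation {d : ℕ} {Φ : (Fin d → ℂ) → ℂ} {R : ℝ}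
    (hΦ : AnalyticOnNhd ℂ Φ (Metric.closedBall 0 R)) (s : Fin d → ℕ) :
    DifferentiableOn ℂ (fun w : ℂ => ∫ θ in cube d, Φ (w • torus θ) * phase s θ)
      (Metric.ball 0 R) := by
  intro w₀ hw₀
  refine DifferentiableAt.differentiableWithinAt ?_
  have hmem : ∀ w ∈ Metric.ball (0 : ℂ) R, ∀ θ : Fin d → ℝ,
      w • torus θ ∈ Metric.closedBall (0 : Fin d → ℂ) R := by
    intro w hw θ
    have hw' : ‖w‖ < R := by simpa using hw
    rw [mem_closedBall_zero_iff, norm_smul]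
    exact (mul_le_of_le_one_right (norm_nonneg _) (norm_torus_le θ)).trans hw'.le
  have hsmul : ∀ w : ℂ, Continuous fun θ : Fin d → ℝ => w • torus θ := fun w =>
    continuous_torus.const_smul w
  have hcont : ∀ w ∈ Metric.ball (0 : ℂ) R, Continuous fun θ : Fin d → ℝ =>
      Φ (w • torus θ) * phase s θ := fun w hw =>
    (hΦ.continuousOn.comp_continuous (hsmul w) (hmem w hw)).mul (continuous_phase s)
  have hfd : AnalyticOnNhd ℂ (fderiv ℂ Φ) (Metric.closedBall 0 R) := fun z hz => (hΦ z hz).fderiv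
  obtain ⟨C, hC⟩ := (isCompact_closedBall (0 : Fin d → ℂ) R).exists_bound_of_continuousOn
    hfd.continuousOn
  have hint : ∀ {g : (Fin d → ℝ) → ℂ} {C : ℝ}, Continuous g → (∀ θ, ‖g θ‖ ≤ C) →
      MeasureTheory.IntegrableOn g (cube d) := fun hg hb =>
    MeasureTheory.Integrable.of_bound hg.aestronglyMeasurable _ (.of_forall hb)
  obtain ⟨C', hC'⟩ := (isCompact_closedBall (0 : Fin d → ℂ) R).exists_bound_of_continuousOn
    hΦ.continuousOn
  have hderiv : ∀ θ, ∀ w ∈ Metric.ball (0 : ℂ) R, HasDerivAt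
      (fun w : ℂ => Φ (w • torus θ) * phase s θ)
      (fderiv ℂ Φ (w • torus θ) (torus θ) * phase s θ) w := by
    intro θ w hw
    have h1 : HasDerivAt (fun w : ℂ => w • torus θ) (torus θ) w := by
      simpa using (hasDerivAt_id w).smul_const (torus θ)
    have h2 := (hΦ _ (hmem w hw θ)).differentiableAt.hasFDerivAt.comp_hasDerivAt w h1
    exact h2.mul_const (phase s θ)
  refine (hasDerivAt_integral_of_dominated_loc_of_deriv_le
    (μ := MeasureTheory.volume.restrict (cube d)) (bound := fun _ => C)
    (Metric.isOpen_ball.mem_nhds hw₀) ?_ ?_ ?_ ?_ (MeasureTheory.integrable_const C)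
    (.of_forall hderiv)).2.differentiableAt
  · filter_upwards [Metric.isOpen_ball.mem_nhds hw₀] with w hw
    exact (hcont w hw).aestronglyMeasurable
  · exact hint (C := C') (hcont w₀ hw₀) fun θ => by
      rw [norm_mul, norm_phase, mul_one]; exact hC' _ (hmem w₀ hw₀ θ)
  · refine Continuous.aestronglyMeasurable ?_
    exact ((hfd.continuousOn.comp_continuous (hsmul w₀) (hmem w₀ hw₀)).clm_apply continuous_torus).mul (continuous_phase s)
  · refine .of_forall fun θ w hw => ?_
    rw [norm_mul, norm_phase, mul_one]
    refine (ContinuousLinearMap.le_opNorm _ _).trans ?_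
    exact (mul_le_of_le_one_right (norm_nonneg _) (norm_torus_le θ)).trans (hC _ (hmem w hw θ))

/-- For small `w` the series converges absolutely and uniformly on the torus of radius `‖w‖`;
integrating termwise, orthogonality of characters keeps only the term `s`. -/
lemma integral_eq_of_hasSum {d : ℕ} {Φ : (Fin d → ℂ) → ℂ} {c : (Fin d → ℕ) → ℂ} {r : ℝ}
    (h : ∀ z : Fin d → ℂ, (∀ k, ‖z k‖ < r) → HasSum (fun s => c s * ∏ k, z k ^ s k) (Φ z))
    (s : Fin d → ℕ) {w : ℂ} (hw : ‖w‖ < r) :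
    ∫ θ in cube d, Φ (w • torus θ) * phase s θ = (2 * (Real.pi : ℂ)) ^ d * c s * w ^ ∑ k, s k := by
  have hprod : ∀ (s' : Fin d → ℕ) (θ : Fin d → ℝ),
      ∏ k, (w • torus θ) k ^ s' k = w ^ (∑ k, s' k) * ∏ k, torus θ k ^ s' k := by
    intro s' θ
    simp only [Pi.smul_apply, smul_eq_mul, mul_pow, Finset.prod_mul_distrib,
      Finset.prod_pow_eq_pow_sum]
  set T : (Fin d → ℕ) → (Fin d → ℝ) → ℂ := fun s' θ =>
    c s' * w ^ (∑ k, s' k) * ((∏ k, torus θ k ^ s' k) * phase s θ) with hT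
  have hnorm : ∀ s' θ, ‖T s' θ‖ = ‖c s' * w ^ (∑ k, s' k)‖ := by
    intro s' θ
    rw [hT]
    simp only
    rw [norm_mul, norm_mul (∏ k, torus θ k ^ s' k), norm_phase, norm_prod]
    simp [norm_torus_apply]
  have hsm : Summable fun s' => ‖c s' * w ^ (∑ k, s' k)‖ := by
    have := (h (fun _ => w) fun _ => hw).summable.norm
    simpa only [Finset.prod_pow_eq_pow_sum] using this
  have hcont : ∀ s', Continuous (T s') := fun s' =>
    continuous_const.mul ((continuous_finsetProd _ fun k _ =>
      ((continuous_apply k).comp continuous_torus).pow _).mul (continuous_phase s))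
  have hint : ∀ s', MeasureTheory.IntegrableOn (T s') (cube d) := fun s' =>
    MeasureTheory.Integrable.of_bound (hcont s').aestronglyMeasurable _
      (.of_forall fun θ => (hnorm s' θ).le)
  have h1 := MeasureTheory.hasSum_integral_of_summable_integral_norm
    (μ := MeasureTheory.volume.restrict (cube d)) hint (by
      simp only [hnorm, MeasureTheory.integral_const]
      exact hsm.mul_left _)
  have h2 : ∀ θ, ∑' s', T s' θ = Φ (w • torus θ) * phase s θ := by
    intro θ
    have := (h (w • torus θ) fun k => by
      rw [Pi.smul_apply, smul_eq_mul, norm_mul, norm_torus_apply, mul_one]; exact hw).mul_right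
        (phase s θ)
    refine (this.of_forall_eq fun s' => ?_).tsum_eq
    rw [hprod, hT]
    ring
  simp only [h2] at h1
  have h3 : ∀ s', ∫ θ in cube d, T s' θ =
      if s' = s then (2 * (Real.pi : ℂ)) ^ d * c s * w ^ ∑ k, s k else 0 := by
    intro s'
    rw [hT]
    simp only
    rw [MeasureTheory.integral_const_mul, integral_monomial_mul_phase]
    split_ifs with hs
    · subst hs; ring
    · rw [mul_zero]
  simp only [h3] at h1
  exact h1.unique (hasSum_ite_eq s _)

/-- Cauchy's formula for the coefficients on the unit torus, and Cauchy's estimate. -/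
lemma coeff_eq_integral {d : ℕ} {F : (Fin d → ℂ) × ℂ → ℂ} {f : (Fin d → ℕ) → ℕ → ℂ}
    (hF : ∀ z : Fin d → ℂ, ‖z‖ ≤ 1 → AnalyticAt ℂ F (z, 0)) (hf : HasExpansion F f) (n : ℕ) :
    (∀ s, ∫ θ in cube d, sliceCoeff F n (torus θ) * phase s θ =
      (2 * (Real.pi : ℂ)) ^ d * f s n) ∧
    ∃ C R : ℝ, 1 < R ∧ ∀ s, ‖f s n‖ ≤ C / R ^ ∑ k, s k := by
  obtain ⟨r, hr, hf⟩ := hf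
  have hUo : IsOpen {z : Fin d → ℂ | AnalyticAt ℂ F (z, 0)} := by
    have hc : Continuous fun z : Fin d → ℂ => (z, (0 : ℂ)) := by fun_prop
    exact (isOpen_analyticAt ℂ F).preimage hc
  obtain ⟨R, hR, hsub⟩ := isCompact_unit_slice hUo hF
  set Φ := sliceCoeff F n with hΦ
  have hΦa : AnalyticOnNhd ℂ Φ (Metric.closedBall 0 R) := fun z hz =>
    analyticAt_sliceCoeff (hsub hz) n
  -- Both sides are holomorphic in `w` on the disk of radius `R > 1` and agree near `0`. The value
  -- `w = 1` gives Cauchy's formula, and a real `w = R'` between `1` and `R` gives Cauchy's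
  -- estimate.
  have key : ∀ s, ∀ w : ℂ, ‖w‖ < R → ∫ θ in cube d, Φ (w • torus θ) * phase s θ =
      (2 * (Real.pi : ℂ)) ^ d * f s n * w ^ ∑ k, s k := by
    intro s w hw
    have hR0 : 0 < R := zero_lt_one.trans hR
    have h1 := (differentiableOn_integral_dilation hΦa s).analyticOnNhd Metric.isOpen_ball
    have h2 : AnalyticOnNhd ℂ (fun w : ℂ => (2 * (Real.pi : ℂ)) ^ d * f s n * w ^ ∑ k, s k)
        (Metric.ball 0 R) := fun w _ => analyticAt_const.mul (analyticAt_id.pow _)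
    -- Radius `r` is needed for the expansion, radius `1` for the analyticity of `F` at `(z, 0)`.
    have hm : 0 < min r 1 := lt_min hr one_pos
    refine h1.eqOn_of_preconnected_of_eventuallyEq h2 (convex_ball _ _).isPreconnected
      (Metric.mem_ball_self hR0) ?_ (by simpa using hw)
    filter_upwards [Metric.ball_mem_nhds (0 : ℂ) hm] with w hw
    have hw' : ‖w‖ < min r 1 := by simpa using hw
    refine integral_eq_of_hasSum (Φ := Φ) (c := fun s => f s n) (r := min r 1) (fun z hz => ?_) s hw'
    refine hasSum_sliceCoeff hr hf (fun k => (hz k).trans_le (min_le_left _ _)) (hF z ?_) n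
    exact (pi_norm_le_iff_of_nonneg zero_le_one).2 fun k => ((hz k).trans_le (min_le_right _ _)).le
  refine ⟨fun s => by simpa using key s 1 (by simpa using hR), ?_⟩
  obtain ⟨R', hR1, hR'⟩ := exists_between hR
  obtain ⟨C, hC⟩ := (isCompact_closedBall (0 : Fin d → ℂ) R).exists_bound_of_continuousOn
    hΦa.continuousOn
  set V := MeasureTheory.volume.real (cube d)
  have h2π : (0 : ℝ) < (2 * Real.pi) ^ d := by positivity
  refine ⟨C * V / (2 * Real.pi) ^ d, R', hR1, fun s => ?_⟩
  have hR0 : 0 < R' := zero_lt_one.trans hR1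
  have hnR : ‖(R' : ℂ)‖ = R' := by rw [Complex.norm_real, Real.norm_of_nonneg hR0.le]
  have h1 := key s R' (by rwa [hnR])
  have h2 : ‖∫ θ in cube d, Φ ((R' : ℂ) • torus θ) * phase s θ‖ ≤ C * V := by
    refine (MeasureTheory.norm_integral_le_of_norm_le_const (C := C) (.of_forall fun θ => ?_)).trans
      (le_of_eq ?_)
    · rw [norm_mul, norm_phase, mul_one]
      refine hC _ ?_
      rw [mem_closedBall_zero_iff, norm_smul, hnR]
      exact (mul_le_of_le_one_right hR0.le (norm_torus_le θ)).trans hR'.le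
    · rw [MeasureTheory.measureReal_restrict_apply_univ]
  rw [h1, norm_mul, norm_mul, norm_pow, norm_pow, hnR, norm_mul, Complex.norm_real,
    Real.norm_of_nonneg Real.pi_pos.le, Complex.norm_ofNat] at h2
  rw [le_div_iff₀ (pow_pos hR0 _), le_div_iff₀ h2π]
  linarith

end

/-! ### Gaussian integrals and an abstract local limit theorem -/

section

/-- The linear substitution `v = A φ` turns the quadratic form of `S` into `∑ v i²`, with Jacobian
`√det S`. -/
lemma exists_transpose_mul_self {d : ℕ} {S : Matrix (Fin d) (Fin d) ℝ} (hS : S.PosDef) :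
    ∃ A : Matrix (Fin d) (Fin d) ℝ, S = Aᵀ * A ∧ |A.det| = √S.det ∧ A.det ≠ 0 := by
  open scoped MatrixOrder in
  obtain ⟨A, hA⟩ := CStarAlgebra.nonneg_iff_eq_star_mul_self.mp hS.posSemidef.nonneg
  have hA' : S = Aᵀ * A := by
    rw [hA, Matrix.star_eq_conjTranspose, Matrix.conjTranspose_eq_transpose_of_trivial]
  have hdet : S.det = A.det ^ 2 := by
    rw [hA', Matrix.det_mul, Matrix.det_transpose, sq]
  refine ⟨A, hA', by rw [hdet, Real.sqrt_sq_eq_abs], fun h0 => ?_⟩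
  have := hS.det_pos
  rw [hdet, h0] at this
  norm_num at this

/-- The Fourier transform of a Gaussian density with covariance matrix `S⁻¹`. -/
lemma integral_gaussian_fourier {d : ℕ} {S : Matrix (Fin d) (Fin d) ℝ} (hS : S.PosDef)
    (y : Fin d → ℝ) :
    ∫ φ : Fin d → ℝ, ((Real.exp (-(φ ⬝ᵥ (S *ᵥ φ)) / 2) : ℝ) : ℂ) *
        Complex.exp (-((y ⬝ᵥ φ : ℝ) * Complex.I)) =
      (((2 * Real.pi) ^ ((d : ℝ) / 2) / √S.det * Real.exp (-(y ⬝ᵥ (S⁻¹ *ᵥ y)) / 2) : ℝ) : ℂ) := by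
  obtain ⟨A, hSA, hAdet, hA0⟩ := exists_transpose_mul_self hS
  have hAu : IsUnit A.det := hA0.isUnit
  -- Chosen so that `y·φ = u·(A φ)`; consequently `∑ u i² = yᵀ S⁻¹ y`.
  set u : Fin d → ℝ := (A⁻¹)ᵀ *ᵥ y with hu
  set g : (Fin d → ℝ) → ℂ := fun v => Complex.exp (-(1 / 2 : ℂ) * ∑ i, (v i : ℂ) ^ 2 +
    ∑ i, (-(u i : ℂ) * Complex.I) * v i) with hg
  have h1 : ∀ φ : Fin d → ℝ, ((Real.exp (-(φ ⬝ᵥ (S *ᵥ φ)) / 2) : ℝ) : ℂ) *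
      Complex.exp (-((y ⬝ᵥ φ : ℝ) * Complex.I)) = g (Matrix.toLin' A φ) := by
    intro φ
    have e1 : φ ⬝ᵥ (S *ᵥ φ) = ∑ i, (A *ᵥ φ) i ^ 2 := by
      rw [hSA, ← Matrix.mulVec_mulVec, Matrix.dotProduct_mulVec, Matrix.vecMul_transpose, dotProduct]
      exact Finset.sum_congr rfl fun i _ => (sq _).symm
    have e2 : y ⬝ᵥ φ = ∑ i, u i * (A *ᵥ φ) i := by
      change _ = u ⬝ᵥ (A *ᵥ φ)
      rw [hu, Matrix.mulVec_transpose, Matrix.dotProduct_mulVec, Matrix.vecMul_vecMul,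
        Matrix.nonsing_inv_mul _ hAu, Matrix.vecMul_one]
    rw [e1, e2, Complex.ofReal_exp, ← Complex.exp_add, hg]
    simp only [Matrix.toLin'_apply]
    congr 1
    push_cast
    rw [Finset.sum_mul, ← Finset.sum_neg_distrib, ← Finset.sum_neg_distrib, Finset.sum_div,
      Finset.mul_sum, ← Finset.sum_add_distrib, ← Finset.sum_add_distrib]
    exact Finset.sum_congr rfl fun i _ => by ring
  simp only [h1]
  have hgc : Continuous g := by rw [hg]; fun_prop
  have hLc : Continuous (Matrix.toLin' A) := (Matrix.toLin' A).continuous_of_finiteDimensional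
  have h2 : ∫ φ : Fin d → ℝ, g (Matrix.toLin' A φ) = |A.det⁻¹| • ∫ v, g v := by
    rw [← MeasureTheory.integral_map hLc.aemeasurable hgc.aestronglyMeasurable,
      Real.map_matrix_volume_pi_eq_smul_volume_pi hA0, MeasureTheory.integral_smul_measure,
      ENNReal.toReal_ofReal (abs_nonneg _)]
  rw [h2, hg, GaussianFourier.integral_cexp_neg_mul_sum_add (by norm_num), abs_inv, hAdet,
    Complex.real_smul]
  have h3 : y ⬝ᵥ (S⁻¹ *ᵥ y) = ∑ i, u i ^ 2 := by
    have : S⁻¹ = A⁻¹ * (A⁻¹)ᵀ := by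
      rw [hSA, Matrix.mul_inv_rev, Matrix.transpose_nonsing_inv]
    rw [this, ← Matrix.mulVec_mulVec, Matrix.dotProduct_mulVec, ← Matrix.mulVec_transpose, ← hu,
      dotProduct]
    exact Finset.sum_congr rfl fun i _ => (sq _).symm
  have h4 : (∑ i, (-(u i : ℂ) * Complex.I) ^ 2) / (4 * (1 / 2 : ℂ)) =
      ((-(∑ i, u i ^ 2) / 2 : ℝ) : ℂ) := by
    push_cast
    simp only [mul_pow, Complex.I_sq, neg_sq, mul_neg_one, Finset.sum_neg_distrib]
    ring
  have h5 : ((Real.pi : ℂ) / (1 / 2)) ^ ((Fintype.card (Fin d) : ℂ) / 2) =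
      (((2 * Real.pi) ^ ((d : ℝ) / 2) : ℝ) : ℂ) := by
    rw [Complex.ofReal_cpow (by positivity)]
    push_cast
    rw [Fintype.card_fin]
    congr 1
    ring
  rw [h3, h4, h5]
  push_cast
  ring

lemma integrable_exp_neg_mul_sum_sq {d : ℕ} {c : ℝ} (hc : 0 < c) :
    MeasureTheory.Integrable fun φ : Fin d → ℝ => Real.exp (-(c * ∑ k, φ k ^ 2)) := by
  have h := (GaussianFourier.integrable_cexp_neg_mul_sum_add (ι := Fin d) (b := (c : ℂ))
    (by simpa using hc) 0).norm
  refine h.congr (.of_forall fun φ => ?_)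
  simp only [Complex.norm_exp]
  congr 1
  have : -(c : ℂ) * ∑ i, (φ i : ℂ) ^ 2 + ∑ i, (0 : Fin d → ℂ) i * (φ i : ℂ) =
      ((-(c * ∑ k, φ k ^ 2) : ℝ) : ℂ) := by push_cast; simp
  rw [this, Complex.ofReal_re]

lemma measurableSet_cube (d : ℕ) : MeasurableSet (cube d) :=
  MeasurableSet.univ_pi fun _ => measurableSet_Ioc

lemma cube_mem_nhds (d : ℕ) : cube d ∈ 𝓝 (0 : Fin d → ℝ) :=
  set_pi_mem_nhds Set.finite_univ fun _ _ =>
    Ioc_mem_nhds (by simpa using Real.pi_pos) (by simpa using Real.pi_pos)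

/-- A local limit theorem: Gaussian decay and pointwise convergence of the rescaled
characteristic functions yield uniform convergence of the Fourier coefficients. -/
lemma local_limit {d : ℕ} {Ψ : ℕ → (Fin d → ℝ) → ℂ} (hcont : ∀ n, Continuous (Ψ n))
    {S : Matrix (Fin d) (Fin d) ℝ} (hS : S.PosDef) (m : Fin d → ℝ) {C c : ℝ} (hc : 0 < c) (C₀ : ℂ)
    (hb : ∀ n : ℕ, 1 ≤ n → ∀ θ ∈ cube d, ‖Ψ n θ‖ ≤ C * Real.exp (-(c * n * ∑ k, θ k ^ 2)))
    (hlim : ∀ φ : Fin d → ℝ, Tendsto (fun n : ℕ => Ψ n ((√n)⁻¹ • φ) *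
      Complex.exp (-((√n * (m ⬝ᵥ φ) : ℝ) * Complex.I))) atTop
      (𝓝 (C₀ * (Real.exp (-(φ ⬝ᵥ (S *ᵥ φ)) / 2) : ℝ)))) :
    ∃ ε : ℕ → ℝ, Tendsto ε atTop (𝓝 0) ∧ ∀ n : ℕ, 1 ≤ n → ∀ (s : Fin d → ℕ) (x : Fin d → ℝ),
      (∀ k, x k = s k - n * m k) →
      ‖(√n : ℂ) ^ d * (∫ θ in cube d, Ψ n θ * phase s θ) -
        C₀ * (((2 * Real.pi) ^ ((d : ℝ) / 2) / √S.det *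
          Real.exp (-(x ⬝ᵥ (S⁻¹ *ᵥ x)) / (2 * n)) : ℝ) : ℂ)‖ ≤ ε n := by
  set L : (Fin d → ℝ) → ℂ := fun φ => C₀ * (Real.exp (-(φ ⬝ᵥ (S *ᵥ φ)) / 2) : ℝ) with hL
  -- The recentred integrand in the variable `φ = √n θ`, extended by zero outside the rescaled cube;
  -- this puts all `n` on the same domain.
  set J : ℕ → (Fin d → ℝ) → ℂ := fun n φ => (cube d).indicator (Ψ n) ((√n)⁻¹ • φ) *
      Complex.exp (-((√n * (m ⬝ᵥ φ) : ℝ) * Complex.I)) with hJ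
  have hexp1 : ∀ r : ℝ, ‖Complex.exp (-((r : ℝ) * Complex.I))‖ = 1 := by
    intro r
    rw [← neg_mul, ← Complex.ofReal_neg, Complex.norm_exp_ofReal_mul_I]
  have hC : 0 ≤ C := by
    have h0 := hb 1 le_rfl 0 (mem_of_mem_nhds (cube_mem_nhds d))
    have h1 := (norm_nonneg _).trans h0
    simpa using h1
  have hJlim : ∀ φ, Tendsto (fun n => J n φ) atTop (𝓝 (L φ)) := by
    intro φ
    refine (hlim φ).congr' ?_
    have h1 : Tendsto (fun n : ℕ => (√(n : ℝ))⁻¹ • φ) atTop (𝓝 ((0 : ℝ) • φ)) :=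
      (tendsto_inv_atTop_zero.comp
        (Real.tendsto_sqrt_atTop.comp tendsto_natCast_atTop_atTop)).smul_const φ
    rw [zero_smul] at h1
    filter_upwards [h1.eventually (cube_mem_nhds d)] with n hn
    rw [hJ]
    simp only
    rw [Set.indicator_of_mem hn]
  have hJb : ∀ n, 1 ≤ n → ∀ φ, ‖J n φ‖ ≤ C * Real.exp (-(c * ∑ k, φ k ^ 2)) := by
    intro n hn φ
    have hn0 : (0 : ℝ) < n := by exact_mod_cast hn
    rw [hJ]
    simp only
    rw [norm_mul, hexp1, mul_one]
    by_cases hmem : (√(n : ℝ))⁻¹ • φ ∈ cube d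
    · rw [Set.indicator_of_mem hmem]
      refine (hb n hn _ hmem).trans (le_of_eq ?_)
      congr 3
      rw [mul_assoc, Finset.mul_sum]
      congr 1
      refine Finset.sum_congr rfl fun k _ => ?_
      rw [Pi.smul_apply, smul_eq_mul, mul_pow, inv_pow, Real.sq_sqrt hn0.le,
        mul_inv_cancel_left₀ hn0.ne']
    · rw [Set.indicator_of_notMem hmem, norm_zero]
      positivity
  have hLb : ∀ φ, ‖L φ‖ ≤ C * Real.exp (-(c * ∑ k, φ k ^ 2)) := fun φ =>
    le_of_tendsto (hJlim φ).norm (eventually_atTop.2 ⟨1, fun n hn => hJb n hn φ⟩)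
  have hJm : ∀ n, MeasureTheory.AEStronglyMeasurable (J n) MeasureTheory.volume := by
    intro n
    have h1 : Measurable ((cube d).indicator (Ψ n)) :=
      (hcont n).measurable.indicator (measurableSet_cube d)
    have h2 : Continuous fun φ : Fin d → ℝ =>
        Complex.exp (-((√n * (m ⬝ᵥ φ) : ℝ) * Complex.I)) := by
      simp only [dotProduct]; fun_prop
    exact ((h1.comp (measurable_const_smul _)).mul h2.measurable).aestronglyMeasurable
  have hLc : Continuous L := by
    simp only [hL, dotProduct, Matrix.mulVec]; fun_prop
  have hgi := integrable_exp_neg_mul_sum_sq (d := d) hc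
  have hJi : ∀ n, 1 ≤ n → MeasureTheory.Integrable (J n) := fun n hn =>
    (hgi.const_mul C).mono' (hJm n) (.of_forall (hJb n hn))
  have hLi : MeasureTheory.Integrable L :=
    (hgi.const_mul C).mono' hLc.aestronglyMeasurable (.of_forall hLb)
  -- The `L¹` distance of the integrands bounds the difference of their Fourier transforms at every
  -- frequency, hence uniformly in `s`.
  refine ⟨fun n => ∫ φ, ‖J n φ - L φ‖, ?_, fun n hn s x hx => ?_⟩
  -- The shift by one is there because the domination holds for `n ≥ 1` only.
  · rw [← tendsto_add_atTop_iff_nat 1]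
    have := MeasureTheory.tendsto_integral_of_dominated_convergence
      (F := fun n φ => ‖J (n + 1) φ - L φ‖) (f := fun _ => (0 : ℝ)) (μ := MeasureTheory.volume)
      (fun φ => 2 * (C * Real.exp (-(c * ∑ k, φ k ^ 2))))
      (fun n => ((hJm (n + 1)).sub hLc.aestronglyMeasurable).norm)
      ((hgi.const_mul C).const_mul 2)
      (fun n => .of_forall fun φ => by
        rw [norm_norm, two_mul]
        exact (norm_sub_le _ _).trans (add_le_add (hJb _ (by omega) φ) (hLb φ)))
      (.of_forall fun φ => by
        have h1 := ((hJlim φ).comp (tendsto_add_atTop_nat 1)).sub_const (L φ)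
        rw [sub_self] at h1
        simpa using h1.norm)
    simpa using this
  · have hn0 : (0 : ℝ) < n := by exact_mod_cast hn
    have hs0 : 0 < √(n : ℝ) := Real.sqrt_pos.2 hn0
    set y : Fin d → ℝ := (√(n : ℝ))⁻¹ • x with hy
    -- Substituting `θ = φ / √n`: the phase `s·φ / √n` splits into `√n m·φ`, absorbed in `J`, and
    -- `y·φ` with `y = (s - n m) / √n`.
    have e1 : (√n : ℂ) ^ d * (∫ θ in cube d, Ψ n θ * phase s θ) =
        ∫ φ, J n φ * Complex.exp (-((y ⬝ᵥ φ : ℝ) * Complex.I)) := by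
      have h1 := MeasureTheory.Measure.integral_comp_inv_smul_of_nonneg
        (MeasureTheory.volume : MeasureTheory.Measure (Fin d → ℝ))
        (fun θ => (cube d).indicator (Ψ n) θ * phase s θ) hs0.le
      rw [Module.finrank_fintype_fun_eq_card, Fintype.card_fin, Complex.real_smul,
        Complex.ofReal_pow] at h1
      rw [← MeasureTheory.integral_indicator (measurableSet_cube d)]
      have h2 : (cube d).indicator (fun θ => Ψ n θ * phase s θ) =
          fun θ => (cube d).indicator (Ψ n) θ * phase s θ := by
        funext θ
        by_cases h : θ ∈ cube d <;> simp [h]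
      rw [h2, ← h1]
      congr 1
      funext φ
      rw [hJ]
      simp only
      rw [mul_assoc, ← Complex.exp_add, phase, ← Complex.exp_sum]
      congr 2
      simp only [dotProduct, Pi.smul_apply, smul_eq_mul, hy]
      push_cast
      rw [Finset.mul_sum, Finset.sum_mul, Finset.sum_mul, ← Finset.sum_neg_distrib,
        ← Finset.sum_neg_distrib, ← Finset.sum_add_distrib]
      refine Finset.sum_congr rfl fun k _ => ?_
      have hsc : ((√(n : ℝ) : ℝ) : ℂ) ≠ 0 := by exact_mod_cast hs0.ne'
      have hsq : ((√(n : ℝ) : ℝ) : ℂ) ^ 2 = n := by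
        rw [← Complex.ofReal_pow, Real.sq_sqrt hn0.le, Complex.ofReal_natCast]
      rw [hx k]
      push_cast
      rw [← hsq]
      field_simp
      ring
    have e2 : C₀ * (((2 * Real.pi) ^ ((d : ℝ) / 2) / √S.det *
          Real.exp (-(x ⬝ᵥ (S⁻¹ *ᵥ x)) / (2 * n)) : ℝ) : ℂ) =
        ∫ φ, L φ * Complex.exp (-((y ⬝ᵥ φ : ℝ) * Complex.I)) := by
      simp only [hL, mul_assoc C₀]
      rw [MeasureTheory.integral_const_mul, integral_gaussian_fourier hS]
      congr 4
      rw [hy, Matrix.mulVec_smul, dotProduct_smul, smul_dotProduct, smul_eq_mul, smul_eq_mul,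
        ← mul_assoc, ← mul_inv, Real.mul_self_sqrt hn0.le]
      field_simp
    have hec : Continuous fun φ : Fin d → ℝ =>
        Complex.exp (-((y ⬝ᵥ φ : ℝ) * Complex.I)) := by
      simp only [dotProduct]; fun_prop
    have hmul : ∀ {g : (Fin d → ℝ) → ℂ}, MeasureTheory.Integrable g →
        MeasureTheory.Integrable fun φ => g φ * Complex.exp (-((y ⬝ᵥ φ : ℝ) * Complex.I)) :=
      fun hg => hg.mul_bdd (c := 1) hec.aestronglyMeasurable (.of_forall fun φ => (hexp1 _).le)
    rw [e1, e2, ← MeasureTheory.integral_sub (hmul (hJi n hn)) (hmul hLi)]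
    refine (MeasureTheory.norm_integral_le_integral_norm _).trans (le_of_eq ?_)
    congr 1
    funext φ
    rw [← sub_mul, norm_mul, hexp1, mul_one]

end

/-! ### Second-order expansions and the implicit root -/

section

lemma isBigO_taylor_two {g : ℂ → ℂ} (hg : AnalyticAt ℂ g 0) :
    (fun w => g w - (g 0 + deriv g 0 * w + deriv (deriv g) 0 / 2 * w ^ 2)) =O[𝓝 0]
      fun w => ‖w‖ ^ 3 := by
  have h := hg.hasFPowerSeriesAt.isBigO_sub_partialSum_pow 3
  refine h.congr_left fun w => ?_
  simp only [FormalMultilinearSeries.partialSum, Finset.sum_range_succ, Finset.range_one,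
    Finset.sum_singleton, FormalMultilinearSeries.apply_eq_pow_smul_coeff,
    FormalMultilinearSeries.coeff_ofScalars, iteratedDeriv_zero, iteratedDeriv_one, zero_add,
    iteratedDeriv_succ (n := 1), Nat.factorial, smul_eq_mul]
  push_cast
  ring

/-- Second-order expansion of `w ↦ p(ρ e^w)`. -/
lemma isBigO_comp_exp {p : ℂ → ℂ} {ρ : ℂ} (hp : AnalyticAt ℂ p ρ) :
    (fun w => p (ρ * Complex.exp w) - (p ρ + ρ * deriv p ρ * w +
      (ρ ^ 2 * deriv (deriv p) ρ + ρ * deriv p ρ) / 2 * w ^ 2)) =O[𝓝 0] fun w => ‖w‖ ^ 3 := by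
  have he : ∀ w : ℂ, HasDerivAt (fun w => ρ * Complex.exp w) (ρ * Complex.exp w) w := fun w =>
    (Complex.hasDerivAt_exp w).const_mul ρ
  have h0 : ρ * Complex.exp 0 = ρ := by simp
  have hexp : AnalyticAt ℂ (fun w => ρ * Complex.exp w) 0 :=
    analyticAt_const.mul analyticAt_cexp
  have hg : AnalyticAt ℂ (fun w => p (ρ * Complex.exp w)) 0 := hp.comp_of_eq hexp h0
  have hd : deriv (fun w => p (ρ * Complex.exp w)) =ᶠ[𝓝 0]
      fun w => deriv p (ρ * Complex.exp w) * (ρ * Complex.exp w) := by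
    have hc : Tendsto (fun w => ρ * Complex.exp w) (𝓝 0) (𝓝 ρ) := by
      have := hexp.continuousAt.tendsto
      rwa [h0] at this
    filter_upwards [hc.eventually hp.eventually_analyticAt] with w hw
    exact (hw.differentiableAt.hasDerivAt.comp w (he w)).deriv
  have h1 : deriv (fun w => p (ρ * Complex.exp w)) 0 = ρ * deriv p ρ := by
    rw [hd.eq_of_nhds, h0, mul_comm]
  have h2 : deriv (deriv fun w => p (ρ * Complex.exp w)) 0 =
      ρ ^ 2 * deriv (deriv p) ρ + ρ * deriv p ρ := by
    rw [hd.deriv_eq]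
    have hp' : HasDerivAt (deriv p) (deriv (deriv p) ρ) (ρ * Complex.exp 0) := by
      rw [h0]; exact hp.deriv.differentiableAt.hasDerivAt
    refine ((hp'.comp 0 (he 0)).mul (he 0)).deriv.trans ?_
    simp only [Function.comp, h0]
    ring
  have := isBigO_taylor_two hg
  rw [h1, h2] at this
  simpa only [h0] using this

namespace Admissible

variable {d : ℕ} {q : ℂ → ℂ} {qs : Fin d → ℂ[X]} {ρ R : ℝ}

lemma analyticAt_q (h : Admissible q qs ρ R) {t : ℂ} (ht : ‖t‖ < R) : AnalyticAt ℂ q t :=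
  h.diff.analyticAt (Metric.isOpen_ball.mem_nhds (by simpa using ht))

lemma analyticAt_denom (h : Admissible q qs ρ R) {z : Fin d → ℂ} {t : ℂ} (ht : ‖t‖ < R) :
    AnalyticAt ℂ (denom q qs) (z, t) := by
  have h1 : AnalyticAt ℂ (fun x : (Fin d → ℂ) × ℂ => q x.2) (z, t) :=
    (h.analyticAt_q ht).comp_of_eq analyticAt_snd rfl
  have h2 : ∀ k, AnalyticAt ℂ (fun x : (Fin d → ℂ) × ℂ => (qs k).eval x.2 * x.1 k) (z, t) := by
    intro k
    have h3 : AnalyticAt ℂ (fun t : ℂ => (qs k).eval t) t :=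
      (qs k).differentiable.analyticAt t
    have h4 : AnalyticAt ℂ (fun x : (Fin d → ℂ) × ℂ => x.1 k) (z, t) :=
      ((ContinuousLinearMap.proj (R := ℂ) (φ := fun _ : Fin d => ℂ) k).comp
        (ContinuousLinearMap.fst ℂ (Fin d → ℂ) ℂ)).analyticAt _
    exact (h3.comp_of_eq analyticAt_snd rfl).mul h4
  exact (analyticAt_const.sub h1).sub (Finset.analyticAt_fun_sum _ fun k _ => h2 k)

/-- The derivative of the denominator with respect to `t`. -/
lemma hasDerivAt_denom (h : Admissible q qs ρ R) (z : Fin d → ℂ) {t : ℂ} (ht : ‖t‖ < R) :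
    HasDerivAt (fun t => denom q qs (z, t))
      (-deriv q t - ∑ k, (derivative (qs k)).eval t * z k) t := by
  have h1 : HasDerivAt q (deriv q t) t := (h.analyticAt_q ht).differentiableAt.hasDerivAt
  exact (h1.const_sub 1).sub (HasDerivAt.fun_sum (u := Finset.univ)
    fun k _ => ((qs k).hasDerivAt t).mul_const (z k))

/-- Near `(1, ρ)`, the zero set of the denominator is the graph of a function of `z`. -/
lemma exists_root (h : Admissible q qs ρ R) :
    ∃ T : (Fin d → ℂ) → ℂ, DifferentiableAt ℂ T (fun _ => 1) ∧ T (fun _ => 1) = ρ ∧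
      ∃ η > 0, ∀ (z : Fin d → ℂ) (t : ℂ), ‖z - fun _ => 1‖ < η → ‖t - ρ‖ < η → (denom q qs (z, t) = 0 ↔ T z = t) := by
  obtain ⟨a₀, a₁, a₂, b₀, b₁, b₂, hm⟩ := h.exists_moments
  set u : (Fin d → ℂ) × ℂ := (fun _ => 1, (ρ : ℂ)) with hu
  have hs : HasStrictFDerivAt (denom q qs) (fderiv ℂ (denom q qs) u) u :=
    (h.analyticAt_denom h.norm_rho_lt).hasStrictFDerivAt
  set e := deriv (diag q qs) ρ with he
  have he0 : e ≠ 0 := by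
    intro h0
    have := hm.deriv_diag_eq h
    rw [← he, h0, mul_zero, eq_comm, neg_eq_zero] at this
    exact hm.mean_pos.ne' (by exact_mod_cast this)
  -- The partial derivative in `t` at `(1, ρ)` is multiplication by `P'(ρ) = -μ / ρ ≠ 0`, so the
  -- implicit function theorem applies.
  have hinr : ∀ c : ℂ, (fderiv ℂ (denom q qs) u ∘L .inr ℂ (Fin d → ℂ) ℂ) c = c * e := by
    intro c
    have h1 := hs.hasFDerivAt.comp_hasDerivAt (ρ : ℂ)
      ((hasDerivAt_const (ρ : ℂ) (fun _ : Fin d => (1 : ℂ))).prodMk (hasDerivAt_id (ρ : ℂ)))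
    have h2 : fderiv ℂ (denom q qs) u (0, 1) = e := h1.deriv.symm
    have h3 : ((0, c) : (Fin d → ℂ) × ℂ) = c • (0, 1) := by simp
    rw [ContinuousLinearMap.comp_apply, ContinuousLinearMap.inr_apply, h3, map_smul, h2, smul_eq_mul]
  have hinv : (fderiv ℂ (denom q qs) u ∘L .inr ℂ (Fin d → ℂ) ℂ).IsInvertible := by
    refine ContinuousLinearMap.IsInvertible.of_inverse
      (g := e⁻¹ • ContinuousLinearMap.id ℂ ℂ) ?_ ?_
    · ext
      simp [hinr, he0]
    · ext
      simp only [ContinuousLinearMap.comp_apply (g := e⁻¹ • ContinuousLinearMap.id ℂ ℂ), hinr]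
      simp [he0]
  refine ⟨hs.implicitFunctionOfProdDomain hinv,
    (hs.hasStrictFDerivAt_implicitFunctionOfProdDomain hinv).hasFDerivAt.differentiableAt, ?_, ?_⟩
  · exact (hs.eventually_apply_eq_iff_implicitFunctionOfProdDomain hinv).self_of_nhds.1 rfl
  · obtain ⟨η, hη, hball⟩ := Metric.eventually_nhds_iff.1
      (hs.eventually_apply_eq_iff_implicitFunctionOfProdDomain hinv)
    refine ⟨η, hη, fun z t hz ht => ?_⟩
    have h0 : denom q qs u = 0 := h.root
    have := hball (y := (z, t)) (by
      rw [Prod.dist_eq, dist_eq_norm, dist_eq_norm]; exact max_lt hz ht)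
    rwa [h0] at this

end Admissible

end

/-! ### Quadratic expansion of the root on the torus -/

section

/-- The quadratic expansion of a root branch `t = ρ e^{W(θ)}` of the denominator on the torus. -/
lemma Moments.isBigO_root {d : ℕ} {q : ℂ → ℂ} {qs : Fin d → ℂ[X]} {ρ R a₀ a₁ a₂ : ℝ}
    {b₀ b₁ b₂ : Fin d → ℝ} (hm : Moments q qs ρ a₀ a₁ a₂ b₀ b₁ b₂) (h : Admissible q qs ρ R)
    {W : (Fin d → ℝ) → ℂ} (hW : W =O[𝓝 0] fun θ => ‖θ‖)
    (h0 : ∀ᶠ θ in 𝓝 0, denom q qs (torus θ, ρ * Complex.exp (W θ)) = 0) :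
    (fun θ => W θ - (-(((fun k => b₀ k / (a₁ + ∑ k, b₁ k)) ⬝ᵥ θ : ℝ) * Complex.I) +
      ((θ ⬝ᵥ (covMatrix (a₁ + ∑ k, b₁ k) (a₂ + ∑ k, b₂ k) b₀ b₁ *ᵥ θ) / 2 : ℝ) : ℂ)))
      =O[𝓝 0] fun θ => ‖θ‖ ^ 3 := by
  set μ := a₁ + ∑ k, b₁ k with hμ
  set M := a₂ + ∑ k, b₂ k with hM
  have hμ0 : μ ≠ 0 := hm.mean_pos.ne'
  have hμc : (μ : ℂ) ≠ 0 := by exact_mod_cast hμ0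
  have hn0 : Tendsto (fun θ : Fin d → ℝ => ‖θ‖) (𝓝 0) (𝓝 0) := by
    simpa using (continuous_norm (E := Fin d → ℝ)).tendsto 0
  have hn1 : (fun θ : Fin d → ℝ => ‖θ‖) =O[𝓝 0] fun _ => (1 : ℝ) := hn0.isBigO_one ℝ
  have hpow : ∀ i j : ℕ, j ≤ i →
      (fun θ : Fin d → ℝ => ‖θ‖ ^ i) =O[𝓝 0] fun θ => ‖θ‖ ^ j := by
    intro i j hij
    obtain ⟨l, rfl⟩ := Nat.exists_eq_add_of_le hij
    have h2 : (fun θ : Fin d → ℝ => ‖θ‖ ^ l) =O[𝓝 0] fun _ => (1 : ℝ) := by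
      simpa using hn1.pow l
    simpa [pow_add] using (isBigO_refl (fun θ : Fin d → ℝ => ‖θ‖ ^ j) (𝓝 0)).mul h2
  have hW0 : Tendsto W (𝓝 0) (𝓝 0) := hW.trans_tendsto hn0
  have hW1 : W =O[𝓝 0] fun θ => ‖θ‖ ^ 1 := by simpa using hW
  have hθ : ∀ k, (fun θ : Fin d → ℝ => ((θ k : ℝ) : ℂ)) =O[𝓝 0] fun θ => ‖θ‖ ^ 1 := fun k =>
    IsBigO.of_bound 1 (.of_forall fun θ => by
      simpa using norm_le_pi_norm θ k)
  have hmul : ∀ {i j : ℕ} {f g : (Fin d → ℝ) → ℂ}, f =O[𝓝 0] (fun θ => ‖θ‖ ^ i) →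
      g =O[𝓝 0] (fun θ => ‖θ‖ ^ j) → (fun θ => f θ * g θ) =O[𝓝 0] fun θ => ‖θ‖ ^ (i + j) := by
    intro i j f g hf hg
    simpa only [pow_add] using hf.mul hg
  have hW3 : (fun θ => ‖W θ‖ ^ 3) =O[𝓝 0] fun θ => ‖θ‖ ^ 3 := hW.norm_left.pow 3
  have hq : (fun θ => q (ρ * Complex.exp (W θ)) - (a₀ + a₁ * W θ + a₂ / 2 * W θ ^ 2))
      =O[𝓝 0] fun θ => ‖θ‖ ^ 3 := by
    have := ((isBigO_comp_exp (h.analyticAt_q h.norm_rho_lt)).comp_tendsto hW0).trans hW3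
    rw [hm.q2_eq, hm.q1_eq, hm.q_eq] at this
    exact this
  have hp : ∀ k, (fun θ => (qs k).eval (ρ * Complex.exp (W θ)) -
      (b₀ k + b₁ k * W θ + b₂ k / 2 * W θ ^ 2)) =O[𝓝 0] fun θ => ‖θ‖ ^ 3 := by
    intro k
    have h1 := isBigO_comp_exp (p := fun t => (qs k).eval t) (ρ := ρ)
      ((qs k).differentiable.analyticAt _)
    have hd1 : deriv (fun t => (qs k).eval t) = fun t => (derivative (qs k)).eval t :=
      funext fun t => Polynomial.deriv _
    rw [hd1, Polynomial.deriv, hm.p2_eq, hm.p1_eq, hm.p_eq] at h1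
    exact (h1.comp_tendsto hW0).trans hW3
  have hE : ∀ k, (fun θ : Fin d → ℝ => torus θ k - (1 + θ k * Complex.I - (θ k : ℂ) ^ 2 / 2))
      =O[𝓝 0] fun θ => ‖θ‖ ^ 3 := by
    intro k
    have h1 := isBigO_taylor_two (g := Complex.exp) analyticAt_cexp
    simp only [Complex.deriv_exp, Complex.exp_zero] at h1
    have h2 : Tendsto (fun θ : Fin d → ℝ => (θ k : ℂ) * Complex.I) (𝓝 0) (𝓝 0) := by
      have : Continuous fun θ : Fin d → ℝ => (θ k : ℂ) * Complex.I := by fun_prop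
      simpa using this.tendsto 0
    have h3 := h1.comp_tendsto h2
    have h4 : (fun θ : Fin d → ℝ => ‖(θ k : ℂ) * Complex.I‖ ^ 3) =O[𝓝 0] fun θ => ‖θ‖ ^ 3 := by
      have := (hθ k).norm_left.pow 3
      simpa using this
    refine (h3.trans h4).congr_left fun θ => ?_
    simp only [Function.comp, torus, mul_pow, Complex.I_sq]
    ring
  have hone : ∀ {f : (Fin d → ℝ) → ℂ}, ContinuousAt f 0 → f =O[𝓝 0] fun θ => ‖θ‖ ^ 0 := by
    intro f hf
    simpa using hf.tendsto.isBigO_one ℝ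
  have hWc : ContinuousAt W 0 := by
    have : W 0 = 0 := by
      have := hW.eq_zero_imp.self_of_nhds
      simpa using this
    rw [ContinuousAt, this]; exact hW0
  have hc : ∀ k, Continuous fun θ : Fin d → ℝ => ((θ k : ℝ) : ℂ) := fun k => by fun_prop
  have hpe : ∀ k, (fun θ => (qs k).eval (ρ * Complex.exp (W θ)) * torus θ k -
      (b₀ k + b₁ k * W θ + b₂ k / 2 * W θ ^ 2 + b₀ k * θ k * Complex.I +
        b₁ k * W θ * θ k * Complex.I - b₀ k * (θ k : ℂ) ^ 2 / 2)) =O[𝓝 0] fun θ => ‖θ‖ ^ 3 := by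
    intro k
    -- `t1` and `t2` carry the two remainders through the product; `t3`, `t4`, `t5` are the terms of
    -- order at least three in the product of the two quadratic polynomials.
    have t1 := hmul (hp k) (hone ((continuous_apply k).comp continuous_torus).continuousAt)
    have hB : ContinuousAt (fun θ => (b₀ k + b₁ k * W θ + b₂ k / 2 * W θ ^ 2 : ℂ)) 0 := by
      fun_prop
    have t2 := hmul (hE k) (hone hB)
    have t3 := (hmul (hmul hW1 (hθ k)) (hθ k)).const_mul_left (-(b₁ k : ℂ) / 2)
    have t4 := (hmul (hmul hW1 hW1) (hθ k)).const_mul_left ((b₂ k : ℂ) / 2 * Complex.I)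
    have t5 := (hmul (hmul (hmul hW1 hW1) (hθ k)) (hone (hc k).continuousAt)).const_mul_left
      (-(b₂ k : ℂ) / 4)
    refine ((((t1.add t2).add t3).add t4).add t5).congr_left fun θ => ?_
    simp only [Function.comp]
    ring
  set X : (Fin d → ℝ) → ℂ := fun θ => ((fun k => b₀ k / μ) ⬝ᵥ θ : ℝ) with hX
  set Y : (Fin d → ℝ) → ℂ := fun θ => ∑ k, (b₁ k : ℂ) * θ k with hY
  set Z : (Fin d → ℝ) → ℂ := fun θ => ∑ k, (b₀ k : ℂ) * (θ k : ℂ) ^ 2 with hZ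
  have hX1 : X =O[𝓝 0] fun θ => ‖θ‖ ^ 1 := by
    have : X = fun θ => ∑ k, ((b₀ k / μ : ℝ) : ℂ) * (θ k : ℂ) := by
      funext θ; simp [hX, dotProduct]
    rw [this]
    exact IsBigO.fun_sum fun k _ => (hθ k).const_mul_left _
  have hY1 : Y =O[𝓝 0] fun θ => ‖θ‖ ^ 1 :=
    IsBigO.fun_sum fun k _ => (hθ k).const_mul_left _
  have hZ1 : Z =O[𝓝 0] fun θ => ‖θ‖ ^ 2 := by
    refine IsBigO.fun_sum fun k _ => ?_
    exact ((hmul (hθ k) (hθ k)).const_mul_left (b₀ k : ℂ)).congr_left fun θ => by rw [sq]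
  have hXμ : ∀ θ : Fin d → ℝ, ∑ k, (b₀ k : ℂ) * θ k * Complex.I = μ * X θ * Complex.I := by
    intro θ
    simp only [hX, dotProduct]
    push_cast
    rw [Finset.mul_sum, Finset.sum_mul]
    exact Finset.sum_congr rfl fun k _ => by field_simp
  have hsumc : (a₀ : ℂ) + ∑ k, (b₀ k : ℂ) = 1 := by exact_mod_cast hm.sum_eq
  -- The equation `H = 0` expanded to second order; the constant terms cancel because `a₀ + ∑ b₀ k =
  -- 1`.
  have htot : (fun θ => μ * W θ + μ * X θ * Complex.I + M / 2 * W θ ^ 2 + W θ * Y θ * Complex.I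
      - Z θ / 2) =O[𝓝 0] fun θ => ‖θ‖ ^ 3 := by
    have h1 := (hq.add (IsBigO.fun_sum (s := Finset.univ) fun k _ => hpe k)).neg_left
    refine h1.congr' ?_ EventuallyEq.rfl
    filter_upwards [h0] with θ hθ0
    rw [denom] at hθ0
    simp only [Finset.sum_sub_distrib, Finset.sum_add_distrib, hXμ] at hθ0 ⊢
    have e1 : ∑ k, (b₁ k : ℂ) * W θ = (∑ k, (b₁ k : ℂ)) * W θ := (Finset.sum_mul ..).symm
    have e2 : ∑ k, (b₂ k : ℂ) / 2 * W θ ^ 2 = (∑ k, (b₂ k : ℂ)) / 2 * W θ ^ 2 := by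
      rw [← Finset.sum_mul, Finset.sum_div]
    have e3 : ∑ k, (b₁ k : ℂ) * W θ * θ k * Complex.I = W θ * Y θ * Complex.I := by
      rw [hY, Finset.mul_sum, Finset.sum_mul]
      exact Finset.sum_congr rfl fun k _ => by ring
    have e4 : ∑ k, (b₀ k : ℂ) * (θ k : ℂ) ^ 2 / 2 = Z θ / 2 := (Finset.sum_div ..).symm
    rw [e1, e2, e3, e4]
    have eμ : (μ : ℂ) = a₁ + ∑ k, (b₁ k : ℂ) := by rw [hμ]; push_cast; rfl
    have eM : (M : ℂ) = a₂ + ∑ k, (b₂ k : ℂ) := by rw [hM]; push_cast; rfl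
    rw [eμ, eM]
    linear_combination hθ0 + hsumc
  -- To first order `W = -i X`. This is fed back into the quadratic terms, with `W² + X² = (W + i
  -- X)(W - i X)`.
  have hlin : (fun θ => W θ + X θ * Complex.I) =O[𝓝 0] fun θ => ‖θ‖ ^ 2 := by
    have t1 := htot.trans (hpow 3 2 (by norm_num))
    have t2 := (hmul hW1 hW1).const_mul_left ((M : ℂ) / 2)
    have t3 := (hmul hW1 hY1).const_mul_left Complex.I
    have t4 := hZ1.const_mul_left (1 / 2 : ℂ)
    refine ((((t1.sub t2).sub t3).add t4).const_mul_left ((μ : ℂ)⁻¹)).congr_left fun θ => ?_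
    field_simp
    ring
  have hlin' : (fun θ => W θ - X θ * Complex.I) =O[𝓝 0] fun θ => ‖θ‖ ^ 1 :=
    hW1.sub ((hX1.const_mul_left Complex.I).congr_left fun θ => mul_comm _ _)
  have t1 := (hmul hlin hlin').const_mul_left ((M : ℂ) / 2)
  have t2 := (hmul hlin hY1).const_mul_left Complex.I
  refine (((htot.sub t1).sub t2).const_mul_left ((μ : ℂ)⁻¹)).congr_left fun θ => ?_
  have eX : ((∑ k, b₀ k / μ * θ k : ℝ) : ℂ) = X θ := rfl
  have eY : ((∑ k, b₁ k * θ k : ℝ) : ℂ) = Y θ := by simp [hY]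
  have eZ : ((∑ k, b₀ k * θ k ^ 2 : ℝ) : ℂ) = Z θ := by simp [hZ]
  have eS : ((θ ⬝ᵥ (covMatrix μ M b₀ b₁ *ᵥ θ) / 2 : ℝ) : ℂ) =
      (M * X θ ^ 2 - 2 * X θ * Y θ + Z θ) / μ / 2 := by
    rw [dotProduct_covMatrix_mulVec, ← eX, ← eY, ← eZ]
    push_cast
    ring
  rw [eS]
  change _ = W θ - (-(X θ * Complex.I) + _)
  field_simp
  linear_combination ((M : ℂ) * X θ ^ 2 - 2 * X θ * Y θ) * Complex.I_sq

end

/-! ### Coefficients in `t`: far from `z = 1` and near it -/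

section

/-- The tube lemma: one radius beyond `ρ` serves all points of `K` simultaneously, which makes the
later error terms uniform in `z`. -/
lemma exists_larger_radius {E : Type*} [TopologicalSpace E] {K : Set E} (hK : IsCompact K)
    {U : Set (E × ℂ)} (hU : IsOpen U) {ρ : ℝ} (hρ : 0 ≤ ρ)
    (h : K ×ˢ Metric.closedBall (0 : ℂ) ρ ⊆ U) :
    ∃ ρ₁, ρ < ρ₁ ∧ K ×ˢ Metric.closedBall (0 : ℂ) ρ₁ ⊆ U := by
  obtain ⟨u, v, -, hv, hKu, hBv, huv⟩ :=
    generalized_tube_lemma hK (isCompact_closedBall (0 : ℂ) ρ) hU h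
  obtain ⟨δ, hδ, hsub⟩ := (isCompact_closedBall (0 : ℂ) ρ).exists_cthickening_subset_open hv hBv
  rw [cthickening_closedBall hδ.le hρ] at hsub
  exact ⟨δ + ρ, by linarith, (Set.prod_mono hKu hsub).trans huv⟩

namespace Admissible

variable {d : ℕ} {q : ℂ → ℂ} {qs : Fin d → ℂ[X]} {ρ R : ℝ} {G : (Fin d → ℂ) × ℂ → ℂ}

lemma isOpen_regular (G : (Fin d → ℂ) × ℂ → ℂ) (R : ℝ) :
    IsOpen {x : (Fin d → ℂ) × ℂ | AnalyticAt ℂ G x ∧ ‖x.2‖ < R} :=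
  (isOpen_analyticAt ℂ G).inter (isOpen_lt (continuous_norm.comp continuous_snd) continuous_const)

lemma isOpen_denom_ne (h : Admissible q qs ρ R) (G : (Fin d → ℂ) × ℂ → ℂ) :
    IsOpen {x : (Fin d → ℂ) × ℂ | (AnalyticAt ℂ G x ∧ ‖x.2‖ < R) ∧ denom q qs x ≠ 0} := by
  have hc : ContinuousOn (denom q qs)
      {x : (Fin d → ℂ) × ℂ | AnalyticAt ℂ G x ∧ ‖x.2‖ < R} := fun x hx =>
    (h.analyticAt_denom (z := x.1) hx.2).continuousAt.continuousWithinAt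
  exact hc.isOpen_inter_preimage (isOpen_regular G R) isOpen_compl_singleton

lemma mem_regular (h : Admissible q qs ρ R) (hG : AnalyticOnNhd ℂ G (polydisk d ρ))
    {z : Fin d → ℂ} {t : ℂ} (hz : ‖z‖ ≤ 1) (ht : ‖t‖ ≤ ρ) :
    AnalyticAt ℂ G (z, t) ∧ ‖t‖ < R :=
  ⟨hG _ ⟨fun k => (norm_le_pi_norm z k).trans hz, ht⟩, ht.trans_lt h.lt⟩

lemma denom_ne_zero (h : Admissible q qs ρ R) {z : Fin d → ℂ} {t : ℂ} (hz : ‖z‖ ≤ 1)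
    (ht : ‖t‖ ≤ ρ) (hne : z ≠ fun _ => 1) : denom q qs (z, t) ≠ 0 := fun h0 =>
  hne (h.eq_of_denom_eq_zero (fun k => (norm_le_pi_norm z k).trans hz) ht h0).2

lemma analyticAt_div (h : Admissible q qs ρ R) {x : (Fin d → ℂ) × ℂ}
    (hx : (AnalyticAt ℂ G x ∧ ‖x.2‖ < R) ∧ denom q qs x ≠ 0) :
    AnalyticAt ℂ (fun x => G x / denom q qs x) x :=
  hx.1.1.div (h.analyticAt_denom (z := x.1) hx.1.2) hx.2

/-- Exponential smallness of the coefficients away from `z = 1`. -/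
lemma exists_sliceCoeff_le (h : Admissible q qs ρ R) (hG : AnalyticOnNhd ℂ G (polydisk d ρ))
    {K : Set (Fin d → ℂ)} (hK : IsCompact K) (hK1 : ∀ z ∈ K, ‖z‖ ≤ 1) (hKne : (fun _ => 1) ∉ K) :
    ∃ C ρ₂ : ℝ, ρ < ρ₂ ∧ ∀ z ∈ K, ∀ n,
      ‖sliceCoeff (fun x => G x / denom q qs x) n z‖ ≤ C / ρ₂ ^ n := by
  obtain ⟨ρ₂, hρ₂, hsub⟩ := exists_larger_radius hK (h.isOpen_denom_ne G) h.pos.le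
    (fun x hx => by
      have ht : ‖x.2‖ ≤ ρ := by simpa using hx.2
      exact ⟨h.mem_regular hG (hK1 _ hx.1) ht,
        h.denom_ne_zero (hK1 _ hx.1) ht fun e => hKne (e ▸ hx.1)⟩)
  obtain ⟨C, hC⟩ := (hK.prod (isCompact_closedBall (0 : ℂ) ρ₂)).exists_bound_of_continuousOn
    (f := fun x => G x / denom q qs x)
    fun x hx => (h.analyticAt_div (hsub hx)).continuousAt.continuousWithinAt
  refine ⟨C, ρ₂, hρ₂, fun z hz n => norm_taylorCoeff_le (h.pos.trans hρ₂) (fun t ht => ?_)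
    (fun t ht => hC (z, t) ⟨hz, Metric.sphere_subset_closedBall ht⟩) n⟩
  have h1 := h.analyticAt_div (hsub (show (z, t) ∈ _ from ⟨hz, ht⟩))
  exact (h1.comp_of_eq (analyticAt_const.prod analyticAt_id) rfl :
    AnalyticAt ℂ (fun t => G (z, t) / denom q qs (z, t)) t).differentiableAt.differentiableWithinAt

/-- Near `z = 1`, the coefficients are those of a simple pole up to exponentially small error. -/
lemma exists_pole (h : Admissible q qs ρ R) (hG : AnalyticOnNhd ℂ G (polydisk d ρ)) :
    ∃ (T r : (Fin d → ℂ) → ℂ) (C ρ₁ : ℝ), ρ < ρ₁ ∧ DifferentiableAt ℂ T (fun _ => 1) ∧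
      T (fun _ => 1) = ρ ∧ ContinuousAt r (fun _ => 1) ∧
      r (fun _ => 1) = G (fun _ => 1, ρ) / deriv (diag q qs) ρ ∧
      ∀ᶠ z in 𝓝 (fun _ => 1), denom q qs (z, T z) = 0 ∧ (‖z‖ ≤ 1 → ∀ n,
        ‖sliceCoeff (fun x => G x / denom q qs x) n z + r z * (T z ^ (n + 1))⁻¹‖ ≤ C / ρ₁ ^ n) := by
  obtain ⟨a₀, a₁, a₂, b₀, b₁, b₂, hm⟩ := h.exists_moments
  obtain ⟨T, hTd, hT1, η, hη, hroot⟩ := h.exists_root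
  set o : Fin d → ℂ := fun _ => 1 with ho
  have ho1 : ‖o‖ ≤ 1 := (pi_norm_le_iff_of_nonneg zero_le_one).2 fun k => by simp [ho]
  -- `D z` is the `t`-derivative of `H` at `(z, T z)`, so `r = G / D` is the residue of `F(z, ·)` at
  -- its pole.
  set D : (Fin d → ℂ) → ℂ :=
    fun z => -deriv q (T z) - ∑ k, (derivative (qs k)).eval (T z) * z k with hD
  have hTc : ContinuousAt T o := hTd.continuousAt
  have hDc : ContinuousAt D o := by
    have h1 : ContinuousAt (fun z => deriv q (T z)) o := by
      refine ContinuousAt.comp (g := deriv q) ?_ hTc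
      rw [hT1]
      exact (h.analyticAt_q h.norm_rho_lt).deriv.continuousAt
    have h2 : ∀ k, ContinuousAt (fun z => (derivative (qs k)).eval (T z) * z k) o := fun k =>
      ((derivative (qs k)).continuous.continuousAt.comp hTc).mul
        (continuous_apply k).continuousAt
    exact h1.neg.sub (tendsto_finsetSum _ fun k _ => h2 k)
  have hD1 : D o = deriv (diag q qs) ρ := by
    rw [h.deriv_diag, hD]
    simp only
    rw [hT1]
    simp [ho]
  have hD0 : D o ≠ 0 := by
    rw [hD1]
    intro h0
    have := hm.deriv_diag_eq h
    rw [h0, mul_zero, eq_comm, neg_eq_zero] at this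
    exact hm.mean_pos.ne' (by exact_mod_cast this)
  have hGc : ContinuousAt (fun z => G (z, T z)) o := by
    refine ContinuousAt.comp (g := G) ?_ (continuousAt_id.prodMk hTc)
    rw [hT1]
    exact (h.mem_regular hG ho1 (by simp [abs_of_pos h.pos])).1.continuousAt
  set r : (Fin d → ℂ) → ℂ := fun z => G (z, T z) / D z with hr
  have hrc : ContinuousAt r o := hGc.div hDc hD0
  have hnear : IsOpen {x : (Fin d → ℂ) × ℂ | ‖x.1 - o‖ < η ∧ ‖x.2 - ρ‖ < η} :=
    (isOpen_lt (continuous_norm.comp (continuous_fst.sub continuous_const)) continuous_const).inter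
      (isOpen_lt (continuous_norm.comp (continuous_snd.sub continuous_const)) continuous_const)
  -- In the closed polydisk, either `H ≠ 0` or the point is `(1, ρ)`, around which the zeros form
  -- the graph of `T`. This alternative is open, so it persists up to a radius `ρ₁ > ρ`; hence for
  -- `‖z‖ ≤ 1` a zero with `‖t‖ ≤ ρ₁` can only be `t = T z`.
  have hUo : IsOpen ({x : (Fin d → ℂ) × ℂ | (AnalyticAt ℂ G x ∧ ‖x.2‖ < R) ∧ denom q qs x ≠ 0} ∪
      ({x | AnalyticAt ℂ G x ∧ ‖x.2‖ < R} ∩ {x | ‖x.1 - o‖ < η ∧ ‖x.2 - ρ‖ < η})) :=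
    (h.isOpen_denom_ne G).union ((isOpen_regular G R).inter hnear)
  obtain ⟨ρ₁, hρ₁, hsub⟩ := exists_larger_radius
    (isCompact_closedBall (0 : Fin d → ℂ) 1) hUo h.pos.le (fun x hx => by
      have hz : ‖x.1‖ ≤ 1 := by simpa using hx.1
      have ht : ‖x.2‖ ≤ ρ := by simpa using hx.2
      by_cases h0 : denom q qs x = 0
      · obtain ⟨e1, e2⟩ :=
          h.eq_of_denom_eq_zero (fun k => (norm_le_pi_norm x.1 k).trans hz) ht h0
        exact .inr ⟨h.mem_regular hG hz ht, by rw [e2]; simpa [ho] using hη,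
          by rw [e1]; simpa using hη⟩
      · exact .inl ⟨h.mem_regular hG hz ht, h0⟩)
  have hreg : ∀ z t, ‖z‖ ≤ 1 → ‖t‖ ≤ ρ₁ → AnalyticAt ℂ G (z, t) ∧ ‖t‖ < R := fun z t hz ht => by
    rcases hsub (show (z, t) ∈ _ from ⟨by simpa using hz, by simpa using ht⟩) with hx | hx
    exacts [hx.1, hx.1]
  have hzero : ∀ z t, ‖z‖ ≤ 1 → ‖t‖ ≤ ρ₁ → denom q qs (z, t) = 0 → T z = t :=
    fun z t hz ht h0 => by
      rcases hsub (show (z, t) ∈ _ from ⟨by simpa using hz, by simpa using ht⟩) with hx | hx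
      exacts [absurd h0 hx.2, (hroot z t hx.2.1 hx.2.2).1 h0]
  -- `η` keeps `T z` where the graph describes the zeros, `(ρ₁ - ρ) / 2` keeps it away from the
  -- circle of radius `ρ₁`, and `ρ / 2` keeps it away from `0`.
  set ε := min (min η ((ρ₁ - ρ) / 2)) (ρ / 2) with hε
  have hε0 : 0 < ε := by
    have := h.pos
    have : 0 < (ρ₁ - ρ) / 2 := by linarith
    positivity
  have hTev : ∀ᶠ z in 𝓝 o, ‖T z - ρ‖ < ε := by
    have := hTc.tendsto
    rw [hT1] at this
    simpa [dist_eq_norm] using this.eventually (Metric.ball_mem_nhds _ hε0)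
  obtain ⟨δ, hδ, hTδ⟩ := Metric.eventually_nhds_iff.1 hTev
  have hTlt : ∀ z, ‖T z - ρ‖ < ε → ‖T z‖ < ρ + (ρ₁ - ρ) / 2 ∧ T z ≠ 0 := by
    intro z hz
    have e1 : ε ≤ (ρ₁ - ρ) / 2 := (min_le_left _ _).trans (min_le_right _ _)
    have e2 : ε ≤ ρ / 2 := min_le_right _ _
    have hρn : ‖(ρ : ℂ)‖ = ρ := by simp [abs_of_pos h.pos]
    constructor
    · calc ‖T z‖ = ‖(T z - ρ) + ρ‖ := by rw [sub_add_cancel]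
        _ ≤ ‖T z - ρ‖ + ρ := (norm_add_le _ _).trans_eq (by rw [hρn])
        _ < _ := by linarith
    · intro h0
      rw [h0, zero_sub, norm_neg, hρn] at hz
      linarith [h.pos]
  set K : Set (Fin d → ℂ) := Metric.closedBall 0 1 ∩ Metric.closedBall o (δ / 2) with hK
  have hKc : IsCompact K := (isCompact_closedBall _ _).inter (isCompact_closedBall _ _)
  have hKT : ∀ z ∈ K, ‖z‖ ≤ 1 ∧ ‖T z - ρ‖ < ε := fun z hz =>
    ⟨by simpa using hz.1, hTδ (lt_of_le_of_lt (by simpa using hz.2) (by linarith))⟩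
  have hne : ∀ z ∈ K, ∀ t ∈ Metric.sphere (0 : ℂ) ρ₁, denom q qs (z, t) ≠ 0 := by
    intro z hz t ht h0
    have htn : ‖t‖ = ρ₁ := by simpa using ht
    have e := hzero z t (hKT z hz).1 htn.le h0
    have := (hTlt z (hKT z hz).2).1
    rw [e, htn] at this
    linarith
  obtain ⟨M, hM⟩ := (hKc.prod (isCompact_sphere (0 : ℂ) ρ₁)).exists_bound_of_continuousOn
    (f := fun x => G x / denom q qs x) fun x hx =>
      (h.analyticAt_div ⟨hreg x.1 x.2 (hKT _ hx.1).1 (by simpa using hx.2.le),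
        hne _ hx.1 _ hx.2⟩).continuousAt.continuousWithinAt
  refine ⟨T, r, M + (‖r o‖ + 1) / ((ρ₁ - ρ) / 2), ρ₁, hρ₁, hTd, hT1, hrc, ?_, ?_⟩
  · rw [hr]; simp only; rw [hT1, hD1]
  have hrev : ∀ᶠ z in 𝓝 o, ‖r z‖ < ‖r o‖ + 1 :=
    hrc.norm.eventually (gt_mem_nhds (lt_add_one _))
  have hDev : ∀ᶠ z in 𝓝 o, D z ≠ 0 := hDc.eventually_ne hD0
  filter_upwards [hrev, hDev, hTev, Metric.ball_mem_nhds o hη,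
    Metric.closedBall_mem_nhds o (half_pos hδ)] with z hrz hDz hTz hzη hzδ
  have h0 : denom q qs (z, T z) = 0 :=
    (hroot z (T z) (by simpa [dist_eq_norm] using hzη)
      (hTz.trans_le ((min_le_left _ _).trans (min_le_left _ _)))).2 rfl
  refine ⟨h0, fun hz1 n => ?_⟩
  have hzK : z ∈ K := ⟨by simpa using hz1, hzδ⟩
  have hTz' := hTlt z hTz
  have hTlt1 : ‖T z‖ < ρ₁ := by linarith [hTz'.1]
  set U : Set ℂ := {t | AnalyticAt ℂ G (z, t) ∧ ‖t‖ < R} with hU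
  have hUo : IsOpen U :=
    (isOpen_regular G R).preimage (f := fun t : ℂ => (z, t)) (by fun_prop)
  have hgd : DifferentiableOn ℂ (fun t => G (z, t)) U := fun t ht =>
    ((ht.1.comp_of_eq (analyticAt_const.prod analyticAt_id) rfl :
      AnalyticAt ℂ (fun t => G (z, t)) t)).differentiableAt.differentiableWithinAt
  have hhd : DifferentiableOn ℂ (fun t => denom q qs (z, t)) U := fun t ht =>
    (h.hasDerivAt_denom z ht.2).differentiableAt.differentiableWithinAt
  have hder : deriv (fun t => denom q qs (z, t)) (T z) = D z :=
    (h.hasDerivAt_denom z (hreg z (T z) hz1 hTlt1.le).2).deriv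
  have key := norm_taylorCoeff_div_add_le (M := M) hUo
    (fun t ht => hreg z t hz1 (by simpa using ht)) hgd hhd hTlt1 hTz'.2 h0 (by rwa [hder])
    (fun t ht h0 => (hzero z t hz1 (by simpa using ht) h0).symm)
    (fun t ht => hM (z, t) ⟨hzK, ht⟩) n
  rw [hder] at key
  refine key.trans ?_
  have hρ1 : 0 < ρ₁ := h.pos.trans hρ₁
  refine div_le_div_of_nonneg_right (add_le_add le_rfl ?_) (by positivity)
  exact div_le_div₀ (by positivity) hrz.le (by linarith) (by linarith [hTz'.1])

end Admissible

end

/-! ### Gaussian domination and pointwise limit of the characteristic functions -/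

section

lemma torus_zero {d : ℕ} : torus (0 : Fin d → ℝ) = fun _ => 1 := by
  funext k; simp [torus]

/-- The logarithm of a root branch along the torus. -/
lemma exists_log_branch {d : ℕ} {T : (Fin d → ℂ) → ℂ} {ρ : ℝ} (hρ : 0 < ρ)
    (hT : DifferentiableAt ℂ T (fun _ => 1)) (hT1 : T (fun _ => 1) = ρ) :
    ∃ W : (Fin d → ℝ) → ℂ, W =O[𝓝 0] (fun θ => ‖θ‖) ∧
      ∀ᶠ θ in 𝓝 0, T (torus θ) = ρ * Complex.exp (W θ) := by
  have hρc : (ρ : ℂ) ≠ 0 := by exact_mod_cast hρ.ne'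
  have htd : DifferentiableAt ℝ (torus : (Fin d → ℝ) → Fin d → ℂ) 0 := by
    refine differentiableAt_pi.2 fun k => ?_
    have h1 : DifferentiableAt ℝ (fun θ : Fin d → ℝ => ((θ k : ℝ) : ℂ)) 0 :=
      Complex.ofRealCLM.differentiableAt.comp (0 : Fin d → ℝ) (differentiableAt_apply k _)
    exact (h1.mul_const _).cexp
  have hTt : DifferentiableAt ℝ (fun θ => T (torus θ)) 0 := by
    refine DifferentiableAt.comp (g := T) 0 ?_ htd
    rw [torus_zero]
    exact hT.restrictScalars ℝ
  have h0 : T (torus 0) / ρ = 1 := by rw [torus_zero, hT1, div_self hρc]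
  have hWd : DifferentiableAt ℝ (fun θ => Complex.log (T (torus θ) / ρ)) 0 := by
    have h1 : DifferentiableAt ℝ (fun θ => T (torus θ) / ρ) 0 := by
      simpa only [div_eq_mul_inv] using hTt.mul_const ((ρ : ℂ)⁻¹)
    refine DifferentiableAt.comp (g := Complex.log) 0 ?_ h1
    refine DifferentiableAt.restrictScalars ℝ (Complex.differentiableAt_log ?_)
    rw [h0]
    exact Complex.one_mem_slitPlane
  refine ⟨fun θ => Complex.log (T (torus θ) / ρ), ?_, ?_⟩
  · have := hWd.hasFDerivAt.isBigO_sub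
    simp only [h0, Complex.log_one, sub_zero] at this
    exact this.norm_right
  · have hne : ∀ᶠ θ in 𝓝 0, T (torus θ) ≠ 0 :=
      hTt.continuousAt.eventually_ne (by rw [torus_zero, hT1]; exact hρc)
    filter_upwards [hne] with θ hθ
    rw [Complex.exp_log (div_ne_zero hθ hρc), mul_div_cancel₀ _ hρc]

lemma exists_quadratic_lower_bound {d : ℕ} {S : Matrix (Fin d) (Fin d) ℝ} (hS : S.PosDef) :
    ∃ c > 0, ∀ θ : Fin d → ℝ, c * ‖θ‖ ^ 2 ≤ θ ⬝ᵥ (S *ᵥ θ) := by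
  obtain ⟨A, hSA, -, hA0⟩ := exists_transpose_mul_self hS
  set L := LinearMap.toContinuousLinearMap (Matrix.toLin' A⁻¹) with hL
  -- From `θ = A⁻¹ (A θ)`; the `+ 1` keeps the constant meaningful when `‖L‖ = 0`, that is for `d =
  -- 0`.
  refine ⟨((‖L‖ + 1) ^ 2)⁻¹, by positivity, fun θ => ?_⟩
  set v := A *ᵥ θ with hv
  have e1 : θ ⬝ᵥ (S *ᵥ θ) = ∑ i, v i ^ 2 := by
    rw [hSA, ← Matrix.mulVec_mulVec, Matrix.dotProduct_mulVec, Matrix.vecMul_transpose, dotProduct]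
    exact Finset.sum_congr rfl fun i _ => (sq _).symm
  have e2 : ‖v‖ ^ 2 ≤ ∑ i, v i ^ 2 := by
    have h0 : 0 ≤ ∑ i, v i ^ 2 := Finset.sum_nonneg fun i _ => sq_nonneg _
    have h1 : ‖v‖ ≤ √(∑ i, v i ^ 2) := (pi_norm_le_iff_of_nonneg (Real.sqrt_nonneg _)).2 fun i => by
      rw [Real.norm_eq_abs, ← Real.sqrt_sq_eq_abs]
      exact Real.sqrt_le_sqrt
        (Finset.single_le_sum (f := fun i => v i ^ 2) (fun i _ => sq_nonneg _) (Finset.mem_univ i))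
    calc ‖v‖ ^ 2 ≤ √(∑ i, v i ^ 2) ^ 2 := pow_le_pow_left₀ (norm_nonneg _) h1 2
      _ = _ := Real.sq_sqrt h0
  have e3 : ‖θ‖ ≤ (‖L‖ + 1) * ‖v‖ := by
    have h1 : L v = θ := by
      rw [hL, LinearMap.coe_toContinuousLinearMap', Matrix.toLin'_apply, hv, Matrix.mulVec_mulVec,
        Matrix.nonsing_inv_mul _ hA0.isUnit, Matrix.one_mulVec]
    calc ‖θ‖ = ‖L v‖ := by rw [h1]
      _ ≤ ‖L‖ * ‖v‖ := L.le_opNorm v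
      _ ≤ _ := by gcongr; linarith
  rw [e1, inv_mul_le_iff₀ (by positivity)]
  calc ‖θ‖ ^ 2 ≤ ((‖L‖ + 1) * ‖v‖) ^ 2 := pow_le_pow_left₀ (norm_nonneg _) e3 2
    _ = (‖L‖ + 1) ^ 2 * ‖v‖ ^ 2 := by ring
    _ ≤ _ := by gcongr

lemma norm_le_pi_of_mem_cube {d : ℕ} {θ : Fin d → ℝ} (hθ : θ ∈ cube d) : ‖θ‖ ≤ Real.pi :=
  (pi_norm_le_iff_of_nonneg Real.pi_pos.le).2 fun k =>
    abs_le.2 ⟨(hθ k (Set.mem_univ k)).1.le, (hθ k (Set.mem_univ k)).2⟩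

/-- On the cube `‖θ‖ ≤ π`, so decay that is exponential in `n` is also Gaussian in `θ`. This brings
the exponentially small errors under the same bound as the main term. -/
lemma exists_pow_le_exp {x : ℝ} (hx0 : 0 < x) (hx1 : x < 1) :
    ∃ κ > 0, ∀ (d n : ℕ), ∀ θ ∈ cube d, x ^ n ≤ Real.exp (-(κ * n * ‖θ‖ ^ 2)) := by
  have hl : 0 < -Real.log x := neg_pos.2 (Real.log_neg hx0 hx1)
  refine ⟨-Real.log x / Real.pi ^ 2, by positivity, fun d n θ hθ => ?_⟩
  rw [← Real.exp_log (pow_pos hx0 n), Real.log_pow, Real.exp_le_exp]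
  have h1 : ‖θ‖ ^ 2 ≤ Real.pi ^ 2 :=
    pow_le_pow_left₀ (norm_nonneg _) (norm_le_pi_of_mem_cube hθ) 2
  have h2 : -Real.log x / Real.pi ^ 2 * n * ‖θ‖ ^ 2 ≤
      -Real.log x / Real.pi ^ 2 * n * Real.pi ^ 2 := by gcongr
  have h3 : -Real.log x / Real.pi ^ 2 * n * Real.pi ^ 2 = n * -Real.log x := by
    field_simp
  linarith

lemma sum_sq_le {d : ℕ} (θ : Fin d → ℝ) : ∑ k, θ k ^ 2 ≤ (d + 1) * ‖θ‖ ^ 2 := by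
  have h1 : ∑ k, θ k ^ 2 ≤ ∑ _k : Fin d, ‖θ‖ ^ 2 := Finset.sum_le_sum fun k _ => by
    rw [← sq_abs]
    exact pow_le_pow_left₀ (abs_nonneg _) (norm_le_pi_norm θ k) 2
  rw [Finset.sum_const, Finset.card_univ, Fintype.card_fin, nsmul_eq_mul] at h1
  nlinarith [sq_nonneg ‖θ‖]

namespace Moments

variable {d : ℕ} {q : ℂ → ℂ} {qs : Fin d → ℂ[X]} {ρ R a₀ a₁ a₂ : ℝ} {b₀ b₁ b₂ : Fin d → ℝ}
  {G : (Fin d → ℂ) × ℂ → ℂ}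

/-- Gaussian decay on the torus and pointwise convergence after rescaling. -/
lemma sliceCoeff_asymptotics (hm : Moments q qs ρ a₀ a₁ a₂ b₀ b₁ b₂) (h : Admissible q qs ρ R)
    (hG : AnalyticOnNhd ℂ G (polydisk d ρ)) :
    (∃ C c : ℝ, 0 < c ∧ ∀ n : ℕ, ∀ θ ∈ cube d,
      ‖(ρ : ℂ) ^ n * sliceCoeff (fun x => G x / denom q qs x) n (torus θ)‖ ≤
        C * Real.exp (-(c * n * ∑ k, θ k ^ 2))) ∧
    ∀ φ : Fin d → ℝ, Tendsto (fun n : ℕ =>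
      (ρ : ℂ) ^ n * sliceCoeff (fun x => G x / denom q qs x) n (torus ((√n)⁻¹ • φ)) *
        Complex.exp (-((√n * ((fun k => b₀ k / (a₁ + ∑ k, b₁ k)) ⬝ᵥ φ) : ℝ) * Complex.I))) atTop
      (𝓝 (G (fun _ => 1, (ρ : ℂ)) / ((a₁ + ∑ k, b₁ k : ℝ) : ℂ) *
        (Real.exp (-(φ ⬝ᵥ (covMatrix (a₁ + ∑ k, b₁ k) (a₂ + ∑ k, b₂ k) b₀ b₁ *ᵥ φ)) / 2) : ℝ))) := by
  set F : (Fin d → ℂ) × ℂ → ℂ := fun x => G x / denom q qs x with hF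
  obtain ⟨T, r, C₁, ρ₁, hρ₁, hTd, hT1, hrc, hr1, hev⟩ := h.exists_pole hG
  obtain ⟨W, hW, hTW⟩ := exists_log_branch h.pos hTd hT1
  have htor : Tendsto (torus : (Fin d → ℝ) → Fin d → ℂ) (𝓝 0) (𝓝 (fun _ => 1)) := by
    have := (continuous_torus (d := d)).tendsto 0
    rwa [torus_zero] at this
  have hevθ := htor.eventually hev
  have hroot : ∀ᶠ θ in 𝓝 0, denom q qs (torus θ, ρ * Complex.exp (W θ)) = 0 := by
    filter_upwards [hevθ, hTW] with θ h1 h2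
    rw [← h2]; exact h1.1
  have hexp := hm.isBigO_root h hW hroot
  have hSpd := hm.posDef_covMatrix
  set S := covMatrix (a₁ + ∑ k, b₁ k) (a₂ + ∑ k, b₂ k) b₀ b₁ with hS
  set m : Fin d → ℝ := fun k => b₀ k / (a₁ + ∑ k, b₁ k) with hmdef
  set μ := a₁ + ∑ k, b₁ k with hμ
  have hρ0 := h.pos
  have hρc : (ρ : ℂ) ≠ 0 := by exact_mod_cast hρ0.ne'
  have hρ10 : 0 < ρ₁ := hρ0.trans hρ₁
  have hnρ : ‖(ρ : ℂ)‖ = ρ := by simp [abs_of_pos hρ0]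
  have hlit := hexp.trans_isLittleO (k := fun θ : Fin d → ℝ => ‖θ‖ ^ 2)
    ((isLittleO_pow_pow (𝕜 := ℝ) (show 2 < 3 by norm_num)).comp_tendsto
      (by simpa using (continuous_norm (E := Fin d → ℝ)).tendsto 0))
  constructor
  · obtain ⟨c₀, hc₀, hc⟩ := exists_quadratic_lower_bound hSpd
    -- Half the quadratic form is at least `c₀ / 2 · ‖θ‖²`, and the `o(‖θ‖²)` error takes at most
    -- `c₀ / 4 · ‖θ‖²` of it.
    have hre : ∀ᶠ θ in 𝓝 (0 : Fin d → ℝ), c₀ / 4 * ‖θ‖ ^ 2 ≤ (W θ).re := by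
      filter_upwards [hlit.def (show 0 < c₀ / 4 by positivity)] with θ hθ
      have h1 := (Complex.abs_re_le_norm _).trans hθ
      have h2 := (abs_le.1 h1).1
      simp only [Complex.sub_re, Complex.add_re, Complex.neg_re, Complex.re_ofReal_mul,
        Complex.I_re, mul_zero, neg_zero, zero_add, Complex.ofReal_re, norm_pow, norm_norm] at h2
      have h3 := hc θ
      linarith
    have hrb : ∀ᶠ z in 𝓝 (fun _ => 1), ‖r z‖ < ‖r (fun _ => 1)‖ + 1 :=
      hrc.norm.eventually (gt_mem_nhds (lt_add_one _))
    set B := ‖r (fun _ => 1)‖ + 1 with hB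
    obtain ⟨δ, hδ, hall⟩ := Metric.eventually_nhds_iff.1
      ((hevθ.and hTW).and (hre.and (htor.eventually hrb)))
    set K : Set (Fin d → ℂ) := torus '' (Set.Icc (fun _ => -Real.pi) (fun _ => Real.pi) ∩
      {θ : Fin d → ℝ | δ ≤ ‖θ‖}) with hK
    have hKc : IsCompact K := ((isCompact_Icc).inter_right
      (isClosed_le continuous_const continuous_norm)).image continuous_torus
    have hK1 : ∀ z ∈ K, ‖z‖ ≤ 1 := by
      rintro _ ⟨θ, -, rfl⟩; exact norm_torus_le θ
    have hKne : (fun _ => 1) ∉ K := by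
      rintro ⟨θ, ⟨hθ, hθδ⟩, he⟩
      have hz : θ = 0 := by
        funext k
        have h1 := congrFun he k
        simp only [torus] at h1
        have h2 : Complex.log (Complex.exp (θ k * Complex.I)) = θ k * Complex.I := by
          -- The compact set is built from the closed cube, so the endpoint `-π`, where the
          -- principal logarithm does not invert `exp`, is excluded by hand: there `e^{iθ} = -1`.
          have hpi : θ k ≠ -Real.pi := by
            intro h3
            rw [h3, Complex.ofReal_neg, neg_mul, Complex.exp_neg, Complex.exp_pi_mul_I] at h1
            norm_num at h1
          refine Complex.log_exp ?_ ?_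
          · simpa using lt_of_le_of_ne (hθ.1 k) (Ne.symm hpi)
          · simpa using hθ.2 k
        rw [h1, Complex.log_one, eq_comm, mul_eq_zero] at h2
        simpa [Complex.I_ne_zero] using h2
      rw [hz] at hθδ
      simp only [Set.mem_ofPred_eq, norm_zero] at hθδ
      linarith
    obtain ⟨C₂, ρ₂, hρ₂, hfar⟩ := h.exists_sliceCoeff_le hG hKc hK1 hKne
    have hρ20 : 0 < ρ₂ := hρ0.trans hρ₂
    obtain ⟨κ₁, hκ₁, hk1⟩ := exists_pow_le_exp (div_pos hρ0 hρ10) ((div_lt_one hρ10).2 hρ₁)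
    obtain ⟨κ₂, hκ₂, hk2⟩ := exists_pow_le_exp (div_pos hρ0 hρ20) ((div_lt_one hρ20).2 hρ₂)
    -- One rate for the three contributions: the pole, the error near `z = 1`, and the region away
    -- from `z = 1`.
    set c := min (c₀ / 4) (min κ₁ κ₂) with hcdef
    have hc0 : 0 < c := lt_min (by positivity) (lt_min hκ₁ hκ₂)
    have hle : ∀ κ, c ≤ κ → ∀ (n : ℕ) (θ : Fin d → ℝ), Real.exp (-(κ * n * ‖θ‖ ^ 2)) ≤
        Real.exp (-(c / (d + 1) * n * ∑ k, θ k ^ 2)) := by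
      intro κ hκ n θ
      rw [Real.exp_le_exp, neg_le_neg_iff]
      calc c / (d + 1) * n * ∑ k, θ k ^ 2 ≤ c / (d + 1) * n * ((d + 1) * ‖θ‖ ^ 2) := by
            gcongr; exact sum_sq_le θ
        _ = c * n * ‖θ‖ ^ 2 := by field_simp
        _ ≤ _ := by gcongr
    refine ⟨B / ρ + |C₁| + |C₂|, c / (d + 1), by positivity, fun n θ hθ => ?_⟩
    set E := Real.exp (-(c / (d + 1) * n * ∑ k, θ k ^ 2)) with hE
    have hE0 : 0 ≤ E := (Real.exp_pos _).le
    rw [norm_mul, norm_pow, hnρ]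
    have herr : ∀ (C' ρ' : ℝ), 0 < ρ' → (ρ / ρ') ^ n ≤ E → ρ ^ n * (C' / ρ' ^ n) ≤ |C'| * E := by
      intro C' ρ' hρ' hEx
      calc ρ ^ n * (C' / ρ' ^ n) = C' * (ρ / ρ') ^ n := by rw [div_pow]; ring
        _ ≤ |C'| * (ρ / ρ') ^ n := by gcongr; exact le_abs_self _
        _ ≤ _ := by gcongr
    by_cases hθδ : ‖θ‖ < δ
    · obtain ⟨⟨h1, h2⟩, h3, h4⟩ := hall (y := θ) (by simpa using hθδ)
      have h5 := h1.2 (norm_torus_le θ) n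
      have h6 : ‖r (torus θ) * (T (torus θ) ^ (n + 1))⁻¹‖ ≤
          B * ((ρ ^ (n + 1))⁻¹ * Real.exp (-(c₀ / 4 * n * ‖θ‖ ^ 2))) := by
        rw [norm_mul, h2, mul_pow, mul_inv, norm_mul, norm_inv, norm_pow, hnρ, ← Complex.exp_nat_mul,
          ← Complex.exp_neg, Complex.norm_exp]
        -- The exponent is `n + 1`; the extra factor is dropped because `re W ≥ 0`.
        have h7 : (-(((n + 1 : ℕ) : ℂ) * W θ)).re ≤ -(c₀ / 4 * n * ‖θ‖ ^ 2) := by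
          rw [Complex.neg_re, ← Complex.ofReal_natCast, Complex.re_ofReal_mul, neg_le_neg_iff]
          push_cast
          have h8 : 0 ≤ c₀ / 4 * ‖θ‖ ^ 2 := by positivity
          have h9 : (0 : ℝ) ≤ n := Nat.cast_nonneg n
          nlinarith
        gcongr
      have h7 : ‖sliceCoeff F n (torus θ)‖ ≤ C₁ / ρ₁ ^ n +
          B * ((ρ ^ (n + 1))⁻¹ * Real.exp (-(c₀ / 4 * n * ‖θ‖ ^ 2))) := by
        have := norm_sub_le (sliceCoeff F n (torus θ) + r (torus θ) * (T (torus θ) ^ (n + 1))⁻¹)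
          (r (torus θ) * (T (torus θ) ^ (n + 1))⁻¹)
        rw [add_sub_cancel_right] at this
        linarith
      have h8 : ρ ^ n * (B * ((ρ ^ (n + 1))⁻¹ * Real.exp (-(c₀ / 4 * n * ‖θ‖ ^ 2)))) ≤ B / ρ * E := by
        have e : ρ ^ n * (B * ((ρ ^ (n + 1))⁻¹ * Real.exp (-(c₀ / 4 * n * ‖θ‖ ^ 2)))) =
            B / ρ * Real.exp (-(c₀ / 4 * n * ‖θ‖ ^ 2)) := by
          rw [pow_succ]; field_simp
        rw [e]
        have hB0 : 0 ≤ B / ρ := by positivity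
        exact mul_le_mul_of_nonneg_left (hle _ (min_le_left _ _) n θ) hB0
      have h9 := herr C₁ ρ₁ hρ10 ((hk1 d n θ hθ).trans
        (hle _ ((min_le_right _ _).trans (min_le_left _ _)) n θ))
      calc ρ ^ n * ‖sliceCoeff F n (torus θ)‖ ≤ ρ ^ n * (C₁ / ρ₁ ^ n +
          B * ((ρ ^ (n + 1))⁻¹ * Real.exp (-(c₀ / 4 * n * ‖θ‖ ^ 2)))) := by gcongr
        _ ≤ |C₁| * E + B / ρ * E := by rw [mul_add]; exact add_le_add h9 h8
        _ ≤ _ := by nlinarith [mul_nonneg (abs_nonneg C₂) hE0]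
    · have hmem : torus θ ∈ K := ⟨θ, ⟨⟨fun k => (hθ k (Set.mem_univ k)).1.le,
        fun k => (hθ k (Set.mem_univ k)).2⟩, not_lt.1 hθδ⟩, rfl⟩
      have h5 := hfar _ hmem n
      have h9 := herr C₂ ρ₂ hρ20 ((hk2 d n θ hθ).trans
        (hle _ ((min_le_right _ _).trans (min_le_right _ _)) n θ))
      have hB0 : 0 ≤ B / ρ := by positivity
      calc ρ ^ n * ‖sliceCoeff F n (torus θ)‖ ≤ ρ ^ n * (C₂ / ρ₂ ^ n) := by gcongr
        _ ≤ |C₂| * E := h9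
        _ ≤ _ := by nlinarith [mul_nonneg (abs_nonneg C₁) hE0, mul_nonneg hB0 hE0]
  · intro φ
    have hsqrt : Tendsto (fun n : ℕ => (√(n : ℝ))⁻¹) atTop (𝓝 0) :=
      tendsto_inv_atTop_zero.comp (Real.tendsto_sqrt_atTop.comp tendsto_natCast_atTop_atTop)
    have hθ0 : Tendsto (fun n : ℕ => (√(n : ℝ))⁻¹ • φ) atTop (𝓝 0) := by
      simpa using hsqrt.smul_const φ
    set θ : ℕ → Fin d → ℝ := fun n => (√(n : ℝ))⁻¹ • φ with hθdef
    set X : ℕ → ℂ := fun n =>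
      Complex.exp (-((√(n : ℝ) * (m ⬝ᵥ φ) : ℝ) * Complex.I)) with hX
    have hXn : ∀ n, ‖X n‖ = 1 := fun n => by
      rw [hX]; simp only
      rw [← neg_mul, ← Complex.ofReal_neg, Complex.norm_exp_ofReal_mul_I]
    set err : ℕ → ℂ := fun n => sliceCoeff F n (torus (θ n)) +
      r (torus (θ n)) * (T (torus (θ n)) ^ (n + 1))⁻¹ with herr
    have herr0 : Tendsto (fun n => (ρ : ℂ) ^ n * err n * X n) atTop (𝓝 0) := by
      have hg : Tendsto (fun n => C₁ * (ρ / ρ₁) ^ n) atTop (𝓝 0) := by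
        simpa using (tendsto_pow_atTop_nhds_zero_of_lt_one (div_pos hρ0 hρ10).le
          ((div_lt_one hρ10).2 hρ₁)).const_mul C₁
      refine squeeze_zero_norm' ?_ hg
      filter_upwards [hθ0.eventually hevθ] with n hn
      have h5 := hn.2 (norm_torus_le _) n
      rw [norm_mul, hXn, mul_one, norm_mul, norm_pow, hnρ]
      calc ρ ^ n * ‖err n‖ ≤ ρ ^ n * (C₁ / ρ₁ ^ n) := by gcongr
        _ = _ := by rw [div_pow]; ring
    have hrlim : Tendsto (fun n => r (torus (θ n))) atTop (𝓝 (r fun _ => 1)) :=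
      hrc.tendsto.comp (htor.comp hθ0)
    have hTlim : Tendsto (fun n => T (torus (θ n))) atTop (𝓝 (ρ : ℂ)) := by
      have := hTd.continuousAt.tendsto.comp (htor.comp hθ0)
      rwa [hT1] at this
    set V : (Fin d → ℝ) → ℂ := fun θ => W θ - (-((m ⬝ᵥ θ : ℝ) * Complex.I) +
      ((θ ⬝ᵥ (S *ᵥ θ) / 2 : ℝ) : ℂ)) with hV
    -- `V(θ) = o(‖θ‖²)` and `‖θ n‖² = ‖φ‖² / n`, so the error survives multiplication by `n`.
    have hVlim : Tendsto (fun n : ℕ => (n : ℂ) * V (θ n)) atTop (𝓝 0) := by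
      have h1 := hlit.comp_tendsto hθ0
      have h2 : (fun n => V (θ n)) =o[atTop] fun n : ℕ => ((n : ℝ))⁻¹ := by
        refine IsLittleO.trans_isBigO (g := fun n => ‖θ n‖ ^ 2) h1 ?_
        refine IsBigO.of_bound (‖φ‖ ^ 2) (.of_forall fun n => ?_)
        have e : ‖θ n‖ ^ 2 = ‖φ‖ ^ 2 * ((n : ℝ))⁻¹ := by
          rw [hθdef]
          simp only
          rw [norm_smul, norm_inv, Real.norm_of_nonneg (Real.sqrt_nonneg _), mul_pow, inv_pow,
            Real.sq_sqrt (Nat.cast_nonneg n), mul_comm]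
        rw [e, norm_mul, norm_pow, norm_norm]
      have h3 := (isBigO_refl (fun n : ℕ => (n : ℝ)) atTop).mul_isLittleO h2.norm_left
      have h4 : (fun n : ℕ => (n : ℝ) * ‖V (θ n)‖) =o[atTop] fun _ => (1 : ℝ) := by
        refine h3.trans_isBigO (IsBigO.of_bound 1 (.of_forall fun n => ?_))
        by_cases hn : (n : ℝ) = 0
        · simp [hn]
        · simp [mul_inv_cancel₀ hn]
      have h5 := (isLittleO_one_iff ℝ).1 h4
      rw [tendsto_zero_iff_norm_tendsto_zero]
      simpa using h5
    -- The pole term `-r T⁻ⁿ⁻¹`, multiplied by `ρⁿ` and recentred: the linear phase cancels, the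
    -- quadratic part of `n W` is exactly the Gaussian exponent, and only `exp (-n V)` is left over.
    have hmain : Tendsto (fun n : ℕ => -(r (torus (θ n)) * (T (torus (θ n)))⁻¹) *
        (Complex.exp (-((n : ℂ) * V (θ n))) * (Real.exp (-(φ ⬝ᵥ (S *ᵥ φ)) / 2) : ℝ))) atTop
        (𝓝 (-((r fun _ => 1) * (ρ : ℂ)⁻¹) *
          (Complex.exp (-0) * (Real.exp (-(φ ⬝ᵥ (S *ᵥ φ)) / 2) : ℝ)))) :=
      (hrlim.mul (hTlim.inv₀ hρc)).neg.mul
        (((Complex.continuous_exp.tendsto _).comp hVlim.neg).mul_const _)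
    have hval : G (fun _ => 1, (ρ : ℂ)) / (μ : ℂ) = -((r fun _ => 1) * (ρ : ℂ)⁻¹) := by
      have h1 := hm.deriv_diag_eq h
      rw [hr1, ← neg_eq_iff_eq_neg.2 h1]
      have hd0 : deriv (diag q qs) ρ ≠ 0 := by
        intro h0
        rw [h0, mul_zero, eq_comm, neg_eq_zero] at h1
        exact hm.mean_pos.ne' (by exact_mod_cast h1)
      field_simp
    rw [hval]
    have hsum := herr0.add hmain
    rw [zero_add, neg_zero, Complex.exp_zero, one_mul] at hsum
    refine hsum.congr' ?_
    filter_upwards [hθ0.eventually hTW, eventually_ge_atTop 1] with n hn hn1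
    have hn0 : (0 : ℝ) < n := by exact_mod_cast hn1
    have hs0 : 0 < √(n : ℝ) := Real.sqrt_pos.2 hn0
    have hkey : X n * Complex.exp (-((n : ℂ) * W (θ n))) =
        Complex.exp (-((n : ℂ) * V (θ n))) * (Real.exp (-(φ ⬝ᵥ (S *ᵥ φ)) / 2) : ℝ) := by
      have e1 : (n : ℝ) * (m ⬝ᵥ θ n) = √(n : ℝ) * (m ⬝ᵥ φ) := by
        rw [hθdef]
        simp only
        rw [dotProduct_smul, smul_eq_mul]
        nth_rewrite 1 [← Real.mul_self_sqrt hn0.le]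
        field_simp
      have e2 : (n : ℝ) * (θ n ⬝ᵥ (S *ᵥ θ n)) = φ ⬝ᵥ (S *ᵥ φ) := by
        rw [hθdef]
        simp only
        rw [Matrix.mulVec_smul, dotProduct_smul, smul_dotProduct, smul_eq_mul, smul_eq_mul,
          ← mul_assoc (√(n : ℝ))⁻¹, ← mul_inv, Real.mul_self_sqrt hn0.le,
          mul_inv_cancel_left₀ hn0.ne']
      rw [Complex.ofReal_exp, ← Complex.exp_add, ← Complex.exp_add, ← e1, ← e2, hV]
      congr 1
      push_cast
      ring
    have hT' : (T (torus (θ n)) ^ (n + 1))⁻¹ =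
        ((ρ : ℂ) ^ n)⁻¹ * Complex.exp (-((n : ℂ) * W (θ n))) * (T (torus (θ n)))⁻¹ := by
      rw [pow_succ, mul_inv]
      congr 1
      rw [hn, mul_pow, mul_inv, ← Complex.exp_nat_mul, Complex.exp_neg]
    have hρn : (ρ : ℂ) ^ n ≠ 0 := pow_ne_zero _ hρc
    change _ = (ρ : ℂ) ^ n * sliceCoeff (fun x => G x / denom q qs x) n (torus (θ n)) * X n
    rw [← hkey, herr]
    simp only
    rw [hT']
    field_simp
    ring

end Moments

end

/-! ### Maximal coefficients and normalisation -/

section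

/-- The set where `u` is at least the positive value `u i₀` is finite and non-empty, so the maximum
is attained on it. -/
theorem exists_forall_le_of_tendsto_cofinite {ι : Type*} {u : ι → ℝ}
    (hu : Tendsto u cofinite (𝓝 0)) {i₀ : ι} (h : 0 < u i₀) : ∃ i, ∀ j, u j ≤ u i := by
  have hfin : {j | u i₀ ≤ u j}.Finite := by
    have := hu.eventually (gt_mem_nhds h)
    rw [eventually_cofinite] at this
    simpa only [not_lt] using this
  obtain ⟨i, hi, hmax⟩ := Set.exists_max_image _ u hfin ⟨i₀, le_refl (u i₀)⟩
  refine ⟨i, fun j => ?_⟩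
  by_cases hj : u i₀ ≤ u j
  · exact hmax j hj
  · exact (not_le.1 hj).le.trans hi

theorem tendsto_sum_cofinite (d : ℕ) :
    Tendsto (fun s : Fin d → ℕ => ∑ k, s k) cofinite atTop := by
  refine tendsto_atTop.2 fun b => ?_
  rw [eventually_cofinite]
  refine (Set.finite_Icc (0 : Fin d → ℕ) fun _ => b).subset fun s hs => ?_
  refine ⟨fun _ => Nat.zero_le _, fun k => ?_⟩
  exact (Finset.single_le_sum (fun i _ => Nat.zero_le (s i)) (Finset.mem_univ k)).trans
    (not_le.1 hs).le

/-- An array which is uniformly close to a positive multiple of a weight `g ≤ 1` that comes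
arbitrarily close to `1` has asymptotically maximal entries. -/
theorem maxAsymptotic_of_uniform {d : ℕ} {φ : ℂ → ℝ} {f : (Fin d → ℕ) → ℕ → ℂ} {A : ℕ → ℂ}
    {g : ℕ → (Fin d → ℕ) → ℝ} {ε : ℕ → ℝ} {τ : ℕ → Fin d → ℕ} {a : ℕ → ℝ}
    (hφ : Continuous φ) (hφ0 : φ 0 = 0) (hφr : ∀ (w : ℂ) (r : ℝ), 0 ≤ r → |φ w - r| ≤ ‖w - r‖)
    (ha : ∀ᶠ n in atTop, 0 < a n ∧ ∀ s, φ (f s n) = a n * φ (f s n / A n))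
    (hg : ∀ n s, 0 ≤ g n s ∧ g n s ≤ 1) (hε : Tendsto ε atTop (𝓝 0))
    (hfg : ∀ᶠ n in atTop, ∀ s, ‖f s n / A n - g n s‖ ≤ ε n)
    (hτ : Tendsto (fun n => g n (τ n)) atTop (𝓝 1))
    (hf : ∀ n, Tendsto (fun s => f s n) cofinite (𝓝 0)) : MaxAsymptotic φ f A := by
  refine ⟨?_, fun σ hσ => ?_⟩
  · have h1 : Tendsto (fun n => g n (τ n) - ε n) atTop (𝓝 1) := by simpa using hτ.sub hε
    filter_upwards [ha, hfg, h1.eventually (lt_mem_nhds zero_lt_one)] with n han hn hpos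
    have h2 := (abs_le.1 ((hφr (f (τ n) n / A n) _ (hg n (τ n)).1).trans (hn (τ n)))).1
    have h3 : 0 < φ (f (τ n) n) := by
      rw [han.2]
      exact mul_pos han.1 (by linarith)
    have h4 : Tendsto (fun s => φ (f s n)) cofinite (𝓝 0) := by
      simpa [hφ0, Function.comp_def] using (hφ.tendsto 0).comp (hf n)
    exact exists_forall_le_of_tendsto_cofinite h4 h3
  · have hgσ : Tendsto (fun n => g n (σ n)) atTop (𝓝 1) := by
      -- Comparing the maximal entry with the entry at `τ n` costs one `ε n` at each of the two, so
      -- `g n (σ n) ≥ g n (τ n) - 2 ε n`.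
      have h1 : Tendsto (fun n => g n (τ n) - 2 * ε n) atTop (𝓝 1) := by
        simpa using hτ.sub (hε.const_mul 2)
      refine tendsto_of_tendsto_of_tendsto_of_le_of_le' h1 tendsto_const_nhds ?_
        (Eventually.of_forall fun n => (hg n _).2)
      filter_upwards [ha, hfg, hσ] with n han hn hσn
      have h2 := (abs_le.1 ((hφr (f (τ n) n / A n) _ (hg n (τ n)).1).trans (hn (τ n)))).1
      have h3 := (abs_le.1 ((hφr (f (σ n) n / A n) _ (hg n (σ n)).1).trans (hn (σ n)))).2
      have h4 := hσn (τ n)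
      rw [han.2, han.2, mul_le_mul_iff_right₀ han.1] at h4
      linarith
    have h5 : Tendsto (fun n => f (σ n) n / A n - (g n (σ n) : ℂ)) atTop (𝓝 0) :=
      squeeze_zero_norm' (hfg.mono fun n hn => hn _) hε
    have h6 : Tendsto (fun n => (g n (σ n) : ℂ)) atTop (𝓝 ((1 : ℝ) : ℂ)) :=
      (Complex.continuous_ofReal.tendsto 1).comp hgσ
    simpa using h5.add h6

theorem abs_norm_sub_le (w : ℂ) (r : ℝ) (hr : 0 ≤ r) : |‖w‖ - r| ≤ ‖w - r‖ := by
  have := abs_norm_sub_norm_le w (r : ℂ)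
  rwa [Complex.norm_of_nonneg hr] at this

theorem abs_re_sub_le (w : ℂ) (r : ℝ) : |w.re - r| ≤ ‖w - r‖ := by
  simpa using Complex.abs_re_le_norm (w - r)

theorem abs_dotProduct_mulVec_le {d : ℕ} (M : Matrix (Fin d) (Fin d) ℝ) {x : Fin d → ℝ}
    (hx : ∀ k, |x k| ≤ 1) : |x ⬝ᵥ (M *ᵥ x)| ≤ ∑ i, ∑ j, |M i j| := by
  have h1 : ∀ i, |(M *ᵥ x) i| ≤ ∑ j, |M i j| := by
    intro i
    change |∑ j, M i j * x j| ≤ _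
    refine (Finset.abs_sum_le_sum_abs (fun j => M i j * x j) Finset.univ).trans
      (Finset.sum_le_sum fun j _ => ?_)
    rw [abs_mul]
    exact mul_le_of_le_one_right (abs_nonneg _) (hx j)
  change |∑ i, x i * (M *ᵥ x) i| ≤ _
  refine (Finset.abs_sum_le_sum_abs (fun i => x i * (M *ᵥ x) i) Finset.univ).trans
    (Finset.sum_le_sum fun i _ => ?_)
  rw [abs_mul]
  exact (mul_le_of_le_one_left (abs_nonneg _) (hx i)).trans (h1 i)

/-- The Gaussian weight with covariance matrix `n • S`, centred at `n • m`. -/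
def gaussWeight {d : ℕ} (S : Matrix (Fin d) (Fin d) ℝ) (m : Fin d → ℝ) (n : ℕ)
    (s : Fin d → ℕ) : ℝ :=
  let x : Fin d → ℝ := fun k => s k - n * m k
  Real.exp (-(x ⬝ᵥ (S⁻¹ *ᵥ x)) / (2 * n))

theorem gaussWeight_le_one {d : ℕ} {S : Matrix (Fin d) (Fin d) ℝ} (hS : S.PosDef)
    (m : Fin d → ℝ) (n : ℕ) (s : Fin d → ℕ) : gaussWeight S m n s ≤ 1 := by
  refine Real.exp_le_one_iff.2 (div_nonpos_of_nonpos_of_nonneg (neg_nonpos.2 ?_) (by positivity))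
  simpa using hS.inv.posSemidef.dotProduct_mulVec_nonneg (fun k => (s k : ℝ) - n * m k)

/-- Rounding moves each coordinate by at most `1`, so the exponent is `O(1 / n)`. This supplies the
near-maximal test points `τ`. -/
theorem tendsto_gaussWeight_floor {d : ℕ} (S : Matrix (Fin d) (Fin d) ℝ) {m : Fin d → ℝ}
    (hm : ∀ k, 0 ≤ m k) :
    Tendsto (fun n : ℕ => gaussWeight S m n fun k => ⌊n * m k⌋₊) atTop (𝓝 1) := by
  have hx : ∀ (n : ℕ) k, |((⌊n * m k⌋₊ : ℕ) : ℝ) - n * m k| ≤ 1 := by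
    intro n k
    have h0 : 0 ≤ n * m k := mul_nonneg (Nat.cast_nonneg n) (hm k)
    rw [abs_le]
    constructor
    · linarith [Nat.lt_floor_add_one (n * m k)]
    · linarith [Nat.floor_le h0]
  set B := ∑ i, ∑ j, |S⁻¹ i j|
  have hexp : Tendsto (fun n : ℕ => -((fun k => ((⌊n * m k⌋₊ : ℕ) : ℝ) - n * m k) ⬝ᵥ
      (S⁻¹ *ᵥ fun k => ((⌊n * m k⌋₊ : ℕ) : ℝ) - n * m k)) / (2 * n)) atTop (𝓝 0) := by
    refine squeeze_zero_norm (a := fun n : ℕ => B / 2 / n) (fun n => ?_)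
      (tendsto_const_div_atTop_nhds_zero_nat _)
    rw [norm_div, norm_neg, Real.norm_eq_abs, Real.norm_of_nonneg (by positivity), div_div]
    gcongr
    exact abs_dotProduct_mulVec_le _ (hx n)
  simpa [gaussWeight, Function.comp_def] using (Real.continuous_exp.tendsto 0).comp hexp

variable {d : ℕ} {G : (Fin d → ℂ) × ℂ → ℂ} {q : ℂ → ℂ} {qs : Fin d → ℂ[X]}
  {ρ R a₀ a₁ a₂ : ℝ} {b₀ b₁ b₂ : Fin d → ℝ}

namespace Moments

theorem gauss_eq (hm : Moments q qs ρ a₀ a₁ a₂ b₀ b₁ b₂) (h : Admissible q qs ρ R)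
    (n : ℕ) (s : Fin d → ℕ) : gauss q qs ρ n s =
      (gaussWeight (covMatrix (a₁ + ∑ k, b₁ k) (a₂ + ∑ k, b₂ k) b₀ b₁)
        (fun k => b₀ k / (a₁ + ∑ k, b₁ k)) n s : ℂ) := by
  set S := covMatrix (a₁ + ∑ k, b₁ k) (a₂ + ∑ k, b₂ k) b₀ b₁
  set x : Fin d → ℝ := fun k => s k - n * (b₀ k / (a₁ + ∑ k, b₁ k)) with hx
  have hxC : (fun k => (s k : ℂ) - n * meanVec q qs ρ k) = Complex.ofRealHom ∘ x := by
    funext k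
    rw [hm.meanVec_eq h]
    simp [hx]
  have hquad : (Complex.ofRealHom ∘ x) ⬝ᵥ (S⁻¹.map Complex.ofRealHom *ᵥ (Complex.ofRealHom ∘ x)) =
      ((x ⬝ᵥ (S⁻¹ *ᵥ x) : ℝ) : ℂ) := by
    have h1 : S⁻¹.map Complex.ofRealHom *ᵥ (Complex.ofRealHom ∘ x) =
        Complex.ofRealHom ∘ (S⁻¹ *ᵥ x) := by
      funext i
      exact (RingHom.map_mulVec Complex.ofRealHom S⁻¹ x i).symm
    rw [h1]
    exact (RingHom.map_dotProduct Complex.ofRealHom x _).symm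
  simp only [gauss, gaussWeight]
  rw [hxC, hm.hessian_inv h]
  change Complex.exp (-((Complex.ofRealHom ∘ x) ⬝ᵥ
    (S⁻¹.map Complex.ofRealHom *ᵥ (Complex.ofRealHom ∘ x))) / (2 * n)) = _
  rw [hquad]
  push_cast
  rfl

theorem peak_eq (hm : Moments q qs ρ a₀ a₁ a₂ b₀ b₁ b₂) (h : Admissible q qs ρ R)
    (G : (Fin d → ℂ) × ℂ → ℂ) (n : ℕ) : peak G q qs ρ n =
      ((ρ ^ (-(n : ℤ)) * (n : ℝ) ^ (-(d : ℝ) / 2) *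
        ((a₁ + ∑ k, b₁ k) * (2 * Real.pi) ^ ((d : ℝ) / 2) *
          √(covMatrix (a₁ + ∑ k, b₁ k) (a₂ + ∑ k, b₂ k) b₀ b₁).det)⁻¹ : ℝ) : ℂ) *
        G (fun _ => 1, (ρ : ℂ)) := by
  have hdet := hm.posDef_covMatrix.det_pos
  have hsqrt : (hessian q qs ρ).det ^ (1 / 2 : ℂ) =
      ((√(covMatrix (a₁ + ∑ k, b₁ k) (a₂ + ∑ k, b₂ k) b₀ b₁).det : ℝ) : ℂ) := by
    rw [hm.hessian_det h, Real.sqrt_eq_rpow, Complex.ofReal_cpow hdet.le]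
    norm_num
  rw [peak, hsqrt, neg_mul, hm.deriv_diag_eq h, neg_neg, Complex.ofReal_mul _ (_⁻¹),
    Complex.ofReal_inv, Complex.ofReal_mul _ (√_), Complex.ofReal_mul (a₁ + _) _,
    div_eq_inv_mul (G _), mul_assoc (Complex.ofReal _) _⁻¹]

/-- The uniform local limit theorem for the coefficients. -/
theorem exists_uniform_limit (hm : Moments q qs ρ a₀ a₁ a₂ b₀ b₁ b₂) (h : Admissible q qs ρ R)
    (hG : AnalyticOnNhd ℂ G (polydisk d ρ)) (hG1 : G (fun _ => 1, (ρ : ℂ)) ≠ 0)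
    {f : (Fin d → ℕ) → ℕ → ℂ}
    (hf : ∀ n s, ∫ θ in cube d, sliceCoeff (fun x => G x / denom q qs x) n (torus θ) * phase s θ =
      (2 * (Real.pi : ℂ)) ^ d * f s n)
    (hF : ∀ z : Fin d → ℂ, ‖z‖ ≤ 1 → AnalyticAt ℂ (fun x => G x / denom q qs x) (z, 0)) :
    ∃ ε : ℕ → ℝ, Tendsto ε atTop (𝓝 0) ∧ ∀ n : ℕ, 1 ≤ n → ∀ s,
      ‖f s n / peak G q qs ρ n - gaussWeight (covMatrix (a₁ + ∑ k, b₁ k) (a₂ + ∑ k, b₂ k) b₀ b₁)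
        (fun k => b₀ k / (a₁ + ∑ k, b₁ k)) n s‖ ≤ ε n := by
  set μ := a₁ + ∑ k, b₁ k
  set S := covMatrix μ (a₂ + ∑ k, b₂ k) b₀ b₁
  have hμ : 0 < μ := hm.mean_pos
  have hS : S.PosDef := hm.posDef_covMatrix
  have hdet : 0 < √S.det := Real.sqrt_pos.2 hS.det_pos
  have h2π : (0 : ℝ) < 2 * Real.pi := by positivity
  obtain ⟨⟨C, c, hc, hb⟩, hlim⟩ := hm.sliceCoeff_asymptotics h hG
  have hcont : ∀ n : ℕ, Continuous fun θ : Fin d → ℝ =>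
      (ρ : ℂ) ^ n * sliceCoeff (fun x => G x / denom q qs x) n (torus θ) := fun n =>
    continuous_const.mul (continuous_iff_continuousAt.2 fun θ =>
      ((analyticAt_sliceCoeff (hF _ (norm_torus_le θ)) n).continuousAt.comp
        continuous_torus.continuousAt))
  obtain ⟨ε, hε, hle⟩ := local_limit hcont hS _ hc _ (fun n _ => hb n) hlim
  set B : ℂ := G (fun _ => 1, (ρ : ℂ)) / (μ : ℂ) *
    (((2 * Real.pi) ^ ((d : ℝ) / 2) / √S.det : ℝ) : ℂ) with hB
  have hB0 : B ≠ 0 := by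
    refine mul_ne_zero (div_ne_zero hG1 (by exact_mod_cast hμ.ne')) ?_
    exact_mod_cast (div_pos (Real.rpow_pos_of_pos h2π _) hdet).ne'
  refine ⟨fun n => ε n / ‖B‖, by simpa using hε.div_const ‖B‖, fun n hn s => ?_⟩
  have hn0 : (0 : ℝ) < n := by exact_mod_cast hn
  -- The normalisations of the torus integral and of `A_n` match: the product does not depend on
  -- `n`, and it is the value of the limiting Fourier integral at the centre.
  have hpk : (√n : ℂ) ^ d * ((ρ : ℂ) ^ n * (2 * (Real.pi : ℂ)) ^ d) * peak G q qs ρ n = B := by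
    rw [hm.peak_eq h, hB, ← mul_assoc, mul_comm (_ * _) (G _), div_mul_eq_mul_div, mul_div_assoc]
    congr 1
    rw [← Complex.ofReal_div]
    have hreal : √(n : ℝ) ^ d * (ρ ^ n * (2 * Real.pi) ^ d) *
        (ρ ^ (-(n : ℤ)) * (n : ℝ) ^ (-(d : ℝ) / 2) *
          (μ * (2 * Real.pi) ^ ((d : ℝ) / 2) * √S.det)⁻¹) =
        (2 * Real.pi) ^ ((d : ℝ) / 2) / √S.det / μ := by
      have e1 : (n : ℝ) ^ (-(d : ℝ) / 2) = (√(n : ℝ) ^ d)⁻¹ := by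
        rw [neg_div, Real.rpow_neg hn0.le, Real.sqrt_eq_rpow, ← Real.rpow_natCast,
          ← Real.rpow_mul hn0.le]
        congr 2
        ring
      have e2 : (2 * Real.pi) ^ d = ((2 * Real.pi) ^ ((d : ℝ) / 2)) ^ 2 := by
        rw [← Real.rpow_natCast (_ ^ _), ← Real.rpow_mul h2π.le, ← Real.rpow_natCast]
        congr 1
        push_cast
        ring
      have := h.pos.ne'
      have := (Real.rpow_pos_of_pos h2π ((d : ℝ) / 2)).ne'
      have := (Real.sqrt_pos.2 hn0).ne'
      rw [e1, e2, zpow_neg, zpow_natCast]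
      field_simp
    rw [← hreal]
    simp only [Complex.ofReal_mul, Complex.ofReal_pow, Complex.ofReal_ofNat]
    rfl
  have hpk0 : peak G q qs ρ n ≠ 0 := fun h0 => hB0 (by rw [← hpk, h0, mul_zero])
  have hq : f s n / peak G q qs ρ n =
      (√n : ℂ) ^ d * ((ρ : ℂ) ^ n * ((2 * (Real.pi : ℂ)) ^ d * f s n)) / B := by
    rw [div_eq_div_iff hpk0 hB0, ← hpk]
    ring
  have hint : ∫ θ in cube d, (ρ : ℂ) ^ n *
      sliceCoeff (fun x => G x / denom q qs x) n (torus θ) * phase s θ =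
      (ρ : ℂ) ^ n * ((2 * (Real.pi : ℂ)) ^ d * f s n) := by
    rw [← hf, ← MeasureTheory.integral_const_mul]
    simp only [mul_assoc]
  have hl := hle n hn s _ fun k => rfl
  rw [hint, Complex.ofReal_mul, ← mul_assoc (_ / _)] at hl
  rw [hq, le_div_iff₀ (norm_pos_iff.2 hB0), ← norm_mul, sub_mul, div_mul_cancel₀ _ hB0, mul_comm _ B]
  exact hl

theorem maxAsymptotic (hm : Moments q qs ρ a₀ a₁ a₂ b₀ b₁ b₂)
    {φ : ℂ → ℝ} {f : (Fin d → ℕ) → ℕ → ℂ} {A : ℕ → ℂ} {ε a : ℕ → ℝ}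
    (hφ : Continuous φ) (hφ0 : φ 0 = 0) (hφr : ∀ (w : ℂ) (r : ℝ), 0 ≤ r → |φ w - r| ≤ ‖w - r‖)
    (ha : ∀ᶠ n in atTop, 0 < a n ∧ ∀ s, φ (f s n) = a n * φ (f s n / A n))
    (hε : Tendsto ε atTop (𝓝 0))
    (hfg : ∀ n : ℕ, 1 ≤ n → ∀ s, ‖f s n / A n -
      gaussWeight (covMatrix (a₁ + ∑ k, b₁ k) (a₂ + ∑ k, b₂ k) b₀ b₁)
        (fun k => b₀ k / (a₁ + ∑ k, b₁ k)) n s‖ ≤ ε n)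
    (hf : ∀ n, Tendsto (fun s => f s n) cofinite (𝓝 0)) : MaxAsymptotic φ f A :=
  maxAsymptotic_of_uniform hφ hφ0 hφr ha
    (fun n s => ⟨(Real.exp_pos _).le, gaussWeight_le_one hm.posDef_covMatrix _ n s⟩) hε
    ((eventually_ge_atTop 1).mono hfg)
    (tendsto_gaussWeight_floor _ fun k => (div_pos (hm.b0_pos k) hm.mean_pos).le) hf

theorem exists_peak_eq (hm : Moments q qs ρ a₀ a₁ a₂ b₀ b₁ b₂) (h : Admissible q qs ρ R)
    (G : (Fin d → ℂ) × ℂ → ℂ) : ∃ K : ℕ → ℝ, (∀ n, 1 ≤ n → 0 < K n) ∧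
      ∀ n, peak G q qs ρ n = K n * G (fun _ => 1, (ρ : ℂ)) := by
  refine ⟨_, fun n hn => ?_, hm.peak_eq h G⟩
  have hn0 : (0 : ℝ) < n := by exact_mod_cast hn
  have h2π : (0 : ℝ) < 2 * Real.pi := by positivity
  exact mul_pos (mul_pos (zpow_pos h.pos _) (Real.rpow_pos_of_pos hn0 _)) (inv_pos.2
    (mul_pos (mul_pos hm.mean_pos (Real.rpow_pos_of_pos h2π _))
      (Real.sqrt_pos.2 hm.posDef_covMatrix.det_pos)))

end Moments

/-- The real numbers `w n / K n` tend to `g`, and the real line is closed. -/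
theorem im_eq_zero_of_tendsto_div {w K : ℕ → ℝ} {A : ℕ → ℂ} {g : ℂ} (hA : ∀ n, A n = K n * g)
    (hg : g ≠ 0) (h : Tendsto (fun n => (w n : ℂ) / A n) atTop (𝓝 1)) : g.im = 0 := by
  have h1 : Tendsto (fun n => ((w n / K n : ℝ) : ℂ)) atTop (𝓝 g) := by
    have := h.mul_const g
    rw [one_mul] at this
    refine this.congr fun n => ?_
    rw [hA, Complex.ofReal_div, ← div_div, div_mul_cancel₀ _ hg]
  have h2 := (Complex.continuous_im.tendsto g).comp h1
  simp only [Function.comp_def, Complex.ofReal_im] at h2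
  exact tendsto_nhds_unique h2 tendsto_const_nhds

end

end LinearLCLT

end
-- Assembly of the theorem
theorem theorem4p3 (d : ℕ) (G : (Fin d → ℂ) × ℂ → ℂ) (q : ℂ → ℂ) (qs : Fin d → ℂ[X]) (ρ : ℝ)
    -- `ρ` is the smallest positive root of `P`
    (hρ : 0 < ρ) (hroot : LinearLCLT.diag q qs ρ = 0)
    (hmin : ∀ x : ℝ, 0 < x → x < ρ → LinearLCLT.diag q qs x ≠ 0)
    -- the `q_k` are nonzero polynomials vanishing at the origin
    (hqs : ∀ k, qs k ≠ 0) (hqs0 : ∀ k, (qs k).eval 0 = 0)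
    -- `q` is analytic for `|t| ≤ ρ` and vanishes at the origin
    (hq : AnalyticOnNhd ℂ q (Metric.closedBall 0 ρ)) (hq0 : q 0 = 0)
    -- the series of `q(t) + ∑ k, q_k(t) z_k` has non-negative (real) coefficients
    (hqs_nonneg : ∀ k n, 0 ≤ (qs k).coeff n) (hq_nonneg : ∀ n, 0 ≤ LinearLCLT.taylorCoeff q n)
    -- the exponents appearing in `q` have greatest common divisor `1`
    (hgcd : ∀ m : ℕ, (∀ n, LinearLCLT.taylorCoeff q n ≠ 0 → m ∣ n) → m = 1)
    -- the numerator is analytic on (a neighbourhood of) the closed polydisk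
    (hG : AnalyticOnNhd ℂ G (LinearLCLT.polydisk d ρ))
    (hG1 : G (fun _ => 1, (ρ : ℂ)) ≠ 0)
    -- `f s n = [z ^ s t ^ n] F(z, t)`
    (f : (Fin d → ℕ) → ℕ → ℂ)
    (hf : LinearLCLT.HasExpansion (fun x => G x / LinearLCLT.denom q qs x) f) :
    (LinearLCLT.hessian q qs ρ).det = LinearLCLT.hessianDet q qs ρ ∧
    0 < (LinearLCLT.hessian q qs ρ).det ∧
    LinearLCLT.MaxAsymptotic (fun w => ‖w‖) f (LinearLCLT.peak G q qs ρ) ∧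
    ((∀ s n, (f s n).im = 0) → 0 < (G (fun _ => 1, (ρ : ℂ))).re →
      LinearLCLT.MaxAsymptotic Complex.re f (LinearLCLT.peak G q qs ρ)) ∧
    Tendsto (fun n : ℕ => ⨆ s : Fin d → ℕ,
      ‖f s n / LinearLCLT.peak G q qs ρ n - LinearLCLT.gauss q qs ρ n s‖ₑ) atTop (𝓝 0) := by
  obtain ⟨R, h⟩ := LinearLCLT.exists_admissible hρ hroot hqs hq hqs_nonneg hq_nonneg hgcd
  obtain ⟨a₀, a₁, a₂, b₀, b₁, b₂, hm⟩ := h.exists_moments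
  have hF : ∀ z : Fin d → ℂ, ‖z‖ ≤ 1 →
      AnalyticAt ℂ (fun x => G x / LinearLCLT.denom q qs x) (z, 0) := by
    intro z hz
    refine h.analyticAt_div ⟨⟨hG _ ⟨fun k => (norm_le_pi_norm z k).trans hz, ?_⟩, ?_⟩, ?_⟩
    · simpa using hρ.le
    · simpa using hρ.trans h.lt
    -- At `t = 0` the denominator equals `1` for every `z`.
    · simp [LinearLCLT.denom, hq0, hqs0]
  have hco := LinearLCLT.coeff_eq_integral hF hf
  obtain ⟨ε, hε, hle⟩ := hm.exists_uniform_limit h hG hG1 (fun n => (hco n).1) hF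
  have hdecay : ∀ n, Tendsto (fun s => f s n) cofinite (𝓝 0) := by
    intro n
    obtain ⟨C, R', hR', hb⟩ := (hco n).2
    refine squeeze_zero_norm hb ?_
    exact tendsto_const_nhds.div_atTop
      ((tendsto_pow_atTop_atTop_of_one_lt hR').comp (LinearLCLT.tendsto_sum_cofinite d))
  obtain ⟨K, hK, hKeq⟩ := hm.exists_peak_eq h G
  have hmax : LinearLCLT.MaxAsymptotic (fun w => ‖w‖) f (LinearLCLT.peak G q qs ρ) := by
    refine hm.maxAsymptotic (a := fun n => ‖LinearLCLT.peak G q qs ρ n‖) continuous_norm norm_zero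
      LinearLCLT.abs_norm_sub_le ?_ hε hle hdecay
    filter_upwards [eventually_ge_atTop 1] with n hn
    have h0 : 0 < ‖LinearLCLT.peak G q qs ρ n‖ := by
      rw [hKeq, norm_pos_iff]
      exact mul_ne_zero (by exact_mod_cast (hK n hn).ne') hG1
    refine ⟨h0, fun s => ?_⟩
    rw [norm_div, mul_div_cancel₀ _ h0.ne']
  refine ⟨hm.det_eq_hessianDet h, ?_, hmax, fun hreal hGre => ?_, ?_⟩
  · rw [hm.hessian_det h]
    exact_mod_cast hm.posDef_covMatrix.det_pos
  -- Only the real part of `G(1, ρ)` is assumed positive. That `G(1, ρ)` is real follows from the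
  -- asymptotics of the entries of largest modulus, since these are real and `A_n` is a real
  -- multiple of `G(1, ρ)`.
  · have him : (G (fun _ => 1, (ρ : ℂ))).im = 0 := by
      obtain ⟨σ, hσ⟩ := hmax.1.choice
      have h1 := hmax.2 σ hσ
      refine LinearLCLT.im_eq_zero_of_tendsto_div (w := fun n => (f (σ n) n).re) hKeq hG1 ?_
      refine h1.congr fun n => ?_
      rw [Complex.ext (Complex.ofReal_re _) ((Complex.ofReal_im _).trans (hreal (σ n) n).symm)]
    have hGr : G (fun _ => 1, (ρ : ℂ)) = ((G (fun _ => 1, (ρ : ℂ))).re : ℂ) :=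
      Complex.ext rfl him
    refine hm.maxAsymptotic (a := fun n => K n * (G (fun _ => 1, (ρ : ℂ))).re)
      Complex.continuous_re Complex.zero_re (fun w r _ => LinearLCLT.abs_re_sub_le w r) ?_ hε hle
      hdecay
    filter_upwards [eventually_ge_atTop 1] with n hn
    have h0 := mul_pos (hK n hn) hGre
    refine ⟨h0, fun s => ?_⟩
    rw [hKeq, hGr, ← Complex.ofReal_mul, Complex.div_ofReal_re, Complex.ofReal_re,
      mul_div_cancel₀ _ h0.ne']
  · have h1 : Tendsto (fun n => ENNReal.ofReal (ε n)) atTop (𝓝 0) := by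
      simpa using ENNReal.tendsto_ofReal hε
    refine tendsto_of_tendsto_of_tendsto_of_le_of_le' tendsto_const_nhds h1
      (Eventually.of_forall fun n => bot_le) ?_
    filter_upwards [eventually_ge_atTop 1] with n hn
    refine iSup_le fun s => ?_
    rw [hm.gauss_eq h, ← ofReal_norm]
    exact ENNReal.ofReal_le_ofReal (hle n hn s)
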